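/- Let $n\ge 2$, let $\Omega\subset\mathbb R^n$ be a bounded domain (open, connected) with Lipschitz boundary, let $A\subset\subset\Omega$ be an open set with Lipschitz boundary and finitely many connected components such that $B:=\Omega\setminus\overline A$ is a domain, and let $1<q_0<p_0\le p<\infty$, $q_0\le q<\infty$. Let $Q_B:B\times[0,\infty)\to\mathbb R$ and $Q_A:A\times[0,\infty)\to\mathbb R$ satisfy: (A1) $Q_B$, $Q_A$ are Carathéodory functions (measurable in $x$ for every $E\ge0$, continuous in $E$ for a.e. $x$); (A2) for a.e. $x$ in $B$, respectively in $A$, the functions $E\mapsto Q_B(x,E)$ and $E\mapsto Q_A(x,E)$ are nonnegative, $C^1$ and strictly convex on $[0,\infty)$ and vanish at $E=0$; (A3) there are constants $0<\underline Q\le\overline Q$ and $E_0>0$ such that, for all $E\ge 0$, $$\underline Q\max\{(E/E_0)^{p_0},(E/E_0)^{p}\}\le Q_B(x,E)\le\overline Q\max\{(E/E_0)^{p_0},(E/E_0)^{p}\}\quad\text{for a.e. }x\in B,$$ $$\underline Q\max\{(E/E_0)^{q_0},(E/E_0)^{q}\}\le Q_A(x,E)\le\overline Q\max\{(E/E_0)^{q_0},(E/E_0)^{q}\}\quad\text{for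 a.e. }x\in A;$$ (A4) there is $\beta_0\in L^\infty(B)$ with $\beta_0\ge c_0$ a.e. in $B$ for some constant $c_0>0$, such that $\lim_{E\to0^+}Q_B(x,E)/E^{p_0}=\beta_0(x)$ for a.e. $x\in B$. Let the boundary datum be given by $f\in W^{1,p}(\Omega)$. For functions $v$ and $g$ on $\Omega$, "$v=g$ on $\partial\Omega$" means that $v-g\in W^{1,s}_0(\Omega)$, where $W^{1,s}(\Omega)$ is the space in which $v$ is sought (for a union of two such spaces, that $v-g$ lies in the union of the two corresponding spaces $W^{1,s}_0(\Omega)$). Consider the problem $$\min\Big\{\int_B\beta_0|\nabla v|^{p_0}\,dx:\ v\in W^{1,p_0}(\Omega),\ v=f\text{ on }\partial\Omega,\ |\nabla v|=0\text{ a.e. in }A\Big\}.\tag{H}$$ Then (H) has a solution $w^0\in W^{1,p_0}(\Omega)$, which is unique (up to equality a.e. in $\Omega$), and the following holds. For every $\lambda>0$ let $v^\lambda$ be the minimizer of $$\mathbb G_0^\lambda(v)=\frac1{\lambda^{p_0}}\Big(\int_BQ_B(x,\lambda|\nabla v|)\,dx+\int_AQ_A(x,\lambda|\nabla v|)\,dx\Big)$$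 over all $v\in W^{1,q_0}(\Omega)$ with $v=f$ on $\partial\Omega$. Then (i) $v^\lambda\rightharpoonup w^0$ weakly in $W^{1,p_0}(B)$ as $\lambda\to0^+$; (ii) $v^\lambda\to w^0$ strongly in $W^{1,q_0}(A)$ as $\lambda\to0^+$; (iii) $v^\lambda\rightharpoonup w^0$ weakly in $W^{1,q_0}(\Omega)$ as $\lambda\to0^+$. The same three convergences, with the same $w^0$, hold for the normalized solutions $v^\lambda=u^\lambda/\lambda$, where for every $\lambda>0$ the function $u^\lambda$ minimizes $\int_BQ_B(x,|\nabla u|)\,dx+\int_AQ_A(x,|\nabla u|)\,dx$ over all $u\in W^{1,p}(\Omega)\cup W^{1,q}(\Omega)$ with $u=\lambda f$ on $\partial\Omega$. -/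

import Mathlib

open Set Filter Topology MeasureTheory
open scoped ENNReal NNReal ContDiff

/-- `φ` is a `C^∞` function with compact support contained in `U`. -/
def IsTestFunction {n : ℕ} (U : Set (EuclideanSpace ℝ (Fin n)))
    (φ : EuclideanSpace ℝ (Fin n) → ℝ) : Prop :=
  ContDiff ℝ ∞ φ ∧ HasCompactSupport φ ∧ tsupport φ ⊆ U

/-- `g` is the weak gradient of `u` in the open set `U`: both are locally integrable in `U`, and
`∫_U u ∇φ = - ∫_U φ g` for all test functions `φ`. -/
def HasWeakGradient {n : ℕ} (U : Set (EuclideanSpace ℝ (Fin n)))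
    (u : EuclideanSpace ℝ (Fin n) → ℝ)
    (g : EuclideanSpace ℝ (Fin n) → EuclideanSpace ℝ (Fin n)) : Prop :=
  LocallyIntegrableOn u U volume ∧ LocallyIntegrableOn g U volume ∧
    ∀ φ : EuclideanSpace ℝ (Fin n) → ℝ, IsTestFunction U φ →
      ∫ x in U, u x • gradient φ x = - ∫ x in U, φ x • g x

open Classical in
/-- The weak gradient `∇u` of `u` in `U` (determined almost everywhere in `U` when it exists, and
set to zero when it does not). -/
noncomputable def weakGrad {n : ℕ} (U : Set (EuclideanSpace ℝ (Fin n)))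
    (u : EuclideanSpace ℝ (Fin n) → ℝ) : EuclideanSpace ℝ (Fin n) → EuclideanSpace ℝ (Fin n) :=
  if h : ∃ g, HasWeakGradient U u g then h.choose else 0

/-- `u` (restricted to `U`) belongs to the Sobolev space `W^{1,s}(U)`. -/
def MemSobolev {n : ℕ} (s : ℝ) (U : Set (EuclideanSpace ℝ (Fin n)))
    (u : EuclideanSpace ℝ (Fin n) → ℝ) : Prop :=
  MemLp u (ENNReal.ofReal s) (volume.restrict U) ∧
    ∃ g, HasWeakGradient U u g ∧ MemLp g (ENNReal.ofReal s) (volume.restrict U)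

/-- The Sobolev norm `‖u‖_{L^s(U)} + ‖∇u‖_{L^s(U)}` of a function `u` in `W^{1,s}(U)`. -/
noncomputable def sobolevENorm {n : ℕ} (s : ℝ) (U : Set (EuclideanSpace ℝ (Fin n)))
    (u : EuclideanSpace ℝ (Fin n) → ℝ) : ℝ≥0∞ :=
  eLpNorm u (ENNReal.ofReal s) (volume.restrict U) +
    eLpNorm (weakGrad U u) (ENNReal.ofReal s) (volume.restrict U)

/-- `u` belongs to `W^{1,s}_0(U)`, the closure in `W^{1,s}(U)` of the `C^1` functions with compact
support in `U`. -/
def MemSobolevZero {n : ℕ} (s : ℝ) (U : Set (EuclideanSpace ℝ (Fin n)))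
    (u : EuclideanSpace ℝ (Fin n) → ℝ) : Prop :=
  MemSobolev s U u ∧ ∃ φ : ℕ → EuclideanSpace ℝ (Fin n) → ℝ,
    (∀ k, ContDiff ℝ 1 (φ k) ∧ HasCompactSupport (φ k) ∧ tsupport (φ k) ⊆ U) ∧
    Tendsto (fun k => sobolevENorm s U (u - φ k)) atTop (𝓝 0)

theorem IsTestFunction.continuous_gradient {n : ℕ} {U : Set (EuclideanSpace ℝ (Fin n))}
    {φ : EuclideanSpace ℝ (Fin n) → ℝ} (hφ : IsTestFunction U φ) :
    Continuous (gradient φ) := by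
  have h : Continuous (fderiv ℝ φ) := hφ.1.continuous_fderiv (by simp)
  exact (InnerProductSpace.toDual ℝ (EuclideanSpace ℝ (Fin n))).symm.continuous.comp h

theorem IsTestFunction.hasCompactSupport_gradient {n : ℕ} {U : Set (EuclideanSpace ℝ (Fin n))}
    {φ : EuclideanSpace ℝ (Fin n) → ℝ} (hφ : IsTestFunction U φ) :
    HasCompactSupport (gradient φ) := by
  have h : HasCompactSupport (fderiv ℝ φ) := hφ.2.1.fderiv ℝ
  exact h.comp_left (g := (InnerProductSpace.toDual ℝ (EuclideanSpace ℝ (Fin n))).symm) (map_zero _)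

theorem MeasureTheory.MemLp.locallyIntegrableOn_of_restrict {n : ℕ} {F : Type*}
    [NormedAddCommGroup F] {s : ℝ≥0∞} (hs : 1 ≤ s) {U : Set (EuclideanSpace ℝ (Fin n))}
    {u : EuclideanSpace ℝ (Fin n) → F} (hu : MemLp u s (volume.restrict U)) :
    LocallyIntegrableOn u U volume :=
  locallyIntegrableOn_of_locallyIntegrable_restrict (hu.locallyIntegrable hs)

/-- The Banach space `W^{1,s}(U)`: the pairs `(u, ∇u)` in `L^s(U) × L^s(U; ℝⁿ)`, with the norm
induced by the product. -/
def sobolevSpace {n : ℕ} (s : ℝ≥0∞) [hs : Fact (1 ≤ s)] (U : Set (EuclideanSpace ℝ (Fin n))) :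
    Submodule ℝ (Lp ℝ s (volume.restrict U) ×
      Lp (EuclideanSpace ℝ (Fin n)) s (volume.restrict U)) where
  carrier := {P | HasWeakGradient U P.1 P.2}
  zero_mem' := by
    refine ⟨(Lp.memLp _).locallyIntegrableOn_of_restrict hs.out,
      (Lp.memLp _).locallyIntegrableOn_of_restrict hs.out, fun φ _ => ?_⟩
    have h1 : ∫ x in U, ((0 : Lp ℝ s (volume.restrict U)) x) • gradient φ x = 0 := by
      rw [← integral_zero (EuclideanSpace ℝ (Fin n)) (EuclideanSpace ℝ (Fin n))
        (μ := volume.restrict U)]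
      refine integral_congr_ae ?_
      filter_upwards [Lp.coeFn_zero ℝ s (volume.restrict U)] with x hx
      rw [hx]; simp
    have h2 : ∫ x in U, φ x •
        ((0 : Lp (EuclideanSpace ℝ (Fin n)) s (volume.restrict U)) x) = 0 := by
      rw [← integral_zero (EuclideanSpace ℝ (Fin n)) (EuclideanSpace ℝ (Fin n))
        (μ := volume.restrict U)]
      refine integral_congr_ae ?_
      filter_upwards [Lp.coeFn_zero (EuclideanSpace ℝ (Fin n)) s (volume.restrict U)] with x hx
      rw [hx]; simp
    exact h1.trans (neg_eq_zero.mpr h2).symm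
  add_mem' := by
    intro P R hP hR
    refine ⟨(Lp.memLp _).locallyIntegrableOn_of_restrict hs.out,
      (Lp.memLp _).locallyIntegrableOn_of_restrict hs.out, fun φ hφ => ?_⟩
    have hi1 : ∀ u : Lp ℝ s (volume.restrict U),
        Integrable (fun x => u x • gradient φ x) (volume.restrict U) := fun u =>
      ((Lp.memLp u).locallyIntegrable hs.out).integrable_smul_right_of_hasCompactSupport
        hφ.continuous_gradient hφ.hasCompactSupport_gradient
    have hi2 : ∀ g : Lp (EuclideanSpace ℝ (Fin n)) s (volume.restrict U),
        Integrable (fun x => φ x • g x) (volume.restrict U) := fun g =>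
      ((Lp.memLp g).locallyIntegrable hs.out).integrable_smul_left_of_hasCompactSupport
        hφ.1.continuous hφ.2.1
    have h1 : ∫ x in U, (P + R).1 x • gradient φ x =
        ∫ x in U, P.1 x • gradient φ x + R.1 x • gradient φ x := by
      refine integral_congr_ae ?_
      filter_upwards [Lp.coeFn_add P.1 R.1] with x hx
      simp only [Prod.fst_add, hx, Pi.add_apply, add_smul]
    have h2 : ∫ x in U, φ x • (P + R).2 x = ∫ x in U, φ x • P.2 x + φ x • R.2 x := by
      refine integral_congr_ae ?_
      filter_upwards [Lp.coeFn_add P.2 R.2] with x hx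
      simp only [Prod.snd_add, hx, Pi.add_apply, smul_add]
    rw [h1, h2, integral_add (hi1 _) (hi1 _), integral_add (hi2 _) (hi2 _), hP.2.2 φ hφ,
      hR.2.2 φ hφ, neg_add]
  smul_mem' := by
    intro c P hP
    refine ⟨(Lp.memLp _).locallyIntegrableOn_of_restrict hs.out,
      (Lp.memLp _).locallyIntegrableOn_of_restrict hs.out, fun φ hφ => ?_⟩
    have h1 : ∫ x in U, (c • P).1 x • gradient φ x = ∫ x in U, c • (P.1 x • gradient φ x) := by
      refine integral_congr_ae ?_
      filter_upwards [Lp.coeFn_smul c P.1] with x hx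
      simp only [Prod.smul_fst, hx, Pi.smul_apply, smul_eq_mul, mul_smul]
    have h2 : ∫ x in U, φ x • (c • P).2 x = ∫ x in U, c • (φ x • P.2 x) := by
      refine integral_congr_ae ?_
      filter_upwards [Lp.coeFn_smul c P.2] with x hx
      simp only [Prod.smul_snd, hx, Pi.smul_apply]
      rw [smul_comm]
    rw [h1, h2, integral_smul, integral_smul, hP.2.2 φ hφ, smul_neg]

/-- `v^t ⇀ w` in `W^{1,s}(U)` as `t → 0⁺`: the functions `v^t` (`t > 0`) and `w` restricted to `U`
belong to `W^{1,s}(U)`, and there is convergence in its weak topology. -/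
def SobolevWeakTendsto {n : ℕ} (s : ℝ) (hs : 1 ≤ s) (U : Set (EuclideanSpace ℝ (Fin n)))
    (v : ℝ → EuclideanSpace ℝ (Fin n) → ℝ) (w : EuclideanSpace ℝ (Fin n) → ℝ) : Prop :=
  haveI : Fact (1 ≤ ENNReal.ofReal s) := ⟨ENNReal.one_le_ofReal.mpr hs⟩
  ∃ (V : ℝ → sobolevSpace (ENNReal.ofReal s) U) (W : sobolevSpace (ENNReal.ofReal s) U),
    (∀ t > 0, (V t).1.1 =ᵐ[volume.restrict U] v t) ∧ W.1.1 =ᵐ[volume.restrict U] w ∧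
    Tendsto (fun t => toWeakSpace ℝ (sobolevSpace (ENNReal.ofReal s) U) (V t)) (𝓝[>] 0)
      (𝓝 (toWeakSpace ℝ (sobolevSpace (ENNReal.ofReal s) U) W))

/-- `v^t → w` in the norm of `W^{1,s}(U)` as `t → 0⁺`, where the functions `v^t` (`t > 0`) and `w`
restricted to `U` belong to `W^{1,s}(U)`. -/
def SobolevStrongTendsto {n : ℕ} (s : ℝ) (U : Set (EuclideanSpace ℝ (Fin n)))
    (v : ℝ → EuclideanSpace ℝ (Fin n) → ℝ) (w : EuclideanSpace ℝ (Fin n) → ℝ) : Prop :=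
  (∀ t > 0, MemSobolev s U (v t)) ∧ MemSobolev s U w ∧
    Tendsto (fun t => sobolevENorm s U (v t - w)) (𝓝[>] 0) (𝓝 0)

/-- The set `U` has Lipschitz boundary: near each of its boundary points, `U` is the set of points
lying above the graph of a Lipschitz function, in the direction of some unit vector `e` (the
Lipschitz function `γ` is only evaluated on the hyperplane orthogonal to `e`). -/
def HasLipschitzBoundary {n : ℕ} (U : Set (EuclideanSpace ℝ (Fin n))) : Prop :=
  ∀ x ∈ frontier U, ∃ (e : EuclideanSpace ℝ (Fin n)) (γ : EuclideanSpace ℝ (Fin n) → ℝ)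
    (K : ℝ≥0) (δ : ℝ), ‖e‖ = 1 ∧ LipschitzWith K γ ∧ 0 < δ ∧
      ∀ y ∈ Metric.ball x δ, y ∈ U ↔ γ (y - inner ℝ e y • e) < inner ℝ e y

/-- The geometric setting: `Ω` is a bounded domain with Lipschitz boundary, `A ⊂⊂ Ω` is an open
set with Lipschitz boundary and finitely many connected components, and `Ω \ closure A` is a
domain. -/
structure IsTwoPhaseDomain {n : ℕ} (Ω A : Set (EuclideanSpace ℝ (Fin n))) : Prop where
  isOpen_Ω : IsOpen Ω
  isConnected_Ω : IsConnected Ω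
  isBounded_Ω : Bornology.IsBounded Ω
  lipschitz_Ω : HasLipschitzBoundary Ω
  isOpen_A : IsOpen A
  closure_A_subset : closure A ⊆ Ω
  lipschitz_A : HasLipschitzBoundary A
  finite_components_A : Finite (ConnectedComponents A)
  isConnected_B : IsConnected (Ω \ closure A)

/-- Structural assumptions on the density `Q` in the region `D`: `Q` is a Carathéodory function, and
for a.e. `x ∈ D` the function `Q(x,·)` is nonnegative, `C^1` and strictly convex on `[0,∞)`, with
`Q(x,0) = 0`. -/
structure IsEnergyDensity {n : ℕ} (D : Set (EuclideanSpace ℝ (Fin n)))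
    (Q : EuclideanSpace ℝ (Fin n) → ℝ → ℝ) : Prop where
  measurable : ∀ E : ℝ, 0 ≤ E → AEMeasurable (fun x => Q x E) (volume.restrict D)
  continuous : ∀ᵐ x ∂(volume.restrict D), ContinuousOn (Q x) (Ici 0)
  nonneg : ∀ᵐ x ∂(volume.restrict D), ∀ E : ℝ, 0 ≤ E → 0 ≤ Q x E
  contDiff : ∀ᵐ x ∂(volume.restrict D), ContDiffOn ℝ 1 (Q x) (Ici 0)
  strictConvex : ∀ᵐ x ∂(volume.restrict D), StrictConvexOn ℝ (Ici 0) (Q x)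
  map_zero : ∀ᵐ x ∂(volume.restrict D), Q x 0 = 0

/-- Growth of `Q` in the region `D`, with small-field exponent `s₀` and large-field exponent `s`:
`Qlow * max ((E/E₀)^s₀) ((E/E₀)^s) ≤ Q x E ≤ Qup * max ((E/E₀)^s₀) ((E/E₀)^s)`. -/
def HasTwoPowerGrowth {n : ℕ} (D : Set (EuclideanSpace ℝ (Fin n)))
    (Q : EuclideanSpace ℝ (Fin n) → ℝ → ℝ) (s₀ s Qlow Qup E₀ : ℝ) : Prop :=
  ∀ᵐ x ∂(volume.restrict D), ∀ E : ℝ, 0 ≤ E →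
    Qlow * max ((E / E₀) ^ s₀) ((E / E₀) ^ s) ≤ Q x E ∧
    Q x E ≤ Qup * max ((E / E₀) ^ s₀) ((E / E₀) ^ s)

/-- `β ∈ L^∞_+(D)`: essentially bounded, and bounded below by a positive constant. -/
def MemLinftyPos {n : ℕ} (D : Set (EuclideanSpace ℝ (Fin n)))
    (β : EuclideanSpace ℝ (Fin n) → ℝ) : Prop :=
  MemLp β ⊤ (volume.restrict D) ∧ ∃ c : ℝ, 0 < c ∧ ∀ᵐ x ∂(volume.restrict D), c ≤ β x

/-- Behaviour of `Q` for small fields in the region `D`: `β ∈ L^∞_+(D)` and `Q(x,E) / E^s₀ → β(x)` as `E → 0⁺`. -/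
def HasSmallFieldLimit {n : ℕ} (D : Set (EuclideanSpace ℝ (Fin n)))
    (Q : EuclideanSpace ℝ (Fin n) → ℝ → ℝ) (s₀ : ℝ)
    (β : EuclideanSpace ℝ (Fin n) → ℝ) : Prop :=
  MemLinftyPos D β ∧
    ∀ᵐ x ∂(volume.restrict D), Tendsto (fun E : ℝ => Q x E / E ^ s₀) (𝓝[>] 0) (𝓝 (β x))

/-- The Dirichlet energy `∫_B Q_B(x,|∇u|) dx + ∫_A Q_A(x,|∇u|) dx`, with `B = Ω \ closure A`;
possibly infinite. -/
noncomputable def dirichletEnergy {n : ℕ} (Ω A : Set (EuclideanSpace ℝ (Fin n)))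
    (QB QA : EuclideanSpace ℝ (Fin n) → ℝ → ℝ) (u : EuclideanSpace ℝ (Fin n) → ℝ) : ℝ≥0∞ :=
  (∫⁻ x in Ω \ closure A, ENNReal.ofReal (QB x ‖weakGrad Ω u x‖)) +
    ∫⁻ x in A, ENNReal.ofReal (QA x ‖weakGrad Ω u x‖)

/-- The normalized energy
`G₀ᵗ(v) = t^{-p₀} (∫_B Q_B(x, t|∇v|) dx + ∫_A Q_A(x, t|∇v|) dx)`. -/
noncomputable def normalizedEnergy {n : ℕ} (Ω A : Set (EuclideanSpace ℝ (Fin n)))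
    (QB QA : EuclideanSpace ℝ (Fin n) → ℝ → ℝ) (p₀ t : ℝ)
    (v : EuclideanSpace ℝ (Fin n) → ℝ) : ℝ≥0∞ :=
  ENNReal.ofReal (1 / t ^ p₀) *
    ((∫⁻ x in Ω \ closure A, ENNReal.ofReal (QB x (t * ‖weakGrad Ω v x‖))) +
      ∫⁻ x in A, ENNReal.ofReal (QA x (t * ‖weakGrad Ω v x‖)))

/-- The weighted `p₀`-energy `∫_B β₀ |∇v|^p₀ dx`, with `B = Ω \ closure A`. -/
noncomputable def weightedEnergy {n : ℕ} (Ω A : Set (EuclideanSpace ℝ (Fin n)))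
    (β₀ : EuclideanSpace ℝ (Fin n) → ℝ) (p₀ : ℝ) (v : EuclideanSpace ℝ (Fin n) → ℝ) : ℝ≥0∞ :=
  ∫⁻ x in Ω \ closure A, ENNReal.ofReal (β₀ x * ‖weakGrad Ω v x‖ ^ p₀)

/-- `u` minimizes the Dirichlet energy among the functions in `W^{1,p}(Ω) ∪ W^{1,q}(Ω)` that are
equal to `g` on `∂Ω`, in the sense `u - g ∈ W^{1,p}_0(Ω) ∪ W^{1,q}_0(Ω)`. -/
def IsPotential {n : ℕ} (Ω A : Set (EuclideanSpace ℝ (Fin n)))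
    (QB QA : EuclideanSpace ℝ (Fin n) → ℝ → ℝ) (p q : ℝ)
    (g u : EuclideanSpace ℝ (Fin n) → ℝ) : Prop :=
  let S : Set (EuclideanSpace ℝ (Fin n) → ℝ) :=
    {v | (MemSobolev p Ω v ∨ MemSobolev q Ω v) ∧
      (MemSobolevZero p Ω (v - g) ∨ MemSobolevZero q Ω (v - g))}
  u ∈ S ∧ IsMinOn (dirichletEnergy Ω A QB QA) S u

/-- `v` minimizes `G₀ᵗ` among the functions in `W^{1,q₀}(Ω)` that are equal to `f` on `∂Ω`. -/
def IsNormalizedMinimizer {n : ℕ} (Ω A : Set (EuclideanSpace ℝ (Fin n)))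
    (QB QA : EuclideanSpace ℝ (Fin n) → ℝ → ℝ) (p₀ q₀ : ℝ)
    (f : EuclideanSpace ℝ (Fin n) → ℝ) (t : ℝ) (v : EuclideanSpace ℝ (Fin n) → ℝ) : Prop :=
  let S : Set (EuclideanSpace ℝ (Fin n) → ℝ) :=
    {z | MemSobolev q₀ Ω z ∧ MemSobolevZero q₀ Ω (z - f)}
  v ∈ S ∧ IsMinOn (normalizedEnergy Ω A QB QA p₀ t) S v

/-- `w` minimizes the weighted `p₀`-energy among the functions in `W^{1,p₀}(Ω)` that are equal to
`f` on `∂Ω` and satisfy `|∇w| = 0` a.e. in `A`. -/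
def IsLimitMinimizer {n : ℕ} (Ω A : Set (EuclideanSpace ℝ (Fin n)))
    (β₀ : EuclideanSpace ℝ (Fin n) → ℝ) (p₀ : ℝ)
    (f w : EuclideanSpace ℝ (Fin n) → ℝ) : Prop :=
  let S : Set (EuclideanSpace ℝ (Fin n) → ℝ) :=
    {z | MemSobolev p₀ Ω z ∧ MemSobolevZero p₀ Ω (z - f) ∧
      ∀ᵐ x ∂(volume.restrict A), ‖weakGrad Ω z x‖ = 0}
  w ∈ S ∧ IsMinOn (weightedEnergy Ω A β₀ p₀) S w

/-! ### Convexity in `L^s` and weak convergence through closed convex sets. -/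

section FunctionalAnalysis

/-! Let `G_t` be the normalized energy, `B` the complement of `closure A` in `Ω`, and `m` the
minimum in (H).

Upper bound. A competitor whose gradient vanishes in `A` pays nothing there, and if it lies in
`W^{1,p}` its normalized energy tends to its weighted `p₀`-energy by dominated convergence
(`tendsto_scaled_energy`). The solution of (H) is only known to be in `W^{1,p₀}`, but it can be
approximated by such competitors (`exists_competitor`, resting on the density result
`exists_contDiff_approx`), so `limsup G_t(v^t) ≤ m`. By the lower growth bounds, `∇v^t` stays
bounded in `L^{p₀}(B)`, while `∫_A |∇v^t|^{q₀}` is at most a constant times `t^{p₀-q₀}`. Since `q₀ <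
p₀`, the gradient in `A` disappears in the limit.

Lower bound. The infima of `Q_B(x,E)/E^{p₀}` over small `E` approach `β₀`, and the tangent
inequality for the power `p₀` bounds `G_t` from below by affine functions of the gradient, for all
small `t` (`mul_rpow_sub_one_mul_le_scaled`, `setIntegral_inner_le_scaled_energy`). Optimizing over
these affine functions (`lintegral_weight_le_of_affine_bounds`) shows that a weak limit has weighted
energy at most `m`. It is therefore a minimizer of (H), and strict convexity makes that minimizer
unique (`IsLimitMinimizer.ae_eq`), so the whole family converges.

Compactness. No subsequences are extracted from weak compactness. In a uniformly convex setting,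
nested bounded closed convex sets have a common point (`UniformlyConvexFun.nonempty_iInter`). Hence
a bounded family converges weakly to `W` once `W` is the only point lying in every closed convex set
that eventually contains the family (`UniformlyConvexFun.tendsto_of_forall_convex`). The boundary
condition, the smallness of the gradient in `A` and the affine energy bounds are all closed convex
conditions. The same intersection principle gives existence for (H).

The remaining modes of convergence. Strong convergence in `A` combines the vanishing of the
gradients there with compactness of `W^{1,q₀}_0(Ω)` in `L^{q₀}(Ω)`
(`HasZeroExt.tendsto_eLpNorm_of_weak`). Weak convergence in `W^{1,p₀}(B)` needs a bound for `v^t` in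
`L^{p₀}(B)` although the gradient in `A` is controlled only in `L^{q₀}`; this is the Poincaré
inequality `exists_poincare_compl`, which uses the gradient outside `closure A` alone.

Boundary values are handled through extension by zero (`HasZeroExt`), which for Lipschitz `Ω`
characterizes `W^{1,s}_0` and does not mention the exponent. The two families of the theorem enter
only through `IsAlmostMinimizing`, a comparison with the `W^{1,p}` competitors above, so one
argument serves both. -/

/-- Minkowski's integral inequality for the average over a probability measure. -/
theorem eLpNorm_integral_le_of_forall_eLpNorm_le {α β F : Type*} [MeasurableSpace α]
    [MeasurableSpace β] [NormedAddCommGroup F] [NormedSpace ℝ F] {ν : Measure α} {μ : Measure β}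
    [SFinite ν] [IsProbabilityMeasure μ] {s : ℝ≥0∞} (hs : 1 ≤ s) (hs' : s ≠ ⊤) {k : α → β → F}
    (hk : AEStronglyMeasurable (Function.uncurry k) (ν.prod μ)) {C : ℝ≥0∞}
    (h : ∀ᵐ b ∂μ, eLpNorm (fun x => k x b) s ν ≤ C) :
    eLpNorm (fun x => ∫ b, k x b ∂μ) s ν ≤ C := by
  have hs0 : s ≠ 0 := (zero_lt_one.trans_le hs).ne'
  have hr : 0 < s.toReal := ENNReal.toReal_pos hs0 hs'
  have hpow : ∀ f : α → F, eLpNorm f s ν ^ s.toReal = ∫⁻ x, ‖f x‖ₑ ^ s.toReal ∂ν := fun f => by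
    rw [eLpNorm_eq_lintegral_rpow_enorm_toReal hs0 hs', ← ENNReal.rpow_mul,
      one_div_mul_cancel hr.ne', ENNReal.rpow_one]
  have hpow' : ∀ f : β → F, eLpNorm f s μ ^ s.toReal = ∫⁻ x, ‖f x‖ₑ ^ s.toReal ∂μ := fun f => by
    rw [eLpNorm_eq_lintegral_rpow_enorm_toReal hs0 hs', ← ENNReal.rpow_mul,
      one_div_mul_cancel hr.ne', ENNReal.rpow_one]
  rw [← ENNReal.rpow_le_rpow_iff hr, hpow]
  calc ∫⁻ x, ‖∫ b, k x b ∂μ‖ₑ ^ s.toReal ∂ν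
      ≤ ∫⁻ x, ∫⁻ b, ‖k x b‖ₑ ^ s.toReal ∂μ ∂ν := by
        refine lintegral_mono_ae ?_
        filter_upwards [hk.prodMk_left] with x hx
        rw [← hpow' (k x)]
        -- Jensen's inequality, in the form that the `L^1` norm is at most the `L^s` norm for a
        -- probability measure.
        refine ENNReal.rpow_le_rpow ?_ hr.le
        refine (enorm_integral_le_lintegral_enorm _).trans ?_
        rw [← eLpNorm_one_eq_lintegral_enorm]
        exact eLpNorm_le_eLpNorm_of_exponent_le hs hx
    _ = ∫⁻ b, ∫⁻ x, ‖k x b‖ₑ ^ s.toReal ∂ν ∂μ :=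
        lintegral_lintegral_swap (hk.enorm.pow_const _)
    _ ≤ ∫⁻ _, C ^ s.toReal ∂μ := by
        refine lintegral_mono_ae ?_
        filter_upwards [h] with b hb
        rw [← hpow (fun x => k x b)]
        exact ENNReal.rpow_le_rpow hb hr.le
    _ = C ^ s.toReal := by simp

theorem norm_half_add_rpow_le {E : Type*} [NormedAddCommGroup E] [NormedSpace ℝ E] {s : ℝ}
    (hs : 1 ≤ s) (a b : E) : ‖(1 / 2 : ℝ) • (a + b)‖ ^ s ≤ (‖a‖ ^ s + ‖b‖ ^ s) / 2 := by
  have h1 : ‖(1 / 2 : ℝ) • (a + b)‖ ≤ (1 / 2 : ℝ) * ‖a‖ + (1 / 2 : ℝ) * ‖b‖ := by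
    rw [norm_smul, ← mul_add]
    simpa using norm_add_le a b
  have h2 := (convexOn_rpow hs).2 (norm_nonneg a) (norm_nonneg b) (by norm_num : (0 : ℝ) ≤ 1 / 2)
    (by norm_num : (0 : ℝ) ≤ 1 / 2) (by norm_num)
  simp only [smul_eq_mul] at h2
  have h3 := Real.rpow_le_rpow (norm_nonneg _) h1 (zero_le_one.trans hs)
  linarith

/-- If the norms agree, strictness comes from the triangle inequality, since two vectors of equal
norm on the same ray coincide. If they differ, it comes from strict convexity of the power. -/
theorem norm_half_add_rpow_lt {E : Type*} [NormedAddCommGroup E] [InnerProductSpace ℝ E] {s : ℝ}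
    (hs : 1 < s) {a b : E} (hab : a ≠ b) :
    ‖(1 / 2 : ℝ) • (a + b)‖ ^ s < (‖a‖ ^ s + ‖b‖ ^ s) / 2 := by
  have h1 : ‖(1 / 2 : ℝ) • (a + b)‖ = (1 / 2 : ℝ) * ‖a + b‖ := by
    rw [norm_smul]; norm_num
  by_cases h : ‖a‖ = ‖b‖
  · have h3 : ‖a + b‖ < ‖a‖ + ‖b‖ := by
      refine lt_of_le_of_ne (norm_add_le a b) fun heq => hab ?_
      exact (sameRay_iff_norm_add.2 heq).eq_of_norm_eq h
    have h4 : ‖(1 / 2 : ℝ) • (a + b)‖ < ‖a‖ := by rw [h1]; linarith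
    have := Real.rpow_lt_rpow (norm_nonneg _) h4 (zero_lt_one.trans hs)
    rw [← h]; linarith
  · have h2 := (strictConvexOn_rpow hs).2 (norm_nonneg a) (norm_nonneg b) h
      (by norm_num : (0 : ℝ) < 1 / 2) (by norm_num : (0 : ℝ) < 1 / 2) (by norm_num)
    simp only [smul_eq_mul] at h2
    have h3 : ‖(1 / 2 : ℝ) • (a + b)‖ ≤ (1 / 2 : ℝ) * ‖a‖ + (1 / 2 : ℝ) * ‖b‖ := by
      rw [h1, ← mul_add]
      have := norm_add_le a b
      linarith
    have h4 := Real.rpow_le_rpow (norm_nonneg _) h3 (zero_le_one.trans hs.le)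
    linarith

/-- Both sides are homogeneous of degree `s`, so one may normalize `‖a‖^s + ‖b‖^s = 1`. On the
compact set where also `‖a - b‖^s ≥ η`, the midpoint deficit is continuous and positive, hence
bounded below. This pointwise estimate replaces Clarkson's inequalities and treats all `s > 1` at
once. -/
theorem exists_norm_sub_rpow_le {E : Type*} [NormedAddCommGroup E] [InnerProductSpace ℝ E]
    [FiniteDimensional ℝ E] {s : ℝ} (hs : 1 < s) {η : ℝ} (hη : 0 < η) :
    ∃ C : ℝ, 0 ≤ C ∧ ∀ a b : E, ‖a - b‖ ^ s ≤ η * (‖a‖ ^ s + ‖b‖ ^ s) +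
      C * ((‖a‖ ^ s + ‖b‖ ^ s) / 2 - ‖(1 / 2 : ℝ) • (a + b)‖ ^ s) := by
  have hs0 : 0 < s := zero_lt_one.trans hs
  have hcn : ∀ g : E × E → E, Continuous g → Continuous fun x => ‖g x‖ ^ s := fun g hg =>
    hg.norm.rpow_const fun _ => Or.inr hs0.le
  have hc1 : Continuous fun x : E × E => ‖x.1‖ ^ s + ‖x.2‖ ^ s :=
    (hcn _ continuous_fst).add (hcn _ continuous_snd)
  have hc2 : Continuous fun x : E × E => ‖x.1 - x.2‖ ^ s := hcn _ (by fun_prop)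
  have hc3 : Continuous fun x : E × E => (‖x.1‖ ^ s + ‖x.2‖ ^ s) / 2 -
      ‖(1 / 2 : ℝ) • (x.1 + x.2)‖ ^ s := (hc1.div_const 2).sub (hcn _ (by fun_prop))
  set K : Set (E × E) := {x | ‖x.1‖ ^ s + ‖x.2‖ ^ s = 1} ∩ {x | η ≤ ‖x.1 - x.2‖ ^ s} with hK
  have hle1 : ∀ t : ℝ, 0 ≤ t → t ^ s ≤ 1 → t ≤ 1 := fun t ht h => by
    by_contra hlt
    exact absurd h (not_le.2 (Real.one_lt_rpow (not_le.1 hlt) hs0))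
  have hKb : ∀ x : E × E, ‖x.1‖ ^ s + ‖x.2‖ ^ s = 1 → ‖x.1‖ ≤ 1 ∧ ‖x.2‖ ≤ 1 := fun x hx => by
    have h1 := Real.rpow_nonneg (norm_nonneg x.1) s
    have h2 := Real.rpow_nonneg (norm_nonneg x.2) s
    exact ⟨hle1 _ (norm_nonneg _) (by linarith), hle1 _ (norm_nonneg _) (by linarith)⟩
  have hKc : IsCompact K := by
    refine Metric.isCompact_of_isClosed_isBounded ?_ ?_
    · exact (isClosed_eq hc1 continuous_const).inter (isClosed_le continuous_const hc2)
    · refine (Metric.isBounded_closedBall (x := (0 : E × E)) (r := 1)).subset fun x hx => ?_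
      rw [mem_closedBall_zero_iff, Prod.norm_def]
      exact max_le (hKb x hx.1).1 (hKb x hx.1).2
  obtain ⟨δ, hδ, hδK⟩ : ∃ δ > 0, ∀ x ∈ K, δ ≤ (‖x.1‖ ^ s + ‖x.2‖ ^ s) / 2 -
      ‖(1 / 2 : ℝ) • (x.1 + x.2)‖ ^ s := by
    rcases K.eq_empty_or_nonempty with hKe | hKn
    · exact ⟨1, one_pos, by simp [hKe]⟩
    · obtain ⟨x, hx, hmin⟩ := hKc.exists_isMinOn hKn hc3.continuousOn
      refine ⟨_, ?_, fun y hy => hmin hy⟩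
      have hne : x.1 ≠ x.2 := fun h => by
        have := hx.2
        simp only [mem_ofPred_eq, h, sub_self, norm_zero, Real.zero_rpow hs0.ne'] at this
        linarith
      exact sub_pos.2 (norm_half_add_rpow_lt hs hne)
  -- After normalization `‖a - b‖ ≤ 2`, so `2^s/δ` times a deficit of at least `δ` dominates `‖a -
  -- b‖^s`.
  refine ⟨2 ^ s / δ, by positivity, fun a b => ?_⟩
  have hN1 := Real.rpow_nonneg (norm_nonneg a) s
  have hN2 := Real.rpow_nonneg (norm_nonneg b) s
  rcases (add_nonneg hN1 hN2).eq_or_lt with h0 | hpos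
  · have ha : a = 0 := by
      have : ‖a‖ ^ s = 0 := by linarith
      rwa [Real.rpow_eq_zero (norm_nonneg _) hs0.ne', norm_eq_zero] at this
    have hb : b = 0 := by
      have : ‖b‖ ^ s = 0 := by linarith
      rwa [Real.rpow_eq_zero (norm_nonneg _) hs0.ne', norm_eq_zero] at this
    simp [ha, hb, Real.zero_rpow hs0.ne']
  set N := ‖a‖ ^ s + ‖b‖ ^ s with hN
  set l : ℝ := N ^ (-(1 / s)) with hl
  have hl0 : 0 < l := Real.rpow_pos_of_pos hpos _
  have hls : l ^ s = N⁻¹ := by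
    rw [hl, ← Real.rpow_mul hpos.le, neg_mul, one_div_mul_cancel hs0.ne', Real.rpow_neg_one]
  have hsc : ∀ v : E, ‖l • v‖ ^ s = N⁻¹ * ‖v‖ ^ s := fun v => by
    rw [norm_smul, Real.norm_of_nonneg hl0.le, Real.mul_rpow hl0.le (norm_nonneg _), hls]
  have key : ‖l • a - l • b‖ ^ s ≤ η + 2 ^ s / δ * ((‖l • a‖ ^ s + ‖l • b‖ ^ s) / 2 -
      ‖(1 / 2 : ℝ) • (l • a + l • b)‖ ^ s) := by
    have hone : ‖l • a‖ ^ s + ‖l • b‖ ^ s = 1 := by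
      rw [hsc, hsc, ← mul_add, ← hN, inv_mul_cancel₀ hpos.ne']
    have hD := norm_half_add_rpow_le hs.le (l • a) (l • b)
    by_cases hη' : η ≤ ‖l • a - l • b‖ ^ s
    · have h1 := hδK (l • a, l • b) ⟨hone, hη'⟩
      have h2 : ‖l • a - l • b‖ ^ s ≤ 2 ^ s := by
        refine Real.rpow_le_rpow (norm_nonneg _) ?_ hs0.le
        have h3 := hKb (l • a, l • b) hone
        exact (norm_sub_le _ _).trans (by linarith [h3.1, h3.2])
      have h4 : (2 : ℝ) ^ s = 2 ^ s / δ * δ := by field_simp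
      have h5 := mul_le_mul_of_nonneg_left h1 (by positivity : 0 ≤ (2 : ℝ) ^ s / δ)
      linarith
    · have : 0 ≤ 2 ^ s / δ * ((‖l • a‖ ^ s + ‖l • b‖ ^ s) / 2 -
          ‖(1 / 2 : ℝ) • (l • a + l • b)‖ ^ s) :=
        mul_nonneg (by positivity) (sub_nonneg.2 hD)
      linarith
  rw [← smul_sub, ← smul_add, smul_comm, hsc, hsc, hsc, hsc] at key
  have := mul_le_mul_of_nonneg_left key hpos.le
  have hNN : N * N⁻¹ = 1 := mul_inv_cancel₀ hpos.ne'
  calc ‖a - b‖ ^ s = N * (N⁻¹ * ‖a - b‖ ^ s) := by rw [← mul_assoc, hNN, one_mul]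
    _ ≤ _ := this
    _ = η * N + 2 ^ s / δ * ((N * N⁻¹) * ((‖a‖ ^ s + ‖b‖ ^ s) / 2 -
        ‖(1 / 2 : ℝ) • (a + b)‖ ^ s)) := by ring
    _ = _ := by rw [hNN, one_mul]

/-- A nonnegative, midpoint convex function, bounded on bounded sets, that is uniformly convex on
bounded sets. -/
structure UniformlyConvexFun {X : Type*} [NormedAddCommGroup X] [NormedSpace ℝ X] (J : X → ℝ) :
    Prop where
  nonneg : ∀ x, 0 ≤ J x
  bounded : ∀ R : ℝ, ∃ M : ℝ, ∀ x, ‖x‖ ≤ R → J x ≤ M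
  midpoint : ∀ x y, J ((1 / 2 : ℝ) • (x + y)) ≤ (J x + J y) / 2
  uniform : ∀ R : ℝ, ∀ ε > 0, ∃ δ > 0, ∀ x y, ‖x‖ ≤ R → ‖y‖ ≤ R →
    (J x + J y) / 2 - J ((1 / 2 : ℝ) • (x + y)) < δ → ‖x - y‖ < ε

theorem Lp_norm_rpow_eq_integral {α E : Type*} [MeasurableSpace α] [NormedAddCommGroup E]
    {μ : Measure α} {s : ℝ} (hs : 0 < s) (x : Lp E (ENNReal.ofReal s) μ) :
    ‖x‖ ^ s = ∫ a, ‖x a‖ ^ s ∂μ := by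
  have h := (Lp.memLp x).eLpNorm_eq_integral_rpow_norm (by simpa using hs) ENNReal.ofReal_ne_top
  rw [ENNReal.toReal_ofReal hs.le] at h
  have hnn : 0 ≤ ∫ a, ‖x a‖ ^ s ∂μ :=
    integral_nonneg fun a => Real.rpow_nonneg (norm_nonneg _) _
  rw [Lp.norm_def, h, ENNReal.toReal_ofReal (Real.rpow_nonneg hnn _), ← Real.rpow_mul hnn,
    inv_mul_cancel₀ hs.ne', Real.rpow_one]

theorem Lp_integrable_norm_rpow {α E : Type*} [MeasurableSpace α] [NormedAddCommGroup E]
    {μ : Measure α} {s : ℝ} (hs : 0 < s) (x : Lp E (ENNReal.ofReal s) μ) :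
    Integrable (fun a => ‖x a‖ ^ s) μ := by
  have := (Lp.memLp x).integrable_norm_rpow (by simpa using hs) ENNReal.ofReal_ne_top
  rwa [ENNReal.toReal_ofReal hs.le] at this

/-- The pointwise inequality of `exists_norm_sub_rpow_le` is integrated. On a bounded set the term
with `η` is as small as desired, and the other one is a multiple of the midpoint deficit. -/
theorem uniformlyConvexFun_Lp_norm_rpow {α E : Type*} [MeasurableSpace α] [NormedAddCommGroup E]
    [InnerProductSpace ℝ E] [FiniteDimensional ℝ E] {μ : Measure α} {s : ℝ} (hs : 1 < s)
    [Fact (1 ≤ ENNReal.ofReal s)] :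
    UniformlyConvexFun (fun x : Lp E (ENNReal.ofReal s) μ => ‖x‖ ^ s) where
  nonneg x := Real.rpow_nonneg (norm_nonneg _) _
  bounded R := ⟨R ^ s, fun x hx =>
    Real.rpow_le_rpow (norm_nonneg _) hx (zero_lt_one.trans hs).le⟩
  midpoint x y := norm_half_add_rpow_le hs.le x y
  uniform R ε hε := by
    have hs0 : 0 < s := zero_lt_one.trans hs
    -- `M` bounds the `s`-th powers of both norms. With `η = ε^s/(4M)` and deficit below
    -- `ε^s/(4(C+1))`, the two terms are at most `ε^s/2` and `ε^s/4`.
    set M : ℝ := |R| ^ s + 1 with hM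
    have hM0 : 0 < M := by positivity
    obtain ⟨C, hC, hCab⟩ := exists_norm_sub_rpow_le (E := E) hs
      (show 0 < ε ^ s / (4 * M) by positivity)
    refine ⟨ε ^ s / (4 * (C + 1)), by positivity, fun x y hx hy hxy => ?_⟩
    have hRs : ∀ z : Lp E (ENNReal.ofReal s) μ, ‖z‖ ≤ R → ‖z‖ ^ s ≤ M := fun z hz => by
      have := Real.rpow_le_rpow (norm_nonneg _) (hz.trans (le_abs_self R)) hs0.le
      linarith
    have hi := Lp_integrable_norm_rpow hs0 (E := E) (μ := μ)
    have hint : ‖x - y‖ ^ s ≤ ε ^ s / (4 * M) * (‖x‖ ^ s + ‖y‖ ^ s) +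
        C * ((‖x‖ ^ s + ‖y‖ ^ s) / 2 - ‖(1 / 2 : ℝ) • (x + y)‖ ^ s) := by
      have hi1 : Integrable (fun a => ‖x a‖ ^ s + ‖y a‖ ^ s) μ := (hi x).add (hi y)
      have hi2 : Integrable (fun a => (‖x a‖ ^ s + ‖y a‖ ^ s) / 2 -
          ‖((1 / 2 : ℝ) • (x + y) : Lp E (ENNReal.ofReal s) μ) a‖ ^ s) μ :=
        (hi1.div_const 2).sub (hi _)
      simp only [Lp_norm_rpow_eq_integral hs0]
      rw [← integral_add (hi x) (hi y), ← integral_div, ← integral_sub (hi1.div_const 2) (hi _),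
        ← integral_const_mul, ← integral_const_mul,
        ← integral_add (hi1.const_mul _) (hi2.const_mul _)]
      refine integral_mono_ae (hi _) ((hi1.const_mul _).add (hi2.const_mul _)) ?_
      filter_upwards [Lp.coeFn_sub x y, Lp.coeFn_add x y,
        Lp.coeFn_smul (1 / 2 : ℝ) (x + y)] with a h1 h2 h3
      have := hCab (x a) (y a)
      simpa only [h1, h2, h3, Pi.sub_apply, Pi.add_apply, Pi.smul_apply] using this
    have h1 : ε ^ s / (4 * M) * (‖x‖ ^ s + ‖y‖ ^ s) ≤ ε ^ s / 2 := by
      calc ε ^ s / (4 * M) * (‖x‖ ^ s + ‖y‖ ^ s) ≤ ε ^ s / (4 * M) * (M + M) := by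
            gcongr
            · exact hRs x hx
            · exact hRs y hy
        _ = ε ^ s / 2 := by field_simp; ring
    have h2 : C * ((‖x‖ ^ s + ‖y‖ ^ s) / 2 - ‖(1 / 2 : ℝ) • (x + y)‖ ^ s) ≤ ε ^ s / 4 := by
      calc _ ≤ C * (ε ^ s / (4 * (C + 1))) := by gcongr
        _ = ε ^ s / 4 * (C / (C + 1)) := by field_simp
        _ ≤ ε ^ s / 4 * 1 := by
            gcongr
            rw [div_le_one (by positivity)]; linarith
        _ = _ := mul_one _
    have h3 : 0 < ε ^ s := by positivity
    exact (Real.rpow_lt_rpow_iff (norm_nonneg _) hε.le hs0).1 (by linarith)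

/-- Midpoint convexity makes both deficits nonnegative, so a small total deficit controls each
component. -/
theorem UniformlyConvexFun.prod {X Y : Type*} [NormedAddCommGroup X] [NormedSpace ℝ X]
    [NormedAddCommGroup Y] [NormedSpace ℝ Y] {J : X → ℝ} {K : Y → ℝ} (hJ : UniformlyConvexFun J)
    (hK : UniformlyConvexFun K) : UniformlyConvexFun (fun z : X × Y => J z.1 + K z.2) where
  nonneg z := add_nonneg (hJ.nonneg _) (hK.nonneg _)
  bounded R := by
    obtain ⟨M, hM⟩ := hJ.bounded R
    obtain ⟨M', hM'⟩ := hK.bounded R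
    exact ⟨M + M', fun z hz => add_le_add (hM _ ((norm_fst_le z).trans hz))
      (hM' _ ((norm_snd_le z).trans hz))⟩
  midpoint z w := by
    have h1 := hJ.midpoint z.1 w.1
    have h2 := hK.midpoint z.2 w.2
    simp only [Prod.smul_fst, Prod.fst_add, Prod.smul_snd, Prod.snd_add]
    linarith
  uniform R ε hε := by
    obtain ⟨δ, hδ, h⟩ := hJ.uniform R ε hε
    obtain ⟨δ', hδ', h'⟩ := hK.uniform R ε hε
    refine ⟨min δ δ', lt_min hδ hδ', fun z w hz hw hzw => ?_⟩
    have h1 := hJ.midpoint z.1 w.1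
    have h2 := hK.midpoint z.2 w.2
    simp only [Prod.smul_fst, Prod.fst_add, Prod.smul_snd, Prod.snd_add] at hzw
    have h3 := hzw.trans_le (min_le_left _ _)
    have h4 := hzw.trans_le (min_le_right _ _)
    rw [Prod.norm_def]
    exact max_lt
      (h _ _ ((norm_fst_le z).trans hz) ((norm_fst_le w).trans hw) (by linarith))
      (h' _ _ ((norm_snd_le z).trans hz) ((norm_snd_le w).trans hw) (by linarith))

theorem UniformlyConvexFun.submodule {X : Type*} [NormedAddCommGroup X] [NormedSpace ℝ X]
    {J : X → ℝ} (hJ : UniformlyConvexFun J) (S : Submodule ℝ X) :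
    UniformlyConvexFun (fun z : S => J z) where
  nonneg z := hJ.nonneg _
  bounded R := (hJ.bounded R).imp fun _ h z hz => h z hz
  midpoint z w := hJ.midpoint z w
  uniform R ε hε := by
    obtain ⟨δ, hδ, h⟩ := hJ.uniform R ε hε
    exact ⟨δ, hδ, fun z w hz hw hzw => h z w hz hw hzw⟩

/-- In a Banach space with a uniformly convex function, a decreasing sequence of nonempty bounded
closed convex sets has a common point. -/
theorem UniformlyConvexFun.nonempty_iInter {X : Type*} [NormedAddCommGroup X] [NormedSpace ℝ X]
    [CompleteSpace X] {J : X → ℝ} (hJ : UniformlyConvexFun J) {C : ℕ → Set X} (hC : Antitone C)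
    (hne : ∀ m, (C m).Nonempty) (hcl : ∀ m, IsClosed (C m)) (hconv : ∀ m, Convex ℝ (C m))
    {R : ℝ} (hR : ∀ x ∈ C 0, ‖x‖ ≤ R) : (⋂ m, C m).Nonempty := by
  obtain ⟨M, hM⟩ := hJ.bounded R
  have hRm : ∀ m, ∀ x ∈ C m, ‖x‖ ≤ R := fun m x hx => hR x (hC (Nat.zero_le m) hx)
  -- The infima over the shrinking sets increase to a finite limit; near-minimizers `x m` of `J` on
  -- `C m` will form a Cauchy sequence.
  set d : ℕ → ℝ := fun m => sInf (J '' C m) with hd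
  have hbdd : ∀ m, BddBelow (J '' C m) := fun m =>
    ⟨0, by rintro _ ⟨x, _, rfl⟩; exact hJ.nonneg x⟩
  have hdle : ∀ m, ∀ x ∈ C m, d m ≤ J x := fun m x hx => csInf_le (hbdd m) ⟨x, hx, rfl⟩
  have hdmono : Monotone d := fun i j hij =>
    csInf_le_csInf (hbdd i) ((hne j).image J) (image_mono (hC hij))
  have hdM : BddAbove (range d) := ⟨M, by
    rintro _ ⟨m, rfl⟩
    obtain ⟨x, hx⟩ := hne m
    exact (hdle m x hx).trans (hM x (hRm m x hx))⟩
  have hex : ∀ m : ℕ, ∃ x ∈ C m, J x < d m + 1 / ((m : ℝ) + 1) := fun m => by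
    obtain ⟨_, ⟨x, hx, rfl⟩, hlt⟩ := Real.lt_sInf_add_pos ((hne m).image J)
      (show (0 : ℝ) < 1 / ((m : ℝ) + 1) by positivity)
    exact ⟨x, hx, hlt⟩
  choose x hxC hxJ using hex
  have hdlim := tendsto_atTop_ciSup hdmono hdM
  have hcau : CauchySeq x := by
    refine Metric.cauchySeq_iff'.2 fun ε hε => ?_
    obtain ⟨δ, hδ, huc⟩ := hJ.uniform R ε hε
    have hd1 : ∀ᶠ m in atTop, (⨆ i, d i) - δ / 2 < d m :=
      hdlim.eventually (lt_mem_nhds (by linarith))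
    have hd2 : ∀ᶠ m : ℕ in atTop, 1 / ((m : ℝ) + 1) < δ / 2 :=
      tendsto_one_div_add_atTop_nhds_zero_nat.eventually (gt_mem_nhds (by linarith))
    obtain ⟨N, hN1, hN2⟩ := (hd1.and hd2).exists
    refine ⟨N, fun m hm => ?_⟩
    rw [dist_eq_norm]
    refine huc _ _ (hRm m _ (hxC m)) (hRm N _ (hxC N)) ?_
    -- The midpoint stays in `C N`, so its value is at least `d N`, while both endpoint values
    -- exceed the limit of the infima by less than `δ/2`. The deficit is thus below `δ`.
    have hmid : (1 / 2 : ℝ) • (x m + x N) ∈ C N := by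
      rw [smul_add]
      exact hconv N (hC hm (hxC m)) (hxC N) (by norm_num) (by norm_num) (by norm_num)
    have h1 := hdle N _ hmid
    have h2 := hxJ m
    have h3 := hxJ N
    have h4 : d m ≤ ⨆ i, d i := le_ciSup hdM m
    have h5 : 1 / ((m : ℝ) + 1) ≤ 1 / ((N : ℝ) + 1) := by gcongr
    linarith
  obtain ⟨y, hy⟩ := cauchySeq_tendsto_of_complete hcau
  refine ⟨y, mem_iInter.2 fun m => (hcl m).mem_of_tendsto hy ?_⟩
  filter_upwards [eventually_ge_atTop m] with k hk using hC hk (hxC k)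

/-- A bounded family converges weakly to `W` as soon as `W` is the only point that belongs to all
closed convex sets which eventually contain the family. -/
theorem UniformlyConvexFun.tendsto_of_forall_convex {X : Type*} [NormedAddCommGroup X]
    [NormedSpace ℝ X] [CompleteSpace X] {J : X → ℝ} (hJ : UniformlyConvexFun J) {ι : Type*}
    {l : Filter ι} [l.IsCountablyGenerated] {V : ι → X} {W : X} {R : ℝ}
    (hR : ∀ᶠ t in l, ‖V t‖ ≤ R)
    (hW : ∀ x, (∀ C : Set X, IsClosed C → Convex ℝ C → (∀ᶠ t in l, V t ∈ C) → x ∈ C) → x = W) :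
    Tendsto (fun t => toWeakSpace ℝ X (V t)) l (𝓝 (toWeakSpace ℝ X W)) := by
  -- A one-sided bound for every functional suffices, since `-L` gives the other side. If it fails
  -- along a sequence, the closed convex hulls of the tails share a point. That point must be `W`,
  -- yet it lies in the half-space `L ≥ L W + ε`.
  have key : ∀ (L : X →L[ℝ] ℝ), ∀ ε > 0, ∀ᶠ t in l, L (V t) < L W + ε := by
    intro L ε hε
    by_contra hcon
    rw [not_eventually] at hcon
    obtain ⟨t, ht, htV⟩ := exists_seq_forall_of_frequently (hcon.and_eventually hR)
    set C : ℕ → Set X := fun m => closure (convexHull ℝ ((fun k => V (t k)) '' Ici m)) with hC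
    have hanti : Antitone C := fun i j hij =>
      closure_mono (convexHull_mono (image_mono (Ici_subset_Ici.2 hij)))
    have hsub : ∀ (m : ℕ) (D : Set X), IsClosed D → Convex ℝ D → (∀ k, m ≤ k → V (t k) ∈ D) →
        C m ⊆ D := fun m D hD hD' h => by
      refine closure_minimal (convexHull_min ?_ hD') hD
      rintro _ ⟨k, hk, rfl⟩
      exact h k hk
    obtain ⟨x, hx⟩ := hJ.nonempty_iInter hanti
      (fun m => ⟨V (t m), subset_closure (subset_convexHull ℝ _ ⟨m, self_mem_Ici, rfl⟩)⟩)
      (fun m => isClosed_closure) (fun m => (convex_convexHull ℝ _).closure)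
      (R := R) (fun x hx => by
        have := hsub 0 (Metric.closedBall 0 R) Metric.isClosed_closedBall (convex_closedBall _ _)
          (fun k _ => by simpa using (htV k).2) hx
        simpa using this)
    rw [mem_iInter] at hx
    have hxW : x = W := hW x fun D hD hD' hev => by
      obtain ⟨m, hm⟩ := eventually_atTop.1 (ht.eventually hev)
      exact hsub m D hD hD' hm (hx m)
    have hge := hsub 0 {y | L W + ε ≤ L y} (isClosed_le continuous_const L.continuous)
      (convex_halfSpace_ge L.isLinear _) (fun k _ => not_lt.1 (htV k).1) (hx 0)
    rw [hxW] at hge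
    simp only [mem_ofPred_eq] at hge
    linarith
  have hind : IsInducing fun (x : WeakSpace ℝ X) (y : X →L[ℝ] ℝ) => (topDualPairing ℝ X).flip x y :=
    ⟨rfl⟩
  rw [hind.tendsto_nhds_iff, tendsto_pi_nhds]
  intro L
  refine (Metric.tendsto_nhds (f := l) (u := fun t => L (V t)) (a := L W)).2 fun ε hε => ?_
  filter_upwards [key L ε hε, key (-L) ε hε] with t h1 h2
  change -(L (V t)) < -(L W) + ε at h2
  rw [Real.dist_eq, abs_lt]
  constructor <;> linarith

theorem tendsto_toWeakSpace_apply {X : Type*} [NormedAddCommGroup X] [NormedSpace ℝ X] {ι : Type*}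
    {l : Filter ι} {V : ι → X} {W : X}
    (h : Tendsto (fun t => toWeakSpace ℝ X (V t)) l (𝓝 (toWeakSpace ℝ X W))) (L : X →L[ℝ] ℝ) :
    Tendsto (fun t => L (V t)) l (𝓝 (L W)) :=
  ((WeakBilin.eval_continuous (topDualPairing ℝ X).flip L).tendsto _).comp h

end FunctionalAnalysis

/-! ### Calculus of weak gradients and completeness of the Sobolev spaces. -/

section WeakGradient

variable {n : ℕ}

local notation "𝔼" => EuclideanSpace ℝ (Fin n)

theorem support_gradient_subset (φ : 𝔼 → ℝ) : Function.support (gradient φ) ⊆ tsupport φ := by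
  intro x hx
  refine support_fderiv_subset ℝ (f := φ) fun h => hx ?_
  simp [gradient, h]

theorem continuous_gradient {φ : 𝔼 → ℝ} (hφ : ContDiff ℝ 1 φ) : Continuous (gradient φ) :=
  (InnerProductSpace.toDual ℝ 𝔼).symm.continuous.comp (hφ.continuous_fderiv one_ne_zero)

theorem tsupport_gradient_subset (φ : 𝔼 → ℝ) : tsupport (gradient φ) ⊆ tsupport φ :=
  closure_minimal (support_gradient_subset φ) (isClosed_tsupport φ)

theorem inner_gradient_eq_fderiv (φ : 𝔼 → ℝ) (x v : 𝔼) : inner ℝ (gradient φ x) v = fderiv ℝ φ x v := by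
  rw [gradient, InnerProductSpace.toDual_symm_apply]

theorem integrable_smul_of_compact {F : Type*} [NormedAddCommGroup F] [NormedSpace ℝ F]
    {U : Set 𝔼} {g : 𝔼 → F} (hg : LocallyIntegrableOn g U volume) {φ : 𝔼 → ℝ}
    (hφ : Continuous φ) (hc : HasCompactSupport φ) (hU : tsupport φ ⊆ U) :
    Integrable (fun x => φ x • g x) volume := by
  refine (integrableOn_iff_integrable_of_support_subset (s := tsupport φ) ?_).1 ?_
  · exact (Function.support_smul_subset_left _ _).trans (subset_tsupport φ)
  · exact (hg.integrableOn_compact_subset hU hc).continuousOn_smul hφ.continuousOn hc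

theorem integrable_smul_of_compact' {F : Type*} [NormedAddCommGroup F] [NormedSpace ℝ F]
    {U : Set 𝔼} {u : 𝔼 → ℝ} (hu : LocallyIntegrableOn u U volume) {Φ : 𝔼 → F}
    (hΦ : Continuous Φ) (hc : HasCompactSupport Φ) (hU : tsupport Φ ⊆ U) :
    Integrable (fun x => u x • Φ x) volume := by
  refine (integrableOn_iff_integrable_of_support_subset (s := tsupport Φ) ?_).1 ?_
  · exact (Function.support_smul_subset_right _ _).trans (subset_tsupport Φ)
  · exact (hu.integrableOn_compact_subset hU hc).smul_continuousOn hΦ.continuousOn hc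

theorem IsTestFunction.tsupport_gradient {U : Set 𝔼} {φ : 𝔼 → ℝ} (hφ : IsTestFunction U φ) :
    tsupport (gradient φ) ⊆ U := (tsupport_gradient_subset φ).trans hφ.2.2

theorem setIntegral_smul_gradient {U : Set 𝔼} {φ : 𝔼 → ℝ} (hφ : IsTestFunction U φ) (u : 𝔼 → ℝ) :
    ∫ x in U, u x • gradient φ x = ∫ x, u x • gradient φ x :=
  setIntegral_eq_integral_of_forall_compl_eq_zero fun x hx => by
    have : x ∉ Function.support (gradient φ) := fun h =>
      hx (hφ.tsupport_gradient (subset_tsupport _ h))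
    rw [Function.notMem_support.1 this, smul_zero]

theorem setIntegral_test_smul {F : Type*} [NormedAddCommGroup F] [NormedSpace ℝ F]
    {U : Set 𝔼} {φ : 𝔼 → ℝ} (hφ : IsTestFunction U φ) (g : 𝔼 → F) :
    ∫ x in U, φ x • g x = ∫ x, φ x • g x :=
  setIntegral_eq_integral_of_forall_compl_eq_zero fun x hx => by
    rw [image_eq_zero_of_notMem_tsupport fun h => hx (hφ.2.2 h), zero_smul]

/-- Test functions and their gradients vanish outside `U`, so the integrals may be taken over the
whole space; this makes restriction to smaller open sets immediate. -/
theorem hasWeakGradient_iff {U : Set 𝔼} {u : 𝔼 → ℝ} {g : 𝔼 → 𝔼} :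
    HasWeakGradient U u g ↔ LocallyIntegrableOn u U volume ∧ LocallyIntegrableOn g U volume ∧
      ∀ φ : 𝔼 → ℝ, IsTestFunction U φ → ∫ x, u x • gradient φ x = - ∫ x, φ x • g x := by
  refine and_congr_right fun _ => and_congr_right fun _ => forall₂_congr fun φ hφ => ?_
  rw [setIntegral_smul_gradient hφ, setIntegral_test_smul hφ]

theorem IsTestFunction.mono {U V : Set 𝔼} {φ : 𝔼 → ℝ} (hφ : IsTestFunction V φ) (h : V ⊆ U) :
    IsTestFunction U φ := ⟨hφ.1, hφ.2.1, hφ.2.2.trans h⟩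

theorem HasWeakGradient.mono {U V : Set 𝔼} {u : 𝔼 → ℝ} {g : 𝔼 → 𝔼} (h : HasWeakGradient U u g)
    (hVU : V ⊆ U) : HasWeakGradient V u g := by
  rw [hasWeakGradient_iff] at h ⊢
  exact ⟨h.1.mono_set hVU, h.2.1.mono_set hVU, fun φ hφ => h.2.2 φ (hφ.mono hVU)⟩

theorem HasWeakGradient.integrable_left {U : Set 𝔼} {u : 𝔼 → ℝ} {g : 𝔼 → 𝔼}
    (h : HasWeakGradient U u g) {φ : 𝔼 → ℝ} (hφ : IsTestFunction U φ) :
    Integrable (fun x => u x • gradient φ x) volume :=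
  integrable_smul_of_compact' h.1 hφ.continuous_gradient hφ.hasCompactSupport_gradient
    hφ.tsupport_gradient

theorem HasWeakGradient.integrable_right {U : Set 𝔼} {u : 𝔼 → ℝ} {g : 𝔼 → 𝔼}
    (h : HasWeakGradient U u g) {φ : 𝔼 → ℝ} (hφ : IsTestFunction U φ) :
    Integrable (fun x => φ x • g x) volume :=
  integrable_smul_of_compact h.2.1 hφ.1.continuous hφ.2.1 hφ.2.2

theorem ae_eq_zero_of_forall_test {F : Type*} [NormedAddCommGroup F] [NormedSpace ℝ F]
    [CompleteSpace F] {U : Set 𝔼} (hU : IsOpen U) {g : 𝔼 → F} (hg : LocallyIntegrableOn g U volume)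
    (h : ∀ φ : 𝔼 → ℝ, IsTestFunction U φ → ∫ x, φ x • g x = 0) :
    g =ᵐ[volume.restrict U] 0 := by
  rw [Filter.EventuallyEq, ae_restrict_iff' hU.measurableSet]
  exact hU.ae_eq_zero_of_integral_contDiff_smul_eq_zero hg
    fun φ h1 h2 h3 => h φ ⟨h1, h2, h3⟩

theorem HasWeakGradient.ae_eq {U : Set 𝔼} (hU : IsOpen U) {u : 𝔼 → ℝ} {g g' : 𝔼 → 𝔼}
    (h : HasWeakGradient U u g) (h' : HasWeakGradient U u g') : g =ᵐ[volume.restrict U] g' := by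
  have h0 := ae_eq_zero_of_forall_test hU (h.2.1.sub h'.2.1) fun φ hφ => by
    have e := (hasWeakGradient_iff.1 h).2.2 φ hφ
    have e' := (hasWeakGradient_iff.1 h').2.2 φ hφ
    simp only [Pi.sub_apply, smul_sub]
    rw [integral_sub (h.integrable_right hφ) (h'.integrable_right hφ), sub_eq_zero]
    exact neg_injective (e.symm.trans e')
  filter_upwards [h0] with x hx using sub_eq_zero.1 hx

theorem hasWeakGradient_weakGrad {U : Set 𝔼} {u : 𝔼 → ℝ} {g : 𝔼 → 𝔼} (h : HasWeakGradient U u g) :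
    HasWeakGradient U u (weakGrad U u) := by
  have hex : ∃ g, HasWeakGradient U u g := ⟨g, h⟩
  rw [weakGrad, dif_pos hex]
  exact hex.choose_spec

theorem HasWeakGradient.weakGrad_ae_eq {U : Set 𝔼} (hU : IsOpen U) {u : 𝔼 → ℝ} {g : 𝔼 → 𝔼}
    (h : HasWeakGradient U u g) : weakGrad U u =ᵐ[volume.restrict U] g :=
  (hasWeakGradient_weakGrad h).ae_eq hU h

theorem locallyIntegrableOn_congr {F : Type*} [NormedAddCommGroup F] {U : Set 𝔼} (hU : IsOpen U)
    {g g' : 𝔼 → F} (hg : LocallyIntegrableOn g U volume) (h : g =ᵐ[volume.restrict U] g') :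
    LocallyIntegrableOn g' U volume := by
  rw [locallyIntegrableOn_iff hU.isLocallyClosed] at hg ⊢
  exact fun k hk hkc => (hg k hk hkc).congr_fun_ae (ae_restrict_of_ae_restrict_of_subset hk h)

theorem HasWeakGradient.congr {U : Set 𝔼} (hU : IsOpen U) {u u' : 𝔼 → ℝ} {g g' : 𝔼 → 𝔼}
    (h : HasWeakGradient U u g) (hu : u =ᵐ[volume.restrict U] u')
    (hg : g =ᵐ[volume.restrict U] g') : HasWeakGradient U u' g' := by
  refine ⟨locallyIntegrableOn_congr hU h.1 hu, locallyIntegrableOn_congr hU h.2.1 hg,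
    fun φ hφ => ?_⟩
  have e1 : ∫ x in U, u x • gradient φ x = ∫ x in U, u' x • gradient φ x :=
    integral_congr_ae (hu.mono fun x hx => congrArg (· • gradient φ x) hx)
  have e2 : ∫ x in U, φ x • g x = ∫ x in U, φ x • g' x :=
    integral_congr_ae (hg.mono fun x hx => congrArg (φ x • ·) hx)
  rw [← e1, ← e2]
  exact h.2.2 φ hφ

theorem HasWeakGradient.add {U : Set 𝔼} {u u' : 𝔼 → ℝ} {g g' : 𝔼 → 𝔼}
    (h : HasWeakGradient U u g) (h' : HasWeakGradient U u' g') :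
    HasWeakGradient U (u + u') (g + g') := by
  refine hasWeakGradient_iff.2 ⟨h.1.add h'.1, h.2.1.add h'.2.1, fun φ hφ => ?_⟩
  simp only [Pi.add_apply, add_smul, smul_add]
  rw [integral_add (h.integrable_left hφ) (h'.integrable_left hφ),
    integral_add (h.integrable_right hφ) (h'.integrable_right hφ),
    (hasWeakGradient_iff.1 h).2.2 φ hφ, (hasWeakGradient_iff.1 h').2.2 φ hφ, neg_add]

theorem HasWeakGradient.const_smul {U : Set 𝔼} {u : 𝔼 → ℝ} {g : 𝔼 → 𝔼}
    (h : HasWeakGradient U u g) (c : ℝ) : HasWeakGradient U (c • u) (c • g) := by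
  refine hasWeakGradient_iff.2 ⟨h.1.smul c, h.2.1.smul c, fun φ hφ => ?_⟩
  simp only [Pi.smul_apply, smul_assoc, smul_comm _ c]
  rw [integral_smul, integral_smul, (hasWeakGradient_iff.1 h).2.2 φ hφ, smul_neg]

theorem HasWeakGradient.sub {U : Set 𝔼} {u u' : 𝔼 → ℝ} {g g' : 𝔼 → 𝔼}
    (h : HasWeakGradient U u g) (h' : HasWeakGradient U u' g') :
    HasWeakGradient U (u - u') (g - g') := by
  simpa [sub_eq_add_neg] using h.add (h'.const_smul (-1))

theorem gradient_mul {φ ψ : 𝔼 → ℝ} {x : 𝔼} (hφ : DifferentiableAt ℝ φ x)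
    (hψ : DifferentiableAt ℝ ψ x) :
    gradient (fun y => φ y * ψ y) x = φ x • gradient ψ x + ψ x • gradient φ x := by
  simp only [gradient, fderiv_fun_mul hφ hψ, map_add, map_smul]

/-- Pairing with a fixed vector `v` reduces the claim to scalar integration by parts for the
derivative in direction `v`. -/
theorem integral_smul_gradient_eq_neg {φ ψ : 𝔼 → ℝ} (hφ : ContDiff ℝ 1 φ) (hψ : ContDiff ℝ 1 ψ)
    (hc : HasCompactSupport ψ) :
    ∫ x, φ x • gradient ψ x = - ∫ x, ψ x • gradient φ x := by
  have hψc : HasCompactSupport (gradient ψ) := hc.of_isClosed_subset (isClosed_tsupport _)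
    (tsupport_gradient_subset ψ)
  have i1 : Integrable (fun x => φ x • gradient ψ x) volume :=
    (hφ.continuous.smul (continuous_gradient hψ)).integrable_of_hasCompactSupport hψc.smul_left
  have i2 : Integrable (fun x => ψ x • gradient φ x) volume :=
    (hψ.continuous.smul (continuous_gradient hφ)).integrable_of_hasCompactSupport hc.smul_right
  refine ext_inner_left (𝕜 := ℝ) fun v => ?_
  rw [inner_neg_right, ← integral_inner (𝕜 := ℝ) i1, ← integral_inner (𝕜 := ℝ) i2]
  have e1 : ∀ x, inner ℝ v (φ x • gradient ψ x) = φ x * fderiv ℝ ψ x v := fun x => by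
    rw [inner_smul_right, real_inner_comm, inner_gradient_eq_fderiv]
  have e2 : ∀ x, inner ℝ v (ψ x • gradient φ x) = fderiv ℝ φ x v * ψ x := fun x => by
    rw [inner_smul_right, real_inner_comm, inner_gradient_eq_fderiv, mul_comm]
  have i1' := i1.const_inner (𝕜 := ℝ) v
  have i2' := i2.const_inner (𝕜 := ℝ) v
  simp only [e1, e2] at i1' i2' ⊢
  exact integral_mul_fderiv_eq_neg_fderiv_mul_of_integrable i2' i1'
    ((hφ.continuous.mul hψ.continuous).integrable_of_hasCompactSupport hc.mul_left)
    (fun x _ => hφ.differentiable one_ne_zero x) (fun x _ => hψ.differentiable one_ne_zero x)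

theorem ContDiff.hasWeakGradient {φ : 𝔼 → ℝ} (hφ : ContDiff ℝ 1 φ) (U : Set 𝔼) :
    HasWeakGradient U φ (gradient φ) :=
  hasWeakGradient_iff.2 ⟨hφ.continuous.locallyIntegrable.locallyIntegrableOn U,
    (continuous_gradient hφ).locallyIntegrable.locallyIntegrableOn U, fun ψ hψ =>
    integral_smul_gradient_eq_neg hφ (hψ.1.of_le (by norm_cast)) hψ.2.1⟩

/-- Leibniz rule: the defining identity for `u` is tested with `ψ φ`. -/
theorem HasWeakGradient.mul_contDiff {U : Set 𝔼} (hU : IsOpen U) {u : 𝔼 → ℝ} {g : 𝔼 → 𝔼}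
    (h : HasWeakGradient U u g) {ψ : 𝔼 → ℝ} (hψ : ContDiff ℝ ∞ ψ) :
    HasWeakGradient U (fun x => ψ x * u x) (fun x => ψ x • g x + u x • gradient ψ x) := by
  have hψ1 : ContDiff ℝ 1 ψ := hψ.of_le (by norm_cast)
  have l1 : LocallyIntegrableOn (fun x => ψ x * u x) U volume :=
    h.1.continuousOn_mul hψ.continuous.continuousOn hU.isLocallyClosed
  have l2 : LocallyIntegrableOn (fun x => ψ x • g x) U volume :=
    h.2.1.continuousOn_smul hU.isLocallyClosed hψ.continuous.continuousOn
  have l3 : LocallyIntegrableOn (fun x => u x • gradient ψ x) U volume :=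
    h.1.smul_continuousOn hU.isLocallyClosed (continuous_gradient hψ1).continuousOn
  refine hasWeakGradient_iff.2 ⟨l1, l2.add l3, fun φ hφ => ?_⟩
  have hψφ : IsTestFunction U (fun x => ψ x * φ x) :=
    ⟨hψ.mul hφ.1, hφ.2.1.mul_left, (tsupport_mul_subset_right).trans hφ.2.2⟩
  have e := (hasWeakGradient_iff.1 h).2.2 _ hψφ
  have j1 : Integrable (fun x => (ψ x * u x) • gradient φ x) volume :=
    integrable_smul_of_compact' l1 hφ.continuous_gradient hφ.hasCompactSupport_gradient
      hφ.tsupport_gradient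
  have j2 : Integrable (fun x => φ x • (u x • gradient ψ x)) volume :=
    integrable_smul_of_compact l3 hφ.1.continuous hφ.2.1 hφ.2.2
  have j3 : Integrable (fun x => φ x • (ψ x • g x)) volume :=
    integrable_smul_of_compact l2 hφ.1.continuous hφ.2.1 hφ.2.2
  have e1 : ∀ x, u x • gradient (fun x => ψ x * φ x) x =
      (ψ x * u x) • gradient φ x + φ x • (u x • gradient ψ x) := fun x => by
    rw [gradient_mul (hψ1.differentiable one_ne_zero x)
      (hφ.1.differentiable (by simp) x)]
    module
  have e2 : ∀ x, (ψ x * φ x) • g x = φ x • (ψ x • g x) := fun x => by module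
  simp only [e1, e2] at e
  rw [integral_add j1 j2] at e
  simp only [smul_add]
  rw [integral_add j3 j2, neg_add, ← e]
  abel

theorem tendsto_integral_smul_left {α F : Type*} [MeasurableSpace α] {μ : Measure α}
    [NormedAddCommGroup F] [NormedSpace ℝ F] {s s' : ℝ≥0∞} [hss : ENNReal.HolderConjugate s' s]
    {ι : Type*} {l : Filter ι} {Φ : α → ℝ} (hΦ : MemLp Φ s' μ) {g : ι → α → F} {g₀ : α → F}
    (hg : ∀ i, MemLp (g i) s μ) (hg₀ : MemLp g₀ s μ)
    (h : Tendsto (fun i => eLpNorm (g i - g₀) s μ) l (𝓝 0)) :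
    Tendsto (fun i => ∫ x, Φ x • g i x ∂μ) l (𝓝 (∫ x, Φ x • g₀ x ∂μ)) := by
  have hint : ∀ g' : α → F, MemLp g' s μ → Integrable (fun x => Φ x • g' x) μ := fun g' hg' =>
    memLp_one_iff_integrable.1 (hg'.smul hΦ)
  refine tendsto_integral_of_L1' _ (hint g₀ hg₀).aestronglyMeasurable
    (Eventually.of_forall fun i => hint _ (hg i)) ?_
  refine tendsto_of_tendsto_of_tendsto_of_le_of_le tendsto_const_nhds
    (h := fun i => eLpNorm Φ s' μ * eLpNorm (g i - g₀) s μ) ?_ (fun _ => zero_le) fun i => ?_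
  · simpa using ENNReal.Tendsto.const_mul h (Or.inr hΦ.eLpNorm_ne_top)
  · refine le_trans (le_of_eq ?_) (eLpNorm_smul_le_mul_eLpNorm (r := 1) ((hg i).sub hg₀).1 hΦ.1)
    congr 1
    ext x
    simp [smul_sub]

theorem tendsto_integral_smul_right {α F : Type*} [MeasurableSpace α] {μ : Measure α}
    [NormedAddCommGroup F] [NormedSpace ℝ F] {s s' : ℝ≥0∞} [hss : ENNReal.HolderConjugate s s']
    {ι : Type*} {l : Filter ι} {Φ : α → F} (hΦ : MemLp Φ s' μ) {u : ι → α → ℝ} {u₀ : α → ℝ}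
    (hu : ∀ i, MemLp (u i) s μ) (hu₀ : MemLp u₀ s μ)
    (h : Tendsto (fun i => eLpNorm (u i - u₀) s μ) l (𝓝 0)) :
    Tendsto (fun i => ∫ x, u i x • Φ x ∂μ) l (𝓝 (∫ x, u₀ x • Φ x ∂μ)) := by
  have hint : ∀ g' : α → ℝ, MemLp g' s μ → Integrable (fun x => g' x • Φ x) μ := fun g' hg' =>
    memLp_one_iff_integrable.1 (hΦ.smul hg')
  refine tendsto_integral_of_L1' _ (hint u₀ hu₀).aestronglyMeasurable
    (Eventually.of_forall fun i => hint _ (hu i)) ?_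
  refine tendsto_of_tendsto_of_tendsto_of_le_of_le tendsto_const_nhds
    (h := fun i => eLpNorm (u i - u₀) s μ * eLpNorm Φ s' μ) ?_ (fun _ => zero_le) fun i => ?_
  · simpa using ENNReal.Tendsto.mul_const h (Or.inr hΦ.eLpNorm_ne_top)
  · refine le_trans (le_of_eq ?_) (eLpNorm_smul_le_mul_eLpNorm (r := 1) hΦ.1 ((hu i).sub hu₀).1)
    congr 1
    ext x
    simp [sub_smul]

/-- A test function and its gradient lie in the conjugate Lebesgue space, so by Hölder both sides of
the defining identity pass to the limit. -/
theorem HasWeakGradient.of_tendsto {U : Set 𝔼} {s : ℝ≥0∞} (hs : 1 ≤ s) {ι : Type*} {l : Filter ι}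
    [l.NeBot] {u : ι → 𝔼 → ℝ} {g : ι → 𝔼 → 𝔼} {u₀ : 𝔼 → ℝ} {g₀ : 𝔼 → 𝔼}
    (h : ∀ i, HasWeakGradient U (u i) (g i)) (hu : ∀ i, MemLp (u i) s (volume.restrict U))
    (hg : ∀ i, MemLp (g i) s (volume.restrict U)) (hu₀ : MemLp u₀ s (volume.restrict U))
    (hg₀ : MemLp g₀ s (volume.restrict U))
    (hul : Tendsto (fun i => eLpNorm (u i - u₀) s (volume.restrict U)) l (𝓝 0))
    (hgl : Tendsto (fun i => eLpNorm (g i - g₀) s (volume.restrict U)) l (𝓝 0)) :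
    HasWeakGradient U u₀ g₀ := by
  refine ⟨hu₀.locallyIntegrableOn_of_restrict hs, hg₀.locallyIntegrableOn_of_restrict hs,
    fun φ hφ => ?_⟩
  have : ENNReal.HolderConjugate s s.conjExponent := ENNReal.HolderConjugate.conjExponent hs
  have : ENNReal.HolderConjugate s.conjExponent s := ENNReal.HolderConjugate.symm
  have l1 := tendsto_integral_smul_right (s := s) (s' := s.conjExponent)
    ((hφ.continuous_gradient.memLp_of_hasCompactSupport
      hφ.hasCompactSupport_gradient (p := s.conjExponent) (μ := volume)).restrict U) hu hu₀ hul
  have l2 := tendsto_integral_smul_left (s := s) (s' := s.conjExponent)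
    ((hφ.1.continuous.memLp_of_hasCompactSupport hφ.2.1
      (p := s.conjExponent) (μ := volume)).restrict U) hg hg₀ hgl
  refine tendsto_nhds_unique l1 ?_
  simpa only [fun i => (h i).2.2 φ hφ] using l2.neg

/-- Closedness in the product of Lebesgue spaces yields the completeness that the intersection
argument for convex sets requires. -/
theorem isClosed_sobolevSpace (s : ℝ≥0∞) [hs : Fact (1 ≤ s)] (U : Set 𝔼) :
    IsClosed (sobolevSpace s U : Set (Lp ℝ s (volume.restrict U) × Lp 𝔼 s (volume.restrict U))) := by
  refine isClosed_of_closure_subset fun P hP => ?_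
  obtain ⟨V, hV, hlim⟩ := mem_closure_iff_seq_limit.1 hP
  refine HasWeakGradient.of_tendsto (U := U) hs.out (l := atTop) (u := fun k => (V k).1)
    (g := fun k => (V k).2) hV (fun k => Lp.memLp _) (fun k => Lp.memLp _) (Lp.memLp _)
    (Lp.memLp _) ?_ ?_
  · exact (Lp.tendsto_Lp_iff_tendsto_eLpNorm' _ _).1 ((continuous_fst.tendsto P).comp hlim)
  · exact (Lp.tendsto_Lp_iff_tendsto_eLpNorm' _ _).1 ((continuous_snd.tendsto P).comp hlim)

instance completeSpace_sobolevSpace (s : ℝ≥0∞) [Fact (1 ≤ s)] (U : Set 𝔼) :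
    CompleteSpace (sobolevSpace s U) :=
  (isClosed_sobolevSpace s U).completeSpace_coe

end WeakGradient

/-! ### Mollification as an average of translates. -/

section Mollification

variable {n : ℕ} {F : Type*} [NormedAddCommGroup F] [NormedSpace ℝ F]

local notation "𝔼" => EuclideanSpace ℝ (Fin n)

/-- The mollification of `u` with the normalized bump function `ρ`. -/
noncomputable def mollify (ρ : ContDiffBump (0 : 𝔼)) (u : 𝔼 → F) : 𝔼 → F :=
  MeasureTheory.convolution (ρ.normed volume) u (ContinuousLinearMap.lsmul ℝ ℝ) volume

/-- The probability measure whose density is the normalized bump function `ρ`. -/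
noncomputable def bumpMeasure (ρ : ContDiffBump (0 : 𝔼)) : Measure 𝔼 :=
  volume.withDensity fun t => ENNReal.ofReal (ρ.normed volume t)

/-- A bump function with outer radius `ε`. -/
noncomputable def bumpOfRadius (n : ℕ) (ε : ℝ) (hε : 0 < ε) :
    ContDiffBump (0 : EuclideanSpace ℝ (Fin n)) where
  rIn := ε / 2
  rOut := ε
  rIn_pos := half_pos hε
  rIn_lt_rOut := half_lt_self hε

theorem measurable_bump_density (ρ : ContDiffBump (0 : 𝔼)) :
    Measurable fun t => ENNReal.ofReal (ρ.normed volume t) :=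
  ρ.continuous_normed.measurable.ennreal_ofReal

instance (ρ : ContDiffBump (0 : 𝔼)) : IsProbabilityMeasure (bumpMeasure ρ) := by
  refine ⟨?_⟩
  rw [bumpMeasure, withDensity_apply _ MeasurableSet.univ, Measure.restrict_univ,
    ← ofReal_integral_eq_lintegral_ofReal ρ.integrable_normed
      (Eventually.of_forall ρ.nonneg_normed), ρ.integral_normed, ENNReal.ofReal_one]

theorem ae_bumpMeasure (ρ : ContDiffBump (0 : 𝔼)) :
    ∀ᵐ t ∂(bumpMeasure ρ), t ∈ Metric.ball (0 : 𝔼) ρ.rOut := by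
  rw [bumpMeasure, ae_withDensity_iff (measurable_bump_density ρ)]
  refine Eventually.of_forall fun t ht => ?_
  rw [← ρ.support_normed_eq (μ := volume), Function.mem_support]
  intro h
  simp [h] at ht

/-- Seen as an average over a probability measure, mollification inherits every `L^s` bound on
translates through Minkowski's inequality. -/
theorem mollify_eq_integral (ρ : ContDiffBump (0 : 𝔼)) (u : 𝔼 → F) (x : 𝔼) :
    mollify ρ u x = ∫ t, u (x - t) ∂(bumpMeasure ρ) := by
  rw [bumpMeasure, integral_withDensity_eq_integral_toReal_smul (measurable_bump_density ρ)
    (Eventually.of_forall fun _ => ENNReal.ofReal_lt_top), mollify, convolution_def]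
  refine integral_congr_ae (Eventually.of_forall fun t => ?_)
  simp [ENNReal.toReal_ofReal (ρ.nonneg_normed t)]

theorem mollify_eq_integral_swap (ρ : ContDiffBump (0 : 𝔼)) (u : 𝔼 → F) (x : 𝔼) :
    mollify ρ u x = ∫ t, ρ.normed volume (x - t) • u t := by
  rw [mollify, convolution_eq_swap]
  rfl

theorem contDiff_mollify (ρ : ContDiffBump (0 : 𝔼)) {u : 𝔼 → F}
    (hu : LocallyIntegrable u volume) : ContDiff ℝ ∞ (mollify ρ u) :=
  ρ.hasCompactSupport_normed.contDiff_convolution_left _ (ρ.contDiff_normed (n := ⊤)) hu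

theorem integrable_sub_bumpMeasure (ρ : ContDiffBump (0 : 𝔼)) {u : 𝔼 → F}
    (hu : LocallyIntegrable u volume) (x : 𝔼) :
    Integrable (fun t => u (x - t)) (bumpMeasure ρ) := by
  rw [bumpMeasure, integrable_withDensity_iff_integrable_smul' (measurable_bump_density ρ)
    (Eventually.of_forall fun _ => ENNReal.ofReal_lt_top)]
  have := ρ.hasCompactSupport_normed.convolutionExists_left (ContinuousLinearMap.lsmul ℝ ℝ)
    (ρ.continuous_normed (μ := volume)) hu x
  refine this.congr (Eventually.of_forall fun t => ?_)
  simp [ENNReal.toReal_ofReal (ρ.nonneg_normed t)]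

theorem aestronglyMeasurable_sub_bumpMeasure (ρ : ContDiffBump (0 : 𝔼)) {G : Type*} [NormedAddCommGroup G] {u : 𝔼 → G}
    (hu : AEStronglyMeasurable u volume) :
    AEStronglyMeasurable (Function.uncurry fun x t => u (x - t)) (volume.prod (bumpMeasure ρ)) := by
  have hq : Measure.QuasiMeasurePreserving (fun p : 𝔼 × 𝔼 => p.1 - p.2)
      ((volume : Measure 𝔼).prod (bumpMeasure ρ)) volume := by
    refine QuasiMeasurePreserving.prod_of_left measurable_sub
      (Eventually.of_forall fun y => ?_)
    exact (measurePreserving_sub_right volume y).quasiMeasurePreserving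
  exact hu.comp_quasiMeasurePreserving hq

theorem eLpNorm_comp_add_right {s : ℝ≥0∞} {G : Type*} [NormedAddCommGroup G] 
    {u : 𝔼 → G} (hu : AEStronglyMeasurable u volume) (a : 𝔼) : eLpNorm (fun x => u (x + a)) s volume = eLpNorm u s volume :=
  eLpNorm_comp_measurePreserving hu (measurePreserving_add_right volume a)

/-- Mollification is a contraction of `L^s`. -/
theorem eLpNorm_mollify_le {s : ℝ≥0∞} (hs : 1 ≤ s) (hs' : s ≠ ⊤) (ρ : ContDiffBump (0 : 𝔼))
    {u : 𝔼 → F} (hu : AEStronglyMeasurable u volume) :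
    eLpNorm (mollify ρ u) s volume ≤ eLpNorm u s volume := by
  simp only [funext (mollify_eq_integral ρ u)]
  refine eLpNorm_integral_le_of_forall_eLpNorm_le hs hs'
    (aestronglyMeasurable_sub_bumpMeasure ρ hu) (Eventually.of_forall fun t => ?_)
  simpa only [sub_eq_add_neg] using (eLpNorm_comp_add_right hu (-t)).le

/-- The mollification error is the average of the differences `u(· - t) - u` over shifts `t` shorter
than the outer radius. -/
theorem eLpNorm_mollify_sub_le [CompleteSpace F] {s : ℝ≥0∞} (hs : 1 ≤ s) (hs' : s ≠ ⊤) (ρ : ContDiffBump (0 : 𝔼))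
    {u : 𝔼 → F} (hu : LocallyIntegrable u volume) {C : ℝ≥0∞}
    (hC : ∀ a : 𝔼, ‖a‖ < ρ.rOut → eLpNorm (fun x => u (x + a) - u x) s volume ≤ C) :
    eLpNorm (fun x => mollify ρ u x - u x) s volume ≤ C := by
  have hum := hu.aestronglyMeasurable
  have h1 : ∀ x, mollify ρ u x - u x = ∫ t, (u (x - t) - u x) ∂(bumpMeasure ρ) := fun x => by
    rw [integral_sub (integrable_sub_bumpMeasure ρ hu x) (integrable_const _),
      mollify_eq_integral]
    simp
  simp only [h1]
  refine eLpNorm_integral_le_of_forall_eLpNorm_le hs hs'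
    ((aestronglyMeasurable_sub_bumpMeasure ρ hum).sub hum.comp_fst) ?_
  filter_upwards [ae_bumpMeasure ρ] with t ht
  simpa only [sub_eq_add_neg] using hC (-t) (by simpa using ht)

/-- Composition with a measure-preserving map is continuous on `L^s` as the map varies in the
compact-open topology, and translations depend continuously on the shift there. -/
theorem tendsto_eLpNorm_translate_sub {s : ℝ≥0∞} (hs : 1 ≤ s) (hs' : s ≠ ⊤) {G : Type*} [NormedAddCommGroup G] {u : 𝔼 → G}
    (hu : MemLp u s volume) :
    Tendsto (fun a : 𝔼 => eLpNorm (fun x => u (x + a) - u x) s volume) (𝓝 0) (𝓝 0) := by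
  have : Fact (1 ≤ s) := ⟨hs⟩
  set g : C(𝔼, C(𝔼, 𝔼)) := (ContinuousMap.mk (fun p : 𝔼 × 𝔼 => p.2 + p.1) (by fun_prop)).curry
    with hg
  have hmp : ∀ a : 𝔼, MeasurePreserving (g a) volume volume := fun a =>
    measurePreserving_add_right volume a
  have h := Filter.Tendsto.compMeasurePreservingLp (tendsto_const_nhds (x := hu.toLp u))
    (g.continuous.tendsto 0) hmp (hmp 0) hs'
  rw [Lp.tendsto_Lp_iff_tendsto_eLpNorm'] at h
  refine h.congr fun a => eLpNorm_congr_ae ?_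
  rw [Lp.toLp_compMeasurePreserving hu (hmp a), Lp.toLp_compMeasurePreserving hu (hmp 0)]
  filter_upwards [(hu.comp_measurePreserving (hmp a)).coeFn_toLp,
    (hu.comp_measurePreserving (hmp 0)).coeFn_toLp] with x h1 h2
  rw [Pi.sub_apply, h1, h2]
  simp [hg]

theorem exists_forall_eLpNorm_translate_sub_lt {s : ℝ≥0∞} (hs : 1 ≤ s) (hs' : s ≠ ⊤) 
    {G : Type*} [NormedAddCommGroup G] {u : 𝔼 → G}
    (hu : MemLp u s volume) {ε : ℝ≥0∞} (hε : 0 < ε) :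
    ∃ δ > 0, ∀ a : 𝔼, ‖a‖ < δ → eLpNorm (fun x => u (x + a) - u x) s volume < ε := by
  have := (tendsto_eLpNorm_translate_sub hs hs' hu).eventually (gt_mem_nhds hε)
  obtain ⟨δ, hδ, h⟩ := Metric.eventually_nhds_iff.1 this
  exact ⟨δ, hδ, fun a ha => h (by simpa using ha)⟩

/-- The gradient of a mollification is the mollification of the weak gradient, as long as the
support of the kernel stays in the domain. -/
theorem gradient_mollify {U : Set 𝔼} {u w : 𝔼 → ℝ} {g G : 𝔼 → 𝔼} (h : HasWeakGradient U u g)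
    (ρ : ContDiffBump (0 : 𝔼)) (hw : LocallyIntegrable w volume) {x : 𝔼}
    (hx : Metric.closedBall x ρ.rOut ⊆ U) (hwu : ∀ y ∈ Metric.closedBall x ρ.rOut, w y = u y)
    (hGg : ∀ y ∈ Metric.closedBall x ρ.rOut, G y = g y) :
    gradient (mollify ρ w) x = mollify ρ G x := by
  set κ : 𝔼 → ℝ := ρ.normed volume with hκ
  have hκc : ContDiff ℝ ∞ κ := ρ.contDiff_normed (n := ⊤)
  have hκ1 : ContDiff ℝ 1 κ := hκc.of_le (by norm_cast)
  -- The reflected kernel at `x` is itself an admissible test function, since its support lies in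
  -- the closed ball contained in `U`. Only the values of `w` and `G` on that ball matter, so
  -- truncations may replace `u` and `g`.
  set φ : 𝔼 → ℝ := fun t => κ (x - t) with hφdef
  have hsupp : tsupport φ ⊆ Metric.closedBall x ρ.rOut := by
    refine closure_minimal (fun t ht => ?_) Metric.isClosed_closedBall
    have : x - t ∈ Function.support κ := ht
    rw [hκ, ρ.support_normed_eq] at this
    rw [Metric.mem_closedBall, dist_comm, dist_eq_norm]
    simpa using (mem_ball_zero_iff.1 this).le
  have hφ : IsTestFunction U φ :=
    ⟨hκc.comp (contDiff_const.sub contDiff_id),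
      (isCompact_closedBall x ρ.rOut).of_isClosed_subset (isClosed_tsupport _) hsupp,
      hsupp.trans hx⟩
  have hfd : ∀ t v, fderiv ℝ κ (x - t) v = - inner ℝ (gradient φ t) v := fun t v => by
    have h1 : HasFDerivAt φ ((fderiv ℝ κ (x - t)).comp (-ContinuousLinearMap.id ℝ 𝔼)) t :=
      (hκ1.differentiable one_ne_zero (x - t)).hasFDerivAt.comp t ((hasFDerivAt_id t).const_sub x)
    rw [inner_gradient_eq_fderiv, h1.fderiv]
    simp
  have hder := ρ.hasCompactSupport_normed.hasFDerivAt_convolution_left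
    (ContinuousLinearMap.lsmul ℝ ℝ) hκ1 hw x
  have hzero : ∀ t, t ∉ Metric.closedBall x ρ.rOut → φ t = 0 ∧ gradient φ t = 0 := fun t ht =>
    ⟨image_eq_zero_of_notMem_tsupport fun h => ht (hsupp h),
      Function.notMem_support.1 fun h => ht (hsupp (support_gradient_subset φ h))⟩
  have e1 : ∀ t, w t • gradient φ t = u t • gradient φ t := fun t => by
    by_cases ht : t ∈ Metric.closedBall x ρ.rOut
    · rw [hwu t ht]
    · rw [(hzero t ht).2, smul_zero, smul_zero]
  have e2 : ∀ t, φ t • G t = φ t • g t := fun t => by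
    by_cases ht : t ∈ Metric.closedBall x ρ.rOut
    · rw [hGg t ht]
    · rw [(hzero t ht).1, zero_smul, zero_smul]
  have hmain : mollify ρ G x = - ∫ t, w t • gradient φ t := by
    rw [mollify_eq_integral_swap]
    simp only [e1]
    rw [(hasWeakGradient_iff.1 h).2.2 φ hφ, neg_neg]
    exact integral_congr_ae (Eventually.of_forall e2)
  have hi : Integrable (fun t => w t • gradient φ t) volume := by
    simpa only [e1] using h.integrable_left hφ
  refine ext_inner_right (𝕜 := ℝ) fun v => ?_
  rw [inner_gradient_eq_fderiv, mollify, hder.fderiv, hmain, inner_neg_left, real_inner_comm,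
    ← integral_inner (𝕜 := ℝ) hi, convolution_eq_swap, ← integral_neg,
    ContinuousLinearMap.integral_apply]
  · refine integral_congr_ae (Eventually.of_forall fun t => ?_)
    simp only [ContinuousLinearMap.precompL_apply, ContinuousLinearMap.lsmul_apply,
      inner_smul_right, smul_eq_mul]
    rw [← hκ, hfd, real_inner_comm]
    ring
  · have := (hκ1.continuous_fderiv one_ne_zero)
    have h2 := (ρ.hasCompactSupport_normed (μ := volume)).fderiv ℝ |>.convolutionExists_left
      ((ContinuousLinearMap.lsmul ℝ ℝ).precompL 𝔼) this hw x
    exact (convolutionExistsAt_iff_integrable_swap).1 h2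

end Mollification

/-! ### Translation estimates in terms of the weak gradient. -/

section Translation

variable {n : ℕ}

local notation "𝔼" => EuclideanSpace ℝ (Fin n)

theorem eLpNorm_le_of_ae_tendsto {α F : Type*} [MeasurableSpace α] [NormedAddCommGroup F]
    {μ : Measure α} {s C : ℝ≥0∞} {f : ℕ → α → F} (hf : ∀ k, AEStronglyMeasurable (f k) μ)
    {f₀ : α → F} (hlim : ∀ᵐ x ∂μ, Tendsto (fun k => f k x) atTop (𝓝 (f₀ x)))
    (hC : ∀ k, eLpNorm (f k) s μ ≤ C) : eLpNorm f₀ s μ ≤ C :=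
  (Lp.eLpNorm_lim_le_liminf_eLpNorm hf f₀ hlim).trans
    ((liminf_le_liminf (Eventually.of_forall hC)).trans (liminf_const C).le)

/-- The difference is the integral of the derivative along the segment from `y` to `y + a`;
Minkowski's inequality in the segment parameter gives the bound. The field `G` need only agree with
the gradient on these segments, but its norm is taken over the whole space. -/
theorem eLpNorm_translate_sub_le_of_contDiff {m : 𝔼 → ℝ} (hm : ContDiff ℝ 1 m) {G : 𝔼 → 𝔼}
    (hG : Continuous G) {s : ℝ≥0∞} (hs : 1 ≤ s) (hs' : s ≠ ⊤) {a : 𝔼} {K : Set 𝔼}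
    (hK : MeasurableSet K)
    (hmG : ∀ y ∈ K, ∀ r ∈ Icc (0 : ℝ) 1, gradient m (y + r • a) = G (y + r • a)) :
    eLpNorm (fun y => m (y + a) - m y) s (volume.restrict K) ≤ ‖a‖ₑ * eLpNorm G s volume := by
  have hcont : Continuous (Function.uncurry fun (y : 𝔼) (r : ℝ) =>
      inner ℝ (G (y + r • a)) a) := by
    unfold Function.uncurry
    fun_prop
  have hcont' : ∀ y : 𝔼, Continuous fun r : ℝ => inner ℝ (G (y + r • a)) a :=
    fun y => hcont.comp (by fun_prop : Continuous fun r : ℝ => (y, r))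
  have hftc : ∀ y ∈ K, m (y + a) - m y =
      ∫ r in Ioc (0 : ℝ) 1, inner ℝ (G (y + r • a)) a := fun y hy => by
    rw [← intervalIntegral.integral_of_le zero_le_one,
      intervalIntegral.integral_eq_sub_of_hasDerivAt
        (f := fun r : ℝ => m (y + r • a)) _ ((hcont' y).intervalIntegrable 0 1)]
    · simp
    · intro r hr
      rw [uIcc_of_le zero_le_one] at hr
      rw [← hmG y hy r hr, inner_gradient_eq_fderiv]
      have h1 : HasDerivAt (fun r : ℝ => y + r • a) a r := by
        simpa using ((hasDerivAt_id r).smul_const a).const_add y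
      exact (hm.differentiable one_ne_zero (y + r • a)).hasFDerivAt.comp_hasDerivAt r h1
  have : IsProbabilityMeasure (volume.restrict (Ioc (0 : ℝ) 1)) := ⟨by simp⟩
  rw [eLpNorm_congr_ae ((ae_restrict_iff' hK).2 (Eventually.of_forall hftc))]
  refine eLpNorm_integral_le_of_forall_eLpNorm_le hs hs' hcont.aestronglyMeasurable
    (Eventually.of_forall fun r => ?_)
  calc eLpNorm (fun y => inner ℝ (G (y + r • a)) a) s (volume.restrict K)
      ≤ eLpNorm (fun y => inner ℝ (G (y + r • a)) a) s volume :=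
        eLpNorm_mono_measure _ Measure.restrict_le_self
    _ ≤ ENNReal.ofReal ‖a‖ * eLpNorm (fun y => G (y + r • a)) s volume := by
        refine eLpNorm_le_mul_eLpNorm_of_ae_le_mul (Eventually.of_forall fun y => ?_) s
        rw [mul_comm]
        exact norm_inner_le_norm _ _
    _ = ‖a‖ₑ * eLpNorm G s volume := by
        rw [eLpNorm_comp_add_right hG.aestronglyMeasurable, ofReal_norm]

/-- The smooth estimate is applied to mollifications, whose gradients are mollified weak gradients
near the segments; almost everywhere convergence and Fatou's lemma then give the claim for `u`. -/
theorem HasWeakGradient.eLpNorm_translate_sub_le_of_isCompact {U : Set 𝔼} (hU : IsOpen U)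
    {u : 𝔼 → ℝ} {g : 𝔼 → 𝔼} (h : HasWeakGradient U u g) {s : ℝ≥0∞} (hs : 1 ≤ s) (hs' : s ≠ ⊤)
    {a : 𝔼} {K : Set 𝔼} (hK : IsCompact K) (hseg : ∀ y ∈ K, ∀ r ∈ Icc (0 : ℝ) 1, y + r • a ∈ U) :
    eLpNorm (fun y => u (y + a) - u y) s (volume.restrict K) ≤
      ‖a‖ₑ * eLpNorm g s (volume.restrict U) := by
  rcases eq_or_ne a 0 with rfl | ha
  · simp
  rcases eq_or_ne (eLpNorm g s (volume.restrict U)) ⊤ with hgt | hgt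
  · rw [hgt, ENNReal.mul_top (by simpa using ha)]
    exact le_top
  have hUm := hU.measurableSet
  set G : 𝔼 → 𝔼 := U.indicator g with hGdef
  have hG : MemLp G s volume :=
    (memLp_indicator_iff_restrict hUm).2 ⟨h.2.1.aestronglyMeasurable, hgt.lt_top⟩
  have hGl : LocallyIntegrable G volume := hG.locallyIntegrable hs
  have hGe : eLpNorm G s volume = eLpNorm g s (volume.restrict U) :=
    eLpNorm_indicator_eq_eLpNorm_restrict hUm
  -- The compact set swept out by the segments. It has a compact neighbourhood `T` in `U`, and `u`
  -- is truncated to `T` so that it becomes integrable on the whole space.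
  set K' : Set 𝔼 := (fun p : 𝔼 × ℝ => p.1 + p.2 • a) '' (K ×ˢ Icc (0 : ℝ) 1) with hK'def
  have hK' : IsCompact K' := (hK.prod isCompact_Icc).image (by fun_prop)
  have hmemK' : ∀ y ∈ K, ∀ r ∈ Icc (0 : ℝ) 1, y + r • a ∈ K' := fun y hy r hr =>
    ⟨(y, r), ⟨hy, hr⟩, rfl⟩
  have hK'U : K' ⊆ U := by
    rintro _ ⟨⟨y, r⟩, ⟨hy, hr⟩, rfl⟩
    exact hseg y hy r hr
  obtain ⟨δ, hδ, hδU⟩ := hK'.exists_cthickening_subset_open hU hK'U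
  set T := Metric.cthickening δ K' with hT
  have hTc : IsCompact T := hK'.cthickening
  set w : 𝔼 → ℝ := T.indicator u with hw
  have hwi : Integrable w volume :=
    (h.1.integrableOn_compact_subset hδU hTc).integrable_indicator hTc.measurableSet
  have hwl := hwi.locallyIntegrable
  have hρ0 : ∀ k : ℕ, 0 < δ / ((k : ℝ) + 1) := fun k => by positivity
  set ρ : ℕ → ContDiffBump (0 : 𝔼) := fun k => bumpOfRadius n (δ / ((k : ℝ) + 1)) (hρ0 k) with hρ
  have hball : ∀ k, ∀ z ∈ K', Metric.closedBall z (ρ k).rOut ⊆ T := fun k z hz => by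
    refine (Metric.closedBall_subset_closedBall ?_).trans
      (Metric.closedBall_subset_cthickening hz δ)
    change δ / ((k : ℝ) + 1) ≤ δ
    exact div_le_self hδ.le (by linarith [(Nat.cast_nonneg k : (0 : ℝ) ≤ k)])
  have hgrad : ∀ k, ∀ z ∈ K', gradient (mollify (ρ k) w) z = mollify (ρ k) G z := fun k z hz =>
    gradient_mollify h (ρ k) hwl ((hball k z hz).trans hδU)
      (fun y hy => indicator_of_mem (hball k z hz hy) u)
      (fun y hy => indicator_of_mem (hδU (hball k z hz hy)) g)
  have hmcont : ∀ k, Continuous (mollify (ρ k) G) := fun k => (contDiff_mollify (ρ k) hGl).continuous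
  have hkey : ∀ k, eLpNorm (fun y => mollify (ρ k) w (y + a) - mollify (ρ k) w y) s
      (volume.restrict K) ≤ ‖a‖ₑ * eLpNorm g s (volume.restrict U) := fun k => by
    refine (eLpNorm_translate_sub_le_of_contDiff ((contDiff_mollify (ρ k) hwl).of_le
      (by norm_cast)) (hmcont k) hs hs' hK.measurableSet
      fun y hy r hr => hgrad k _ (hmemK' y hy r hr)).trans ?_
    gcongr
    exact (eLpNorm_mollify_le hs hs' (ρ k) hG.1).trans hGe.le
  have hlim : ∀ᵐ y ∂(volume : Measure 𝔼),
      Tendsto (fun k => mollify (ρ k) w y) atTop (𝓝 (w y)) := by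
    refine ContDiffBump.ae_convolution_tendsto_right_of_locallyIntegrable (K := 2) ?_
      (Eventually.of_forall fun k => ?_) hwl
    · have h0 := (tendsto_one_div_add_atTop_nhds_zero_nat (𝕜 := ℝ)).const_mul δ
      simp only [mul_one_div, mul_zero] at h0
      exact h0
    · change δ / ((k : ℝ) + 1) ≤ 2 * (δ / ((k : ℝ) + 1) / 2)
      linarith
  have hlim' := (measurePreserving_add_right volume a).quasiMeasurePreserving.ae hlim
  refine eLpNorm_le_of_ae_tendsto (f := fun k y => mollify (ρ k) w (y + a) - mollify (ρ k) w y)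
    (fun k => ?_) ?_ hkey
  · have := (contDiff_mollify (ρ k) hwl).continuous
    exact (by fun_prop : Continuous fun y => mollify (ρ k) w (y + a) -
      mollify (ρ k) w y).aestronglyMeasurable
  · rw [ae_restrict_iff' hK.measurableSet]
    filter_upwards [hlim, hlim'] with y h1 h2 hy
    have hmem : ∀ z ∈ K', w z = u z := fun z hz =>
      indicator_of_mem (Metric.self_subset_cthickening K' hz) u
    have m1 := hmem _ (by simpa using hmemK' y hy 0 (by simp))
    have m2 := hmem _ (by simpa using hmemK' y hy 1 (by simp))
    rw [m1] at h1
    rw [m2] at h2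
    exact h2.sub h1

/-- Exhaustion of the open set by compact sets, with Fatou's lemma; the compact estimate has a
constant independent of the set. -/
theorem HasWeakGradient.eLpNorm_translate_sub_le {U : Set 𝔼} (hU : IsOpen U)
    {u : 𝔼 → ℝ} {g : 𝔼 → 𝔼} (h : HasWeakGradient U u g) {s : ℝ≥0∞} (hs : 1 ≤ s) (hs' : s ≠ ⊤)
    {a : 𝔼} {D : Set 𝔼} (hD : IsOpen D) (hseg : ∀ y ∈ D, ∀ r ∈ Icc (0 : ℝ) 1, y + r • a ∈ U) :
    eLpNorm (fun y => u (y + a) - u y) s (volume.restrict D) ≤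
      ‖a‖ₑ * eLpNorm g s (volume.restrict U) := by
  obtain ⟨K, hKcl, hKD, hKU, hKm⟩ := hD.exists_iUnion_isClosed
  set L : ℕ → Set 𝔼 := fun k => K k ∩ Metric.closedBall 0 k with hL
  have hLc : ∀ k, IsCompact (L k) := fun k =>
    (isCompact_closedBall (0 : 𝔼) k).inter_left (hKcl k)
  have hLD : ∀ k, L k ⊆ D := fun k => inter_subset_left.trans (hKD k)
  have hDU : D ⊆ U := fun y hy => by simpa using hseg y hy 0 (by simp)
  have hua : AEStronglyMeasurable (fun y => u (y + a)) (volume.restrict D) := by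
    have h1 := (measurePreserving_add_right (volume : Measure 𝔼) a).restrict_preimage
      hU.measurableSet
    have h2 := h.1.aestronglyMeasurable.comp_measurePreserving h1
    exact h2.mono_measure (Measure.restrict_mono
      (fun y hy => by simpa using hseg y hy 1 (by simp)) le_rfl)
  have hum : AEStronglyMeasurable u (volume.restrict D) :=
    h.1.aestronglyMeasurable.mono_measure (Measure.restrict_mono hDU le_rfl)
  refine eLpNorm_le_of_ae_tendsto (f := fun k => (L k).indicator fun y => u (y + a) - u y)
    (fun k => (hua.sub hum).indicator (hLc k).measurableSet) ?_ fun k => ?_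
  · rw [ae_restrict_iff' hD.measurableSet]
    refine Eventually.of_forall fun y hy => tendsto_const_nhds.congr' ?_
    obtain ⟨m, hm⟩ := mem_iUnion.1 (hKU.symm ▸ hy : y ∈ ⋃ k, K k)
    obtain ⟨m', hm'⟩ := exists_nat_ge ‖y‖
    filter_upwards [eventually_ge_atTop (max m m')] with k hk
    rw [indicator_of_mem]
    refine ⟨hKm (le_of_max_le_left hk) hm, ?_⟩
    rw [mem_closedBall_zero_iff]
    exact hm'.trans (by exact_mod_cast le_of_max_le_right hk)
  · rw [eLpNorm_indicator_eq_eLpNorm_restrict (hLc k).measurableSet,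
      Measure.restrict_restrict (hLc k).measurableSet, inter_eq_self_of_subset_left (hLD k)]
    exact h.eLpNorm_translate_sub_le_of_isCompact hU hs hs' (hLc k)
      fun y hy => hseg y (hLD k hy)

end Translation

/-! ### Consequences of the Lipschitz boundary, and locally constant functions. -/

section Geometry

variable {n : ℕ}

local notation "𝔼" => EuclideanSpace ℝ (Fin n)

/-- Near a boundary point of a set with Lipschitz boundary, a translation in a suitable direction
moves points of the set inside, and points of the complement outside, at a comparable distance from
the boundary. -/
theorem HasLipschitzBoundary.exists_cone {U : Set 𝔼} (hU : HasLipschitzBoundary U) {x : 𝔼}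
    (hx : x ∈ frontier U) :
    ∃ e : 𝔼, ‖e‖ = 1 ∧ ∃ r > 0, ∃ κ > 0, κ ≤ 1 ∧ ∀ y ∈ Metric.ball x r, ∀ h ∈ Ioo (0 : ℝ) r,
      (y ∈ U → Metric.closedBall (y + h • e) (κ * h) ⊆ U) ∧
      (y ∉ U → Metric.closedBall (y - h • e) (κ * h) ⊆ Uᶜ) := by
  obtain ⟨e, γ, K, δ, he, hγ, hδ, hchart⟩ := hU x hx
  have hK : (0 : ℝ) ≤ K := K.2
  -- A perturbation `d` changes the height along `e` by at most `‖d‖` and the graph function by at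
  -- most `2K‖d‖`. As `2Kκ + 2κ = 1`, perturbations up to `κh` cannot undo a shift of `h`.
  set κ : ℝ := 1 / (2 * (K + 1)) with hκ
  have hκ0 : 0 < κ := by positivity
  have hκK : 2 * (K : ℝ) * κ + 2 * κ = 1 := by rw [hκ]; field_simp
  have hκ1 : 2 * κ ≤ 1 := by nlinarith [mul_nonneg hK hκ0.le]
  have hee : inner ℝ e e = (1 : ℝ) := by rw [real_inner_self_eq_norm_sq, he]; norm_num
  have hproj : ∀ d : 𝔼, ‖d - inner ℝ e d • e‖ ≤ 2 * ‖d‖ := fun d => by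
    have h1 := abs_real_inner_le_norm e d
    rw [he, one_mul] at h1
    calc ‖d - inner ℝ e d • e‖ ≤ ‖d‖ + ‖inner ℝ e d • e‖ := norm_sub_le _ _
      _ ≤ ‖d‖ + ‖d‖ := by
          rw [norm_smul, he, mul_one]
          exact add_le_add le_rfl h1
      _ = _ := by ring
  have key : ∀ (y d : 𝔼) (t : ℝ), |γ (y + t • e + d - inner ℝ e (y + t • e + d) • e) -
      γ (y - inner ℝ e y • e)| ≤ 2 * K * ‖d‖ ∧
      |inner ℝ e (y + t • e + d) - (inner ℝ e y + t)| ≤ ‖d‖ := fun y d t => by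
    have hin : inner ℝ e (y + t • e + d) = inner ℝ e y + t + inner ℝ e d := by
      rw [inner_add_right, inner_add_right, inner_smul_right, hee, mul_one]
    constructor
    · have h1 := hγ.dist_le_mul (y + t • e + d - inner ℝ e (y + t • e + d) • e)
        (y - inner ℝ e y • e)
      have h2 : y + t • e + d - inner ℝ e (y + t • e + d) • e - (y - inner ℝ e y • e) =
          d - inner ℝ e d • e := by
        rw [hin]; module
      rw [Real.dist_eq, dist_eq_norm, h2] at h1
      refine h1.trans ?_
      have := mul_le_mul_of_nonneg_left (hproj d) hK
      linarith
    · rw [hin, add_sub_cancel_left]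
      simpa [he] using abs_real_inner_le_norm e d
  -- The distance to the centre, the shift and the perturbation are each below `δ/3`, so everything
  -- stays in the chart.
  refine ⟨e, he, δ / 3, by positivity, κ, hκ0, by linarith, fun y hy h hh => ?_⟩
  have hyd := Metric.mem_ball.1 hy
  have hyx : y ∈ Metric.ball x δ := Metric.mem_ball.2 (by linarith)
  have hmem : ∀ (t : ℝ) (d : 𝔼), |t| = h → ‖d‖ ≤ κ * h → y + t • e + d ∈ Metric.ball x δ :=
    fun t d ht hd => by
      rw [Metric.mem_ball, dist_eq_norm]
      have h1 : y + t • e + d - x = (y - x) + t • e + d := by abel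
      have h2 : ‖t • e‖ = h := by rw [norm_smul, he, mul_one, Real.norm_eq_abs, ht]
      have h3 : ‖y - x‖ < δ / 3 := by rwa [← dist_eq_norm]
      have h4 : κ * h ≤ h / 2 := by nlinarith [hh.1]
      calc ‖y + t • e + d - x‖ ≤ ‖y - x‖ + ‖t • e‖ + ‖d‖ := by
            rw [h1]; exact norm_add₃_le
        _ < δ := by linarith [hh.2]
  have hk2 : 2 * K * (κ * h) + 2 * (κ * h) = h := by
    linear_combination h * hκK
  have hκh : 0 < κ * h := mul_pos hκ0 hh.1
  constructor
  · intro hyU w hw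
    have hlt := (hchart y hyx).1 hyU
    set d := w - (y + h • e) with hd
    have hdn : ‖d‖ ≤ κ * h := by rw [hd, ← dist_eq_norm]; exact hw
    have hwd : w = y + h • e + d := by rw [hd]; abel
    have h0 := hmem h d (abs_of_pos hh.1) hdn
    obtain ⟨k1, k2⟩ := key y d h
    rw [hwd, hchart _ h0]
    have hKd := mul_le_mul_of_nonneg_left hdn (by positivity : 0 ≤ 2 * (K : ℝ))
    linarith [(abs_le.1 k1).2, (abs_le.1 k2).1]
  · intro hyU w hw
    have hlt : inner ℝ e y ≤ γ (y - inner ℝ e y • e) := not_lt.1 fun hlt => hyU ((hchart y hyx).2 hlt)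
    set d := w - (y - h • e) with hd
    have hdn : ‖d‖ ≤ κ * h := by rw [hd, ← dist_eq_norm]; exact hw
    have hwd : w = y + (-h) • e + d := by rw [hd]; module
    have h0 := hmem (-h) d (by rw [abs_neg, abs_of_pos hh.1]) hdn
    obtain ⟨k1, k2⟩ := key y d (-h)
    rw [hwd, mem_compl_iff, hchart _ h0, not_lt]
    have hKd := mul_le_mul_of_nonneg_left hdn (by positivity : 0 ≤ 2 * (K : ℝ))
    linarith [(abs_le.1 k1).1, (abs_le.1 k2).2]

open scoped Pointwise in
-- A short shift along `e` moves boundary points off the boundary, so shifts by different amounts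
-- give disjoint copies of a small boundary piece. Infinitely many disjoint translates with bounded
-- shifts force measure zero.
theorem HasLipschitzBoundary.volume_frontier {U : Set 𝔼} (hU : HasLipschitzBoundary U) :
    volume (frontier U) = 0 := by
  refine measure_null_of_locally_null _ fun x hx => ?_
  obtain ⟨e, he, r, hr, κ, hκ, -, hcone⟩ := hU.exists_cone hx
  refine ⟨frontier U ∩ Metric.ball x r,
    inter_mem_nhdsWithin _ (Metric.ball_mem_nhds x hr), ?_⟩
  have hshift : ∀ y ∈ frontier U ∩ Metric.ball x r, ∀ h ∈ Ioo (0 : ℝ) r,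
      y + h • e ∉ frontier U := fun y hy h hh hmem => by
    have hκh : 0 < κ * h := mul_pos hκ hh.1
    obtain ⟨y', hy'U, hy'⟩ : ∃ y' ∈ U, y' ∈ Metric.ball x r ∩ Metric.ball y (κ * h) := by
      have hn : Metric.ball x r ∩ Metric.ball y (κ * h) ∈ 𝓝 y :=
        inter_mem (Metric.isOpen_ball.mem_nhds hy.2) (Metric.ball_mem_nhds y hκh)
      obtain ⟨z, hz1, hz2⟩ := mem_closure_iff_nhds.1 (frontier_subset_closure hy.1) _ hn
      exact ⟨z, hz2, hz1⟩
    have hsub := ((hcone y' hy'.1 h hh).1 hy'U)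
    refine hmem.2 (mem_interior.2 ⟨Metric.ball (y' + h • e) (κ * h),
      Metric.ball_subset_closedBall.trans hsub, Metric.isOpen_ball, ?_⟩)
    rw [Metric.mem_ball, dist_add_right, dist_comm]
    exact hy'.2
  -- The denominator `k + 2` keeps all shifts, and hence their differences, strictly below `r`.
  set u : ℕ → 𝔼 := fun k => (r / ((k : ℝ) + 2)) • e with hu
  have hu1 : ∀ k : ℕ, 0 < r / ((k : ℝ) + 2) ∧ r / ((k : ℝ) + 2) < r := fun k => by
    refine ⟨by positivity, div_lt_self hr ?_⟩
    linarith [(Nat.cast_nonneg k : (0 : ℝ) ≤ k)]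
  have hlt : ∀ j k : ℕ, j < k → Disjoint ({u j} + (frontier U ∩ Metric.ball x r))
      ({u k} + (frontier U ∩ Metric.ball x r)) := fun j k hjk => by
    rw [Set.disjoint_left]
    rintro _ ⟨_, rfl, y, hy, rfl⟩ ⟨_, rfl, y', hy', heq⟩
    have hjk' : r / ((k : ℝ) + 2) < r / ((j : ℝ) + 2) := by
      have : (j : ℝ) < k := by exact_mod_cast hjk
      gcongr
    refine hshift y hy (r / ((j : ℝ) + 2) - r / ((k : ℝ) + 2))
      ⟨by linarith, by linarith [(hu1 j).2, (hu1 k).1]⟩ ?_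
    have : y + (r / ((j : ℝ) + 2) - r / ((k : ℝ) + 2)) • e = y' := by
      simp only [hu] at heq
      rw [sub_smul, eq_comm, ← sub_eq_iff_eq_add'.2 heq.symm]
      abel
    rw [this]
    exact hy'.1
  refine Measure.addHaar_eq_zero_of_disjoint_translates volume u ?_ ?_
    (isClosed_frontier.measurableSet.inter Metric.isOpen_ball.measurableSet)
  · refine (Metric.isBounded_closedBall (x := (0 : 𝔼)) (r := r)).subset ?_
    rintro _ ⟨k, rfl⟩
    rw [mem_closedBall_zero_iff, hu, norm_smul, he, mul_one, Real.norm_of_nonneg (hu1 k).1.le]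
    exact (hu1 k).2.le
  · intro j k hjk
    rcases hjk.lt_or_gt with h | h
    · exact hlt j k h
    · exact (hlt k j h).symm

/-- One local direction has to serve both sets. Because `closure A ⊆ Ω`, at most one of the two
requirements is nonvacuous near a given point: the direction is `e` at the boundary of `A`, `-e` at
the boundary of `Ω`, and zero elsewhere. -/
theorem exists_shift {Ω A : Set 𝔼} (hΩ : IsOpen Ω) (hΩL : HasLipschitzBoundary Ω) (hA : IsOpen A)
    (hAL : HasLipschitzBoundary A) (hAΩ : closure A ⊆ Ω) {x : 𝔼} (hx : x ∈ closure Ω) :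
    ∃ a : 𝔼, ∃ r > 0, ∃ κ > 0, ∀ y ∈ Metric.ball x r, ∀ h ∈ Ioo (0 : ℝ) r,
      (y ∈ A → Metric.closedBall (y + h • a) (κ * h) ⊆ A) ∧
      (y ∉ Ω → Metric.closedBall (y + h • a) (κ * h) ⊆ Ωᶜ) := by
  by_cases hxΩ : x ∈ Ω
  · obtain ⟨r₁, hr₁, hball₁⟩ := Metric.isOpen_iff.1 hΩ x hxΩ
    by_cases hxA : x ∈ A
    · obtain ⟨r₂, hr₂, hball₂⟩ := Metric.isOpen_iff.1 hA x hxA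
      refine ⟨0, min r₁ (r₂ / 2), by positivity, 1, one_pos, fun y hy h hh => ⟨fun _ w hw => ?_,
        fun hyΩ => absurd (hball₁ (Metric.ball_subset_ball (min_le_left _ _) hy)) hyΩ⟩⟩
      refine hball₂ ?_
      rw [smul_zero, add_zero, one_mul, Metric.mem_closedBall] at hw
      have h1 := (Metric.mem_ball.1 hy).trans_le (min_le_right _ _)
      have h2 := hh.2.trans_le (min_le_right _ _)
      rw [Metric.mem_ball]
      linarith [dist_triangle w y x]
    · by_cases hxA' : x ∈ closure A
      · have hfr : x ∈ frontier A := ⟨hxA', by rwa [hA.interior_eq]⟩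
        obtain ⟨e, -, r, hr, κ, hκ, -, hcone⟩ := hAL.exists_cone hfr
        refine ⟨e, min r₁ r, by positivity, κ, hκ, fun y hy h hh => ⟨fun hyA =>
          (hcone y (Metric.ball_subset_ball (min_le_right _ _) hy) h
            ⟨hh.1, hh.2.trans_le (min_le_right _ _)⟩).1 hyA,
          fun hyΩ => absurd (hball₁ (Metric.ball_subset_ball (min_le_left _ _) hy)) hyΩ⟩⟩
      · obtain ⟨r₂, hr₂, hball₂⟩ := Metric.isOpen_iff.1 isClosed_closure.isOpen_compl x hxA'
        exact ⟨0, min r₁ r₂, by positivity, 1, one_pos, fun y hy h hh => ⟨fun hyA =>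
          absurd (subset_closure hyA) (hball₂ (Metric.ball_subset_ball (min_le_right _ _) hy)),
          fun hyΩ => absurd (hball₁ (Metric.ball_subset_ball (min_le_left _ _) hy)) hyΩ⟩⟩
  · have hfr : x ∈ frontier Ω := ⟨hx, by rwa [hΩ.interior_eq]⟩
    obtain ⟨e, -, r, hr, κ, hκ, -, hcone⟩ := hΩL.exists_cone hfr
    obtain ⟨r₂, hr₂, hball₂⟩ := Metric.isOpen_iff.1 isClosed_closure.isOpen_compl x
      (fun h => hxΩ (hAΩ h))
    refine ⟨-e, min r r₂, by positivity, κ, hκ, fun y hy h hh => ⟨fun hyA =>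
          absurd (subset_closure hyA) (hball₂ (Metric.ball_subset_ball (min_le_right _ _) hy)),
          fun hyΩ => ?_⟩⟩
    rw [smul_neg, ← sub_eq_add_neg]
    exact (hcone y (Metric.ball_subset_ball (min_le_left _ _) hy) h
      ⟨hh.1, hh.2.trans_le (min_le_left _ _)⟩).2 hyΩ

theorem exists_smooth_partition {ι : Type} [Fintype ι] {s : Set 𝔼} (hs : IsClosed s)
    {U : ι → Set 𝔼} (hU : ∀ i, IsOpen (U i)) (hsU : s ⊆ ⋃ i, U i) :
    ∃ ψ : ι → 𝔼 → ℝ, (∀ i, ContDiff ℝ ∞ (ψ i)) ∧ (∀ i, tsupport (ψ i) ⊆ U i) ∧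
      ∀ x ∈ s, ∑ i, ψ i x = 1 := by
  obtain ⟨f, hf⟩ := SmoothPartitionOfUnity.exists_isSubordinate (modelWithCornersSelf ℝ 𝔼) hs U hU hsU
  refine ⟨fun i => f i, fun i => (f i).contMDiff.contDiff, hf, fun x hx => ?_⟩
  rw [← finsum_eq_sum_of_fintype]
  exact f.sum_eq_one hx

/-- A function whose weak gradient vanishes in an open set agrees almost everywhere with a function
that is locally constant in this set. -/
theorem exists_ae_eq_locally_constant {A : Set 𝔼} (hA : IsOpen A) {z : 𝔼 → ℝ}
    (hz : LocallyIntegrable z volume) (h : HasWeakGradient A z 0) :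
    ∃ c : 𝔼 → ℝ, c =ᵐ[volume] z ∧ ∀ x ∈ A, ∀ᶠ y in 𝓝 x, c y = c x := by
  have hρ0 : ∀ k : ℕ, 0 < 1 / ((k : ℝ) + 1) := fun k => by positivity
  set ρ : ℕ → ContDiffBump (0 : 𝔼) := fun k => bumpOfRadius n (1 / ((k : ℝ) + 1)) (hρ0 k) with hρ
  have hlim0 : Tendsto (fun k => (ρ k).rOut) atTop (𝓝 0) := tendsto_one_div_add_atTop_nhds_zero_nat
  have hlim : ∀ᵐ y ∂(volume : Measure 𝔼), Tendsto (fun k => mollify (ρ k) z y) atTop (𝓝 (z y)) := by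
    refine ContDiffBump.ae_convolution_tendsto_right_of_locallyIntegrable (K := 2) hlim0
      (Eventually.of_forall fun k => ?_) hz
    change 1 / ((k : ℝ) + 1) ≤ 2 * (1 / ((k : ℝ) + 1) / 2)
    linarith
  -- The representative is the limit of mollifications. On a small ball these have zero gradient for
  -- large `k`, hence are constant there, so the limits at two points of the ball agree whether or
  -- not they exist.
  refine ⟨fun y => limUnder atTop fun k => mollify (ρ k) z y,
    hlim.mono fun y hy => hy.limUnder_eq, fun x hx => ?_⟩
  obtain ⟨r, hr, hball⟩ := Metric.isOpen_iff.1 hA x hx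
  filter_upwards [Metric.ball_mem_nhds x (half_pos hr)] with y hy
  have hev : (fun k => mollify (ρ k) z y) =ᶠ[atTop] fun k => mollify (ρ k) z x := by
    filter_upwards [hlim0.eventually (gt_mem_nhds (half_pos hr))] with k hk
    have hgr : ∀ w ∈ Metric.ball x (r / 2), fderivWithin ℝ (mollify (ρ k) z) (Metric.ball x (r / 2)) w
        = 0 := fun w hw => by
      rw [fderivWithin_of_isOpen Metric.isOpen_ball hw]
      have hsub : Metric.closedBall w (ρ k).rOut ⊆ A := fun y hy => hball (by
        rw [Metric.mem_closedBall] at hy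
        rw [Metric.mem_ball] at hw ⊢
        linarith [dist_triangle y w x])
      have h0 := gradient_mollify (G := 0) h (ρ k) hz hsub (fun _ _ => rfl) (fun _ _ => rfl)
      have h1 : mollify (ρ k) (0 : 𝔼 → 𝔼) w = 0 := by simp [mollify_eq_integral]
      rw [h1] at h0
      ext v
      rw [← inner_gradient_eq_fderiv, h0]
      simp
    exact (convex_ball x (r / 2)).is_const_of_fderivWithin_eq_zero
      ((contDiff_mollify (ρ k) hz).differentiable (by simp)).differentiableOn hgr hy
      (Metric.mem_ball_self (half_pos hr))
  simp only [limUnder, map_congr hev]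

/-- A locally constant function has zero derivative, and the mean value inequality applies on a
convex set. It will be used on balls and segments inside `A`. -/
theorem eq_of_locally_constant {A S : Set 𝔼} {c : 𝔼 → ℝ}
    (hc : ∀ x ∈ A, ∀ᶠ y in 𝓝 x, c y = c x) (hS : Convex ℝ S) (hSA : S ⊆ A) {x y : 𝔼}
    (hx : x ∈ S) (hy : y ∈ S) : c x = c y := by
  have hd : ∀ w ∈ S, HasFDerivWithinAt c (0 : 𝔼 →L[ℝ] ℝ) S w := fun w hw =>
    ((hasFDerivAt_const (c w) w).congr_of_eventuallyEq (hc w (hSA hw))).hasFDerivWithinAt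
  have := hS.norm_image_sub_le_of_norm_hasFDerivWithin_le (C := 0) hd (by simp) hy hx
  rwa [zero_mul, norm_le_zero_iff, sub_eq_zero] at this

end Geometry

/-! ### Smooth approximation preserving the vanishing gradient in `A`. -/

section Density

variable {n : ℕ}

local notation "𝔼" => EuclideanSpace ℝ (Fin n)

theorem mollify_congr_ae {F : Type*} [NormedAddCommGroup F] [NormedSpace ℝ F]
    (ρ : ContDiffBump (0 : 𝔼)) {u v : 𝔼 → F} (h : u =ᵐ[volume] v) : mollify ρ u = mollify ρ v := by
  ext x
  rw [mollify_eq_integral_swap, mollify_eq_integral_swap]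
  exact integral_congr_ae (h.mono fun t ht => congrArg (ρ.normed volume (x - t) • ·) ht)

theorem mollify_eq_zero (ρ : ContDiffBump (0 : 𝔼)) {u : 𝔼 → ℝ} {x : 𝔼}
    (h : ∀ᵐ t ∂(volume : Measure 𝔼), t ∈ Metric.closedBall x ρ.rOut → u t = 0) :
    mollify ρ u x = 0 := by
  rw [mollify_eq_integral_swap, ← integral_zero 𝔼 ℝ (μ := volume)]
  refine integral_congr_ae (h.mono fun t ht => ?_)
  simp only
  by_cases hmem : t ∈ Metric.closedBall x ρ.rOut
  · rw [ht hmem, smul_zero]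
  · have : x - t ∉ Function.support (ρ.normed (volume : Measure 𝔼)) := fun h => by
      rw [ρ.support_normed_eq, mem_ball_zero_iff, ← dist_eq_norm, dist_comm] at h
      exact hmem h.le
    rw [Function.notMem_support.1 this, zero_smul]

theorem mollify_eq_self (ρ : ContDiffBump (0 : 𝔼)) {u : 𝔼 → ℝ} {x : 𝔼}
    (h : ∀ y ∈ Metric.ball x ρ.rOut, u y = u x) : mollify ρ u x = u x :=
  ContDiffBump.normed_convolution_eq_right h

/-- The error splits into the mollification error, seen at the shifted point, and the translation
error. -/
theorem eLpNorm_mollify_translate_sub_le {F : Type*} [NormedAddCommGroup F] [NormedSpace ℝ F]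
    {s : ℝ≥0∞} (hs : 1 ≤ s) (ρ : ContDiffBump (0 : 𝔼)) {u : 𝔼 → F}
    (hu : LocallyIntegrable u volume) (a : 𝔼) :
    eLpNorm (fun y => mollify ρ u (y + a) - u y) s volume ≤
      eLpNorm (fun y => mollify ρ u y - u y) s volume +
        eLpNorm (fun y => u (y + a) - u y) s volume := by
  have hum := hu.aestronglyMeasurable
  have hm : AEStronglyMeasurable (fun y => mollify ρ u y - u y) volume :=
    (contDiff_mollify ρ hu).continuous.aestronglyMeasurable.sub hum
  have hua : AEStronglyMeasurable (fun y => u (y + a)) volume :=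
    hum.comp_measurePreserving (measurePreserving_add_right volume a)
  have hma := hm.comp_measurePreserving (measurePreserving_add_right volume a)
  rw [← eLpNorm_comp_add_right hm a]
  refine le_trans (le_of_eq ?_) (eLpNorm_add_le hma (hua.sub hum) hs)
  congr 1
  ext y
  simp

theorem gradient_comp_add_right (m : 𝔼 → ℝ) (a y : 𝔼) :
    gradient (fun x => m (x + a)) y = gradient m (y + a) := by
  simp only [gradient, fderiv_comp_add_right]

theorem gradient_fun_sum {ι : Type*} {t : Finset ι} {f : ι → 𝔼 → ℝ} {y : 𝔼}
    (h : ∀ i ∈ t, DifferentiableAt ℝ (f i) y) :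
    gradient (fun x => ∑ i ∈ t, f i x) y = ∑ i ∈ t, gradient (f i) y := by
  simp only [gradient, fderiv_fun_sum h, map_sum]

theorem gradient_eq_zero_of_eventually_const {f : 𝔼 → ℝ} {y : 𝔼} {c : ℝ} (h : ∀ᶠ x in 𝓝 y, f x = c) :
    gradient f y = 0 := by
  have : f =ᶠ[𝓝 y] fun _ => c := h
  simp [gradient, this.fderiv_eq]

/-- Mollifying leaves the value at `y + a` unchanged because the ball is in `A`, and the value at `y
+ a` equals that at `y` because the segment is in `A`. -/
theorem mollify_shift_eq {A : Set 𝔼} {c : 𝔼 → ℝ} (hc : ∀ x ∈ A, ∀ᶠ y in 𝓝 x, c y = c x)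
    (ρ : ContDiffBump (0 : 𝔼)) {y a : 𝔼} (hseg : ∀ θ ∈ Icc (0 : ℝ) 1, y + θ • a ∈ A)
    (hball : Metric.ball (y + a) ρ.rOut ⊆ A) : mollify ρ c (y + a) = c y := by
  rw [mollify_eq_self ρ fun w hw => eq_of_locally_constant hc (convex_ball _ _) hball hw
    (Metric.mem_ball_self ρ.rOut_pos)]
  refine eq_of_locally_constant hc (convex_segment y (y + a)) ?_ (right_mem_segment ℝ _ _)
    (left_mem_segment ℝ _ _)
  rw [segment_eq_image']
  rintro _ ⟨θ, hθ, rfl⟩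
  simpa using hseg θ hθ

/-- The approximation is `∑ ψ_i m(· + τ a_i)`, with `m` a mollification and `a_i` the local
directions of `exists_shift`. The shifts make every summand vanish near the complement of `Ω`, and
make it equal to `ψ_i c` on `A`, where `c` is the locally constant representative. As the `ψ_i` sum
to one, the approximation equals `c` on `A` and has zero gradient there. -/
theorem exists_contDiff_approx_aux {Ω A : Set 𝔼} (hΩ : IsOpen Ω) (hΩb : Bornology.IsBounded Ω)
    (hΩL : HasLipschitzBoundary Ω) (hA : IsOpen A) (hAL : HasLipschitzBoundary A)
    (hAΩ : closure A ⊆ Ω) {s : ℝ≥0∞} (hs : 1 ≤ s) (hs' : s ≠ ⊤) {z : 𝔼 → ℝ} {g : 𝔼 → 𝔼}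
    (h : HasWeakGradient univ z g) (hz : MemLp z s volume) (hg : MemLp g s volume)
    (hz0 : ∀ᵐ x ∂(volume : Measure 𝔼), x ∉ Ω → z x = 0) (hgA : g =ᵐ[volume.restrict A] 0) :
    ∃ M : ℝ≥0∞, M ≠ ⊤ ∧ ∀ η : ℝ≥0∞, 0 < η → ∃ φ : 𝔼 → ℝ, ContDiff ℝ ∞ φ ∧ HasCompactSupport φ ∧
      tsupport φ ⊆ Ω ∧ (∀ x ∈ A, gradient φ x = 0) ∧
      eLpNorm (z - φ) s (volume.restrict Ω) ≤ M * η ∧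
      eLpNorm (g - gradient φ) s (volume.restrict Ω) ≤ M * η := by
  have hzl : LocallyIntegrable z volume := hz.locallyIntegrable hs
  have hgl : LocallyIntegrable g volume := hg.locallyIntegrable hs
  have hAsub : A ⊆ Ω := subset_closure.trans hAΩ
  obtain ⟨c, hcz, hcA⟩ := exists_ae_eq_locally_constant hA hzl
    ((h.mono (subset_univ A)).congr hA (ae_eq_refl _) hgA)
  have hcomp : IsCompact (closure Ω) := hΩb.isCompact_closure
  choose! a r hr κ hκ hsh using fun x (hx : x ∈ closure Ω) =>
    exists_shift hΩ hΩL hA hAL hAΩ hx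
  obtain ⟨t, ht⟩ := hcomp.elim_nhds_subcover' (fun x _ => Metric.ball x (r x / 2))
    (fun x hx => Metric.ball_mem_nhds x (half_pos (hr x hx)))
  obtain ⟨ψ, hψc, hψs, hψ1⟩ := exists_smooth_partition (ι := t) isClosed_closure
    (U := fun i => Metric.ball (i : 𝔼) (r i / 2)) (fun _ => Metric.isOpen_ball)
    (fun x hx => by
      obtain ⟨i, hi, hxi⟩ := mem_iUnion₂.1 (ht hx)
      exact mem_iUnion.2 ⟨⟨i, hi⟩, hxi⟩)
  have hmem : ∀ i : t, (i : 𝔼) ∈ closure Ω := fun i => i.1.2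
  have hψcs : ∀ i, HasCompactSupport (ψ i) := fun i =>
    (isCompact_closedBall (i : 𝔼) (r i / 2)).of_isClosed_subset (isClosed_tsupport _)
      ((hψs i).trans Metric.ball_subset_closedBall)
  have hψ1' : ∀ i, ContDiff ℝ 1 (ψ i) := fun i => (hψc i).of_le (by norm_cast)
  choose C hC using fun i => (hψcs i).exists_bound_of_continuous (hψc i).continuous
  choose D hD using fun i => HasCompactSupport.exists_bound_of_continuous
    ((hψcs i).of_isClosed_subset (isClosed_tsupport _) (tsupport_gradient_subset (ψ i)))
    (continuous_gradient (hψ1' i))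
  -- The constant depends only on bounds for the partition functions and their gradients. The factor
  -- two accounts for one mollification error and one translation error, each at most `η`.
  refine ⟨∑ i, (ENNReal.ofReal (C i) + ENNReal.ofReal (D i)) * 2, ?_, fun η hη => ?_⟩
  · exact ENNReal.sum_ne_top.2 fun i _ => ENNReal.mul_ne_top
      (ENNReal.add_ne_top.2 ⟨ENNReal.ofReal_ne_top, ENNReal.ofReal_ne_top⟩) ENNReal.ofNat_ne_top
  obtain ⟨δ₁, hδ₁, hzδ⟩ := exists_forall_eLpNorm_translate_sub_lt hs hs' hz hη
  obtain ⟨δ₂, hδ₂, hgδ⟩ := exists_forall_eLpNorm_translate_sub_lt hs hs' hg hη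
  set δ := min δ₁ δ₂ with hδ
  have hδ0 : 0 < δ := lt_min hδ₁ hδ₂
  obtain ⟨τ, hτ0, hτ⟩ : ∃ τ : ℝ, 0 < τ ∧ ∀ i : t, τ < r i ∧ ‖τ • a i‖ < δ := by
    have h1 : ∀ᶠ τ : ℝ in 𝓝[>] 0, 0 < τ := self_mem_nhdsWithin
    have h2 : ∀ i : t, ∀ᶠ τ : ℝ in 𝓝[>] 0, τ < r i ∧ ‖τ • a i‖ < δ := fun i => by
      refine nhdsWithin_le_nhds ((gt_mem_nhds (hr i (hmem i))).and ?_)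
      have : Tendsto (fun τ : ℝ => ‖τ • a i‖) (𝓝 0) (𝓝 ‖(0 : ℝ) • a i‖) :=
        (by fun_prop : Continuous fun τ : ℝ => ‖τ • a i‖).tendsto 0
      rw [zero_smul, norm_zero] at this
      exact this.eventually (gt_mem_nhds hδ0)
    exact (h1.and (eventually_all.2 h2)).exists
  -- The mollification radius is chosen after the shift: a ball of radius `ε` whose centre is
  -- displaced by less than `ε` must fit in the ball of radius `κ_i τ` provided by the geometry.
  obtain ⟨ε, hε0, hεδ, hε⟩ : ∃ ε : ℝ, 0 < ε ∧ ε < δ ∧ ∀ i : t, 2 * ε < κ i * τ ∧ 2 * ε < r i := by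
    have h1 : ∀ᶠ ε : ℝ in 𝓝[>] 0, 0 < ε := self_mem_nhdsWithin
    have h2 : ∀ b : ℝ, 0 < b → ∀ᶠ ε : ℝ in 𝓝[>] 0, 2 * ε < b := fun b hb => by
      refine nhdsWithin_le_nhds ?_
      filter_upwards [gt_mem_nhds (half_pos hb)] with ε hε
      linarith
    have h3 : ∀ᶠ ε : ℝ in 𝓝[>] 0, ε < δ := nhdsWithin_le_nhds (gt_mem_nhds hδ0)
    exact (h1.and (h3.and (eventually_all.2 fun i : t =>
      (h2 _ (mul_pos (hκ i (hmem i)) hτ0)).and (h2 _ (hr i (hmem i)))))).exists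
  set ρ := bumpOfRadius n ε hε0 with hρ
  have hρε : ρ.rOut = ε := rfl
  set m := mollify ρ z with hm
  have hmc : ContDiff ℝ ∞ m := contDiff_mollify ρ hzl
  have hmg : ∀ y, gradient m y = mollify ρ g y := fun y =>
    gradient_mollify h ρ hzl (subset_univ _) (fun _ _ => rfl) (fun _ _ => rfl)
  have hmia : ∀ i : t, ContDiff ℝ ∞ fun y => m (y + τ • a i) := fun i =>
    hmc.comp (contDiff_id.add contDiff_const)
  have hz2 : ∀ i : t, eLpNorm (fun y => m (y + τ • a i) - z y) s volume ≤ 2 * η := fun i => by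
    refine (eLpNorm_mollify_translate_sub_le hs ρ hzl _).trans ?_
    rw [two_mul]
    refine add_le_add (eLpNorm_mollify_sub_le hs hs' ρ hzl fun b hb => (hzδ b ?_).le)
      (hzδ _ ((hτ i).2.trans_le (min_le_left _ _))).le
    exact (hb.trans hεδ).trans_le (min_le_left _ _)
  have hg2 : ∀ i : t, eLpNorm (fun y => mollify ρ g (y + τ • a i) - g y) s volume ≤ 2 * η :=
    fun i => by
    refine (eLpNorm_mollify_translate_sub_le hs ρ hgl _).trans ?_
    rw [two_mul]
    refine add_le_add (eLpNorm_mollify_sub_le hs hs' ρ hgl fun b hb => (hgδ b ?_).le)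
      (hgδ _ ((hτ i).2.trans_le (min_le_right _ _))).le
    exact (hb.trans hεδ).trans_le (min_le_right _ _)
  set φ : 𝔼 → ℝ := fun y => ∑ i : t, ψ i y * m (y + τ • a i) with hφ
  have hφc : ContDiff ℝ ∞ φ := ContDiff.sum fun i _ => (hψc i).mul (hmia i)
  have hψball : ∀ (i : t) (y : 𝔼), ψ i y ≠ 0 → y ∈ Metric.ball (i : 𝔼) (r i / 2) := fun i y hy =>
    hψs i (subset_tsupport _ hy)
  -- Vanishing on a whole neighbourhood of the complement is needed to place the closed support
  -- inside the open set `Ω`.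
  have hφ0 : ∀ y ∈ Metric.thickening ε Ωᶜ, φ y = 0 := fun y hy => by
    obtain ⟨y₀, hy₀, hyy₀⟩ := Metric.mem_thickening_iff.1 hy
    refine Finset.sum_eq_zero fun i _ => ?_
    by_cases hψy : ψ i y = 0
    · rw [hψy, zero_mul]
    · have h1 := Metric.mem_ball.1 (hψball i y hψy)
      have h2 : y₀ ∈ Metric.ball (i : 𝔼) (r i) := by
        rw [Metric.mem_ball]
        rw [dist_comm] at hyy₀
        linarith [dist_triangle y₀ y i, (hε i).2]
      have h3 := (hsh i (hmem i) y₀ h2 τ ⟨hτ0, (hτ i).1⟩).2 hy₀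
      have h4 : Metric.closedBall (y + τ • a i) ρ.rOut ⊆ Ωᶜ := fun w hw => h3 (by
        rw [Metric.mem_closedBall, hρε] at hw
        rw [Metric.mem_closedBall]
        have h5 : dist (y + τ • a i) (y₀ + τ • a i) = dist y y₀ := dist_add_right _ _ _
        linarith [dist_triangle w (y + τ • a i) (y₀ + τ • a i), (hε i).1])
      rw [hm, mollify_eq_zero ρ (hz0.mono fun w hw hw' => hw (h4 hw')), mul_zero]
  have hφs : tsupport φ ⊆ (Metric.thickening ε Ωᶜ)ᶜ :=
    closure_minimal (fun y hy hy' => hy (hφ0 y hy')) Metric.isOpen_thickening.isClosed_compl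
  have hφΩ : tsupport φ ⊆ Ω := hφs.trans (compl_subset_comm.1 (Metric.self_subset_thickening hε0 _))
  have hφA : ∀ y ∈ A, φ y = c y := fun y hy => by
    have h1 : ∀ i : t, ψ i y * m (y + τ • a i) = ψ i y * c y := fun i => by
      by_cases hψy : ψ i y = 0
      · rw [hψy, zero_mul, zero_mul]
      · have h2 := Metric.ball_subset_ball (half_le_self (hr i (hmem i)).le) (hψball i y hψy)
        rw [hm, ← mollify_congr_ae ρ hcz, mollify_shift_eq hcA ρ ?_ ?_]
        · intro θ hθ
          rcases hθ.1.eq_or_lt with h0 | h0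
          · rwa [← h0, zero_smul, add_zero]
          · have h3 : θ * τ ≤ τ := mul_le_of_le_one_left hτ0.le hθ.2
            have h4 := (hsh i (hmem i) y h2 (θ * τ) ⟨mul_pos h0 hτ0, h3.trans_lt (hτ i).1⟩).1 hy
            rw [smul_smul]
            exact h4 (Metric.mem_closedBall_self
              (mul_nonneg (hκ i (hmem i)).le (mul_pos h0 hτ0).le))
        · refine Subset.trans ?_ ((hsh i (hmem i) y h2 τ ⟨hτ0, (hτ i).1⟩).1 hy)
          refine (Metric.ball_subset_ball ?_).trans Metric.ball_subset_closedBall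
          rw [hρε]
          linarith [(hε i).1]
    rw [hφ]
    simp only [h1]
    rw [← Finset.sum_mul, hψ1 y (subset_closure (hAsub hy)), one_mul]
  have hgφ : ∀ y, gradient φ y = ∑ i : t, (ψ i y • mollify ρ g (y + τ • a i) +
      m (y + τ • a i) • gradient (ψ i) y) := fun y => by
    have hd1 : ∀ i : t, DifferentiableAt ℝ (ψ i) y := fun i =>
      (hψc i).differentiable (by simp) y
    have hd2 : ∀ i : t, DifferentiableAt ℝ (fun y => m (y + τ • a i)) y := fun i =>
      (hmia i).differentiable (by simp) y
    rw [hφ, gradient_fun_sum (f := fun (i : t) x => ψ i x * m (x + τ • a i))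
      fun i _ => (hd1 i).mul (hd2 i)]
    refine Finset.sum_congr rfl fun i _ => ?_
    rw [gradient_mul (hd1 i) (hd2 i), gradient_comp_add_right, hmg]
  -- This cancellation lets `z` be subtracted from the factors of `∇ψ_i`, so that only the small
  -- differences `m(· + τ a_i) - z` remain in the gradient error.
  have hψg : ∀ y ∈ Ω, ∑ i : t, gradient (ψ i) y = 0 := fun y hy => by
    rw [← gradient_fun_sum fun i _ => (hψc i).differentiable (by simp) y]
    refine gradient_eq_zero_of_eventually_const (c := 1) ?_
    filter_upwards [hΩ.mem_nhds hy] with y' hy' using hψ1 y' (subset_closure hy')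
  have hbd : ∀ {F F' : Type} [NormedAddCommGroup F] [NormedAddCommGroup F'] (f : 𝔼 → F)
      (w : 𝔼 → F') (B : ℝ), (∀ y, ‖f y‖ ≤ B * ‖w y‖) → eLpNorm w s volume ≤ 2 * η →
      eLpNorm f s (volume.restrict Ω) ≤ ENNReal.ofReal B * (2 * η) := fun f w B hfw hw =>
    (eLpNorm_mono_measure _ Measure.restrict_le_self).trans
      ((eLpNorm_le_mul_eLpNorm_of_ae_le_mul (Eventually.of_forall hfw) s).trans (by gcongr))
  have hmz : ∀ i : t, AEStronglyMeasurable (fun y => m (y + τ • a i) - z y) volume := fun i =>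
    (hmia i).continuous.aestronglyMeasurable.sub hz.1
  have hmg' : ∀ i : t, AEStronglyMeasurable (fun y => mollify ρ g (y + τ • a i) - g y) volume :=
    fun i => ((contDiff_mollify ρ hgl).continuous.comp
      (continuous_id.add continuous_const)).aestronglyMeasurable.sub hg.1
  have hψm : ∀ i : t, AEStronglyMeasurable (ψ i) volume := fun i =>
    (hψc i).continuous.aestronglyMeasurable
  have hgψm : ∀ i : t, AEStronglyMeasurable (gradient (ψ i)) volume := fun i =>
    (continuous_gradient (hψ1' i)).aestronglyMeasurable
  have hf1 : ∀ i : t, eLpNorm (fun y => ψ i y • (m (y + τ • a i) - z y)) s (volume.restrict Ω) ≤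
      ENNReal.ofReal (C i) * (2 * η) := fun i => hbd _ _ _ (fun y => by
    rw [norm_smul]
    exact mul_le_mul_of_nonneg_right (hC i y) (norm_nonneg _)) (hz2 i)
  have hf2 : ∀ i : t, eLpNorm (fun y => ψ i y • (mollify ρ g (y + τ • a i) - g y)) s
      (volume.restrict Ω) ≤ ENNReal.ofReal (C i) * (2 * η) := fun i => hbd _ _ _ (fun y => by
    rw [norm_smul]
    exact mul_le_mul_of_nonneg_right (hC i y) (norm_nonneg _)) (hg2 i)
  have hf3 : ∀ i : t, eLpNorm (fun y => (m (y + τ • a i) - z y) • gradient (ψ i) y) s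
      (volume.restrict Ω) ≤ ENNReal.ofReal (D i) * (2 * η) := fun i => hbd _ _ _ (fun y => by
    rw [norm_smul, mul_comm]
    exact mul_le_mul_of_nonneg_right (hD i y) (norm_nonneg _)) (hz2 i)
  refine ⟨φ, hφc, (hΩb.isCompact_closure).of_isClosed_subset (isClosed_tsupport _)
    (hφΩ.trans subset_closure), hφΩ, fun y hy => ?_, ?_, ?_⟩
  · refine gradient_eq_zero_of_eventually_const (c := c y) ?_
    filter_upwards [hA.mem_nhds hy, hcA y hy] with y' hy' hcy'
    rw [hφA y' hy', hcy']
  · have he : φ - z =ᵐ[volume.restrict Ω]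
        ∑ i : t, fun y => ψ i y • (m (y + τ • a i) - z y) := by
      rw [Filter.EventuallyEq, ae_restrict_iff' hΩ.measurableSet]
      refine Eventually.of_forall fun y hy => ?_
      simp only [Finset.sum_apply, smul_sub, Finset.sum_sub_distrib, Pi.sub_apply]
      rw [← Finset.sum_smul, hψ1 y (subset_closure hy), one_smul]
      rfl
    rw [eLpNorm_sub_comm, eLpNorm_congr_ae he]
    refine (eLpNorm_sum_le (fun i _ => ((hψm i).smul (hmz i)).restrict) hs).trans ?_
    rw [Finset.sum_mul]
    refine Finset.sum_le_sum fun i _ => (hf1 i).trans ?_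
    rw [mul_assoc]
    gcongr
    exact le_self_add
  · have he : gradient φ - g =ᵐ[volume.restrict Ω]
        ∑ i : t, ((fun y => ψ i y • (mollify ρ g (y + τ • a i) - g y)) +
          fun y => (m (y + τ • a i) - z y) • gradient (ψ i) y) := by
      rw [Filter.EventuallyEq, ae_restrict_iff' hΩ.measurableSet]
      refine Eventually.of_forall fun y hy => ?_
      simp only [Finset.sum_apply, smul_sub, sub_smul, Finset.sum_sub_distrib, Pi.sub_apply,
        Pi.add_apply, hgφ, Finset.sum_add_distrib]
      rw [← Finset.sum_smul, hψ1 y (subset_closure hy), one_smul, ← Finset.smul_sum, hψg y hy,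
        smul_zero, sub_zero]
      abel
    rw [eLpNorm_sub_comm, eLpNorm_congr_ae he]
    refine (eLpNorm_sum_le (fun i _ => (((hψm i).smul (hmg' i)).restrict).add
      ((hmz i).smul (hgψm i)).restrict) hs).trans ?_
    rw [Finset.sum_mul]
    refine Finset.sum_le_sum fun i _ => (eLpNorm_add_le ((hψm i).smul (hmg' i)).restrict
      ((hmz i).smul (hgψm i)).restrict hs).trans ?_
    rw [mul_assoc, add_mul]
    exact add_le_add (hf2 i) (hf3 i)

/-- Density: a Sobolev function that vanishes outside `Ω`, with vanishing gradient in `A`, is the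
limit of smooth functions with compact support in `Ω` and vanishing gradient in `A`. -/
theorem exists_contDiff_approx {Ω A : Set 𝔼} (hΩ : IsOpen Ω) (hΩb : Bornology.IsBounded Ω)
    (hΩL : HasLipschitzBoundary Ω) (hA : IsOpen A) (hAL : HasLipschitzBoundary A)
    (hAΩ : closure A ⊆ Ω) {s : ℝ≥0∞} (hs : 1 ≤ s) (hs' : s ≠ ⊤) {z : 𝔼 → ℝ} {g : 𝔼 → 𝔼}
    (h : HasWeakGradient univ z g) (hz : MemLp z s volume) (hg : MemLp g s volume)
    (hz0 : ∀ᵐ x ∂(volume : Measure 𝔼), x ∉ Ω → z x = 0) (hgA : g =ᵐ[volume.restrict A] 0) :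
    ∃ φ : ℕ → 𝔼 → ℝ, (∀ k, ContDiff ℝ ∞ (φ k) ∧ HasCompactSupport (φ k) ∧ tsupport (φ k) ⊆ Ω ∧
      ∀ x ∈ A, gradient (φ k) x = 0) ∧
      Tendsto (fun k => eLpNorm (z - φ k) s (volume.restrict Ω)) atTop (𝓝 0) ∧
      Tendsto (fun k => eLpNorm (g - gradient (φ k)) s (volume.restrict Ω)) atTop (𝓝 0) := by
  obtain ⟨M, hM, hex⟩ := exists_contDiff_approx_aux hΩ hΩb hΩL hA hAL hAΩ hs hs' h hz hg hz0 hgA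
  choose φ h1 h2 h3 h4 h5 h6 using fun k : ℕ => hex ((k : ℝ≥0∞) + 1)⁻¹ (by simp)
  have hlim : Tendsto (fun k : ℕ => M * ((k : ℝ≥0∞) + 1)⁻¹) atTop (𝓝 0) := by
    have h0 : Tendsto (fun k : ℕ => ((k : ℝ≥0∞) + 1)⁻¹) atTop (𝓝 0) := by
      have := (tendsto_add_atTop_iff_nat 1).2 ENNReal.tendsto_inv_nat_nhds_zero
      simpa using this
    simpa using ENNReal.Tendsto.const_mul h0 (Or.inr hM)
  exact ⟨φ, fun k => ⟨h1 k, h2 k, h3 k, h4 k⟩,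
    tendsto_of_tendsto_of_tendsto_of_le_of_le tendsto_const_nhds hlim (fun _ => zero_le) h5,
    tendsto_of_tendsto_of_tendsto_of_le_of_le tendsto_const_nhds hlim (fun _ => zero_le) h6⟩

end Density

/-! ### Zero boundary values as extension by zero, and Poincaré's inequality. -/

section Sobolev

variable {n : ℕ}

local notation "𝔼" => EuclideanSpace ℝ (Fin n)

theorem MemSobolev.hasWeakGradient {s : ℝ} {U : Set 𝔼} {u : 𝔼 → ℝ} (h : MemSobolev s U u) :
    HasWeakGradient U u (weakGrad U u) :=
  let ⟨_, hg, _⟩ := h.2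
  hasWeakGradient_weakGrad hg

theorem MemSobolev.memLp_weakGrad {s : ℝ} {U : Set 𝔼} (hU : IsOpen U) {u : 𝔼 → ℝ}
    (h : MemSobolev s U u) : MemLp (weakGrad U u) (ENNReal.ofReal s) (volume.restrict U) :=
  let ⟨_, hg, hgs⟩ := h.2
  hgs.ae_eq (hg.weakGrad_ae_eq hU).symm

theorem MemSobolev.mono_exponent {s s' : ℝ} {U : Set 𝔼} (hUb : Bornology.IsBounded U)
    {u : 𝔼 → ℝ} (h : MemSobolev s U u) (hs : s' ≤ s) : MemSobolev s' U u := by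
  have : IsFiniteMeasure (volume.restrict U) := ⟨by simpa using hUb.measure_lt_top⟩
  obtain ⟨g, hg, hgs⟩ := h.2
  exact ⟨h.1.mono_exponent (ENNReal.ofReal_le_ofReal hs), g, hg,
    hgs.mono_exponent (ENNReal.ofReal_le_ofReal hs)⟩

theorem MemSobolev.const_smul {s : ℝ} {U : Set 𝔼} {u : 𝔼 → ℝ} (hu : MemSobolev s U u) (c : ℝ) :
    MemSobolev s U (c • u) :=
  let ⟨_, hg, hgs⟩ := hu.2
  ⟨hu.1.const_smul c, _, hg.const_smul c, hgs.const_smul c⟩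

theorem MemSobolev.mono_set {s : ℝ} {U V : Set 𝔼} {u : 𝔼 → ℝ} (hu : MemSobolev s U u)
    (hVU : V ⊆ U) : MemSobolev s V u :=
  let ⟨_, hg, hgs⟩ := hu.2
  ⟨hu.1.mono_measure (Measure.restrict_mono hVU le_rfl), _, hg.mono hVU,
    hgs.mono_measure (Measure.restrict_mono hVU le_rfl)⟩

/-- The extensions by zero of `z` and `g` outside `Ω` are a function on the whole space and its weak
gradient. -/
def HasZeroExt (Ω : Set (EuclideanSpace ℝ (Fin n))) (z : EuclideanSpace ℝ (Fin n) → ℝ)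
    (g : EuclideanSpace ℝ (Fin n) → EuclideanSpace ℝ (Fin n)) : Prop :=
  HasWeakGradient univ (Ω.indicator z) (Ω.indicator g)

theorem HasZeroExt.hasWeakGradient {Ω : Set 𝔼} (hΩ : IsOpen Ω) {z : 𝔼 → ℝ} {g : 𝔼 → 𝔼}
    (h : HasZeroExt Ω z g) : HasWeakGradient Ω z g :=
  (h.mono (subset_univ Ω)).congr hΩ (indicator_ae_eq_restrict hΩ.measurableSet)
    (indicator_ae_eq_restrict hΩ.measurableSet)

theorem HasZeroExt.congr {Ω : Set 𝔼} (hΩ : IsOpen Ω) {z z' : 𝔼 → ℝ} {g g' : 𝔼 → 𝔼}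
    (h : HasZeroExt Ω z g) (hz : z =ᵐ[volume.restrict Ω] z') (hg : g =ᵐ[volume.restrict Ω] g') :
    HasZeroExt Ω z' g' := by
  refine HasWeakGradient.congr isOpen_univ h ?_ ?_ <;> rw [Measure.restrict_univ]
  · filter_upwards [(ae_restrict_iff' hΩ.measurableSet).1 hz] with x hx
    by_cases hxΩ : x ∈ Ω <;> simp [hxΩ, hx]
  · filter_upwards [(ae_restrict_iff' hΩ.measurableSet).1 hg] with x hx
    by_cases hxΩ : x ∈ Ω <;> simp [hxΩ, hx]

theorem HasZeroExt.add {Ω : Set 𝔼} {z z' : 𝔼 → ℝ} {g g' : 𝔼 → 𝔼} (h : HasZeroExt Ω z g)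
    (h' : HasZeroExt Ω z' g') : HasZeroExt Ω (z + z') (g + g') := by
  have := HasWeakGradient.add h h'
  rwa [← indicator_add', ← indicator_add'] at this

theorem HasZeroExt.sub {Ω : Set 𝔼} {z z' : 𝔼 → ℝ} {g g' : 𝔼 → 𝔼} (h : HasZeroExt Ω z g)
    (h' : HasZeroExt Ω z' g') : HasZeroExt Ω (z - z') (g - g') := by
  have := HasWeakGradient.sub h h'
  rwa [← indicator_sub', ← indicator_sub'] at this

theorem HasZeroExt.const_smul {Ω : Set 𝔼} {z : 𝔼 → ℝ} {g : 𝔼 → 𝔼} (h : HasZeroExt Ω z g) (c : ℝ) :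
    HasZeroExt Ω (c • z) (c • g) := by
  have e1 : Ω.indicator (c • z) = c • Ω.indicator z := indicator_const_smul Ω c z
  have e2 : Ω.indicator (c • g) = c • Ω.indicator g := indicator_const_smul Ω c g
  rw [HasZeroExt, e1, e2]
  exact HasWeakGradient.const_smul h c

theorem HasZeroExt.of_contDiff {Ω : Set 𝔼} {φ : 𝔼 → ℝ} (hφ : ContDiff ℝ 1 φ)
    (hs : tsupport φ ⊆ Ω) : HasZeroExt Ω φ (gradient φ) := by
  rw [HasZeroExt, indicator_eq_self.2 ((subset_tsupport φ).trans hs),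
    indicator_eq_self.2 ((support_gradient_subset φ).trans hs)]
  exact hφ.hasWeakGradient univ

theorem HasZeroExt.of_tendsto {Ω : Set 𝔼} (hΩ : IsOpen Ω) {s : ℝ≥0∞} (hs : 1 ≤ s) {ι : Type*}
    {l : Filter ι} [l.NeBot] {u : ι → 𝔼 → ℝ} {g : ι → 𝔼 → 𝔼} {u₀ : 𝔼 → ℝ} {g₀ : 𝔼 → 𝔼}
    (h : ∀ i, HasZeroExt Ω (u i) (g i)) (hu : ∀ i, MemLp (u i) s (volume.restrict Ω))
    (hg : ∀ i, MemLp (g i) s (volume.restrict Ω)) (hu₀ : MemLp u₀ s (volume.restrict Ω))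
    (hg₀ : MemLp g₀ s (volume.restrict Ω))
    (hul : Tendsto (fun i => eLpNorm (u i - u₀) s (volume.restrict Ω)) l (𝓝 0))
    (hgl : Tendsto (fun i => eLpNorm (g i - g₀) s (volume.restrict Ω)) l (𝓝 0)) :
    HasZeroExt Ω u₀ g₀ := by
  have hm := hΩ.measurableSet
  refine HasWeakGradient.of_tendsto hs (l := l) h ?_ ?_ ?_ ?_ ?_ ?_ <;>
    simp only [Measure.restrict_univ, memLp_indicator_iff_restrict hm, ← indicator_sub',
      eLpNorm_indicator_eq_eLpNorm_restrict hm] <;> assumption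

/-- Compactly supported `C^1` functions extend by zero, and the extension property survives `L^s`
limits of functions and gradients. -/
theorem MemSobolevZero.hasZeroExt {s : ℝ} (hs : 1 ≤ s) {Ω : Set 𝔼} (hΩ : IsOpen Ω) {z : 𝔼 → ℝ}
    (h : MemSobolevZero s Ω z) : HasZeroExt Ω z (weakGrad Ω z) := by
  obtain ⟨hz, φ, hφ, hlim⟩ := h
  have hs' : 1 ≤ ENNReal.ofReal s := ENNReal.one_le_ofReal.2 hs
  have hgc : ∀ k, MemLp (gradient (φ k)) (ENNReal.ofReal s) volume := fun k =>
    (continuous_gradient (hφ k).1).memLp_of_hasCompactSupport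
      ((hφ k).2.1.of_isClosed_subset (isClosed_tsupport _) (tsupport_gradient_subset _))
  refine HasZeroExt.of_tendsto hΩ hs' (l := atTop) (u := φ) (g := fun k => gradient (φ k))
    (fun k => HasZeroExt.of_contDiff (hφ k).1 (hφ k).2.2)
    (fun k => ((hφ k).1.continuous.memLp_of_hasCompactSupport (hφ k).2.1).restrict Ω)
    (fun k => (hgc k).restrict Ω) hz.1 (hz.memLp_weakGrad hΩ) ?_ ?_
  · refine tendsto_of_tendsto_of_tendsto_of_le_of_le tendsto_const_nhds hlim (fun _ => zero_le)
      fun k => ?_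
    rw [eLpNorm_sub_comm]
    exact le_self_add
  · refine tendsto_of_tendsto_of_tendsto_of_le_of_le tendsto_const_nhds hlim (fun _ => zero_le)
      fun k => ?_
    rw [eLpNorm_sub_comm, ← eLpNorm_congr_ae
      ((hz.hasWeakGradient.sub ((hφ k).1.hasWeakGradient Ω)).weakGrad_ae_eq hΩ)]
    exact le_add_self

theorem memSobolev_of_hasZeroExt {s : ℝ} {Ω : Set 𝔼} (hΩ : IsOpen Ω) {z : 𝔼 → ℝ} {g : 𝔼 → 𝔼}
    (h : HasZeroExt Ω z g) (hz : MemLp z (ENNReal.ofReal s) (volume.restrict Ω))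
    (hg : MemLp g (ENNReal.ofReal s) (volume.restrict Ω)) : MemSobolev s Ω z :=
  ⟨hz, g, h.hasWeakGradient hΩ, hg⟩

theorem exists_contDiff_approx_of_hasZeroExt {Ω A : Set 𝔼} (hΩ : IsOpen Ω)
    (hΩb : Bornology.IsBounded Ω) (hΩL : HasLipschitzBoundary Ω) (hA : IsOpen A)
    (hAL : HasLipschitzBoundary A) (hAΩ : closure A ⊆ Ω) {s : ℝ} (hs : 1 ≤ s) {z : 𝔼 → ℝ}
    {g : 𝔼 → 𝔼} (h : HasZeroExt Ω z g) (hz : MemLp z (ENNReal.ofReal s) (volume.restrict Ω))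
    (hg : MemLp g (ENNReal.ofReal s) (volume.restrict Ω)) (hgA : g =ᵐ[volume.restrict A] 0) :
    ∃ φ : ℕ → 𝔼 → ℝ, (∀ k, ContDiff ℝ ∞ (φ k) ∧ HasCompactSupport (φ k) ∧ tsupport (φ k) ⊆ Ω ∧
      ∀ x ∈ A, gradient (φ k) x = 0) ∧
      Tendsto (fun k => eLpNorm (z - φ k) (ENNReal.ofReal s) (volume.restrict Ω)) atTop (𝓝 0) ∧
      Tendsto (fun k => eLpNorm (g - gradient (φ k)) (ENNReal.ofReal s) (volume.restrict Ω))
        atTop (𝓝 0) := by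
  have hm := hΩ.measurableSet
  obtain ⟨φ, h1, h2, h3⟩ := exists_contDiff_approx hΩ hΩb hΩL hA hAL hAΩ
    (ENNReal.one_le_ofReal.2 hs) ENNReal.ofReal_ne_top h ((memLp_indicator_iff_restrict hm).2 hz)
    ((memLp_indicator_iff_restrict hm).2 hg)
    (Eventually.of_forall fun x hx => indicator_of_notMem hx z) (by
      have hsub : A ⊆ Ω := subset_closure.trans hAΩ
      filter_upwards [hgA, ae_restrict_mem hA.measurableSet] with x hx hxA
      rw [indicator_of_mem (hsub hxA), hx])
  refine ⟨φ, h1, h2.congr fun k => eLpNorm_congr_ae ?_, h3.congr fun k => eLpNorm_congr_ae ?_⟩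
  · filter_upwards [indicator_ae_eq_restrict (f := z) hm] with x hx
    rw [Pi.sub_apply, hx, Pi.sub_apply]
  · filter_upwards [indicator_ae_eq_restrict (f := g) hm] with x hx
    rw [Pi.sub_apply, hx, Pi.sub_apply]

theorem hasLipschitzBoundary_empty : HasLipschitzBoundary (∅ : Set 𝔼) := by
  simp [HasLipschitzBoundary]

/-- The density result with empty `A`. Together with `MemSobolevZero.hasZeroExt`, it makes the
boundary condition independent of the exponent, up to integrability. -/
theorem HasZeroExt.memSobolevZero {Ω : Set 𝔼} (hΩ : IsOpen Ω) (hΩb : Bornology.IsBounded Ω)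
    (hΩL : HasLipschitzBoundary Ω) {s : ℝ} (hs : 1 ≤ s) {z : 𝔼 → ℝ} {g : 𝔼 → 𝔼}
    (h : HasZeroExt Ω z g) (hz : MemLp z (ENNReal.ofReal s) (volume.restrict Ω))
    (hg : MemLp g (ENNReal.ofReal s) (volume.restrict Ω)) : MemSobolevZero s Ω z := by
  obtain ⟨φ, h1, h2, h3⟩ := exists_contDiff_approx_of_hasZeroExt hΩ hΩb hΩL isOpen_empty
    hasLipschitzBoundary_empty (by simp) hs h hz hg (by simp [Filter.EventuallyEq])
  have hφ1 : ∀ k, ContDiff ℝ 1 (φ k) := fun k => (h1 k).1.of_le (by norm_cast)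
  refine ⟨memSobolev_of_hasZeroExt hΩ h hz hg, φ, fun k => ⟨hφ1 k, (h1 k).2.1, (h1 k).2.2.1⟩, ?_⟩
  have h4 := h2.add h3
  rw [add_zero] at h4
  refine h4.congr fun k => ?_
  rw [sobolevENorm, eLpNorm_congr_ae
    (((h.hasWeakGradient hΩ).sub ((hφ1 k).hasWeakGradient Ω)).weakGrad_ae_eq hΩ)]

/-- Poincaré's inequality for functions that vanish on the boundary. -/
theorem exists_poincare (hn : 1 ≤ n) {Ω : Set 𝔼} (hΩ : IsOpen Ω) (hΩb : Bornology.IsBounded Ω) :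
    ∃ C : ℝ≥0∞, C ≠ ⊤ ∧ ∀ s : ℝ≥0∞, 1 ≤ s → s ≠ ⊤ → ∀ (z : 𝔼 → ℝ) (g : 𝔼 → 𝔼), HasZeroExt Ω z g →
      eLpNorm z s (volume.restrict Ω) ≤ C * eLpNorm g s (volume.restrict Ω) := by
  obtain ⟨R, hR⟩ := hΩb.subset_ball (0 : 𝔼)
  -- The shift exceeds the diameter, so a point of `Ω` leaves `Ω` and the extended function vanishes
  -- there; the translation estimate is then the inequality, with the constant `‖a‖` for all
  -- exponents.
  set a : 𝔼 := (2 * |R|) • EuclideanSpace.single ⟨0, hn⟩ (1 : ℝ) with ha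
  have han : ‖a‖ = 2 * |R| := by
    rw [ha, norm_smul, PiLp.norm_single]
    simp
  refine ⟨‖a‖ₑ, enorm_ne_top, fun s hs hs' z g h => ?_⟩
  have hm := hΩ.measurableSet
  have h1 := HasWeakGradient.eLpNorm_translate_sub_le isOpen_univ h hs hs' (a := a) hΩ
    (fun _ _ _ _ => mem_univ _)
  rw [Measure.restrict_univ, eLpNorm_indicator_eq_eLpNorm_restrict hm] at h1
  refine le_trans (le_of_eq ?_) h1
  rw [← eLpNorm_neg]
  refine eLpNorm_congr_ae ?_
  filter_upwards [ae_restrict_mem hm] with y hy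
  have hya : y + a ∉ Ω := fun hya => by
    have h2 := mem_ball_zero_iff.1 (hR hy)
    have h3 := mem_ball_zero_iff.1 (hR hya)
    have h4 : ‖a‖ ≤ ‖y + a‖ + ‖y‖ := by
      simpa using norm_sub_le (y + a) y
    linarith [le_abs_self R]
  rw [indicator_of_notMem hya, indicator_of_mem hy, zero_sub, Pi.neg_apply]

end Sobolev

/-! ### Poincaré's inequality using the gradient outside `closure A` only. -/

section PoincareOutside

variable {n : ℕ}

local notation "𝔼" => EuclideanSpace ℝ (Fin n)

/-- Control of `z` is carried from one set to another along segments inside `U`, at the cost of the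
gradient. Iterating this along chains of balls avoids crossing `A`. -/
theorem HasWeakGradient.eLpNorm_le_translate {U : Set 𝔼} (hU : IsOpen U) {z : 𝔼 → ℝ} {g : 𝔼 → 𝔼}
    (h : HasWeakGradient U z g) {s : ℝ≥0∞} (hs : 1 ≤ s) (hs' : s ≠ ⊤) {a : 𝔼} {D E : Set 𝔼}
    (hD : IsOpen D) (hE : MeasurableSet E) (hEU : E ⊆ U)
    (hseg : ∀ y ∈ D, ∀ r ∈ Icc (0 : ℝ) 1, y + r • a ∈ U) (hDE : ∀ y ∈ D, y + a ∈ E) :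
    eLpNorm z s (volume.restrict D) ≤
      eLpNorm z s (volume.restrict E) + ‖a‖ₑ * eLpNorm g s (volume.restrict U) := by
  have hDU : D ⊆ U := fun y hy => by simpa using hseg y hy 0 (by simp)
  have hmp := (measurePreserving_add_right (volume : Measure 𝔼) a).restrict_preimage hE
  have hzE : AEStronglyMeasurable z (volume.restrict E) :=
    h.1.aestronglyMeasurable.mono_measure (Measure.restrict_mono hEU le_rfl)
  have hzD : AEStronglyMeasurable z (volume.restrict D) :=
    h.1.aestronglyMeasurable.mono_measure (Measure.restrict_mono hDU le_rfl)
  have hle : volume.restrict D ≤ volume.restrict ((fun x => x + a) ⁻¹' E) :=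
    Measure.restrict_mono hDE le_rfl
  have hza : AEStronglyMeasurable (fun y => z (y + a)) (volume.restrict D) :=
    (hzE.comp_measurePreserving hmp).mono_measure hle
  have h1 := h.eLpNorm_translate_sub_le hU hs hs' hD hseg
  have h2 : eLpNorm (fun y => z (y + a)) s (volume.restrict D) ≤ eLpNorm z s (volume.restrict E) :=
    (eLpNorm_mono_measure _ hle).trans (eLpNorm_comp_measurePreserving hzE hmp).le
  have h3 := eLpNorm_sub_le hza (hza.sub hzD) hs (p := s)
  refine le_trans (le_of_eq ?_) (h3.trans (add_le_add h2 h1))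
  congr 1
  ext y
  simp

theorem eLpNorm_restrict_union_le {α F : Type*} [MeasurableSpace α] [NormedAddCommGroup F]
    {μ : Measure α} {s : ℝ≥0∞} (hs : 1 ≤ s) {f : α → F} {S T : Set α} (hS : MeasurableSet S)
    (hT : MeasurableSet T) (hf : AEStronglyMeasurable f (μ.restrict (S ∪ T))) :
    eLpNorm f s (μ.restrict (S ∪ T)) ≤ eLpNorm f s (μ.restrict S) + eLpNorm f s (μ.restrict T) := by
  set ν := μ.restrict (S ∪ T) with hν
  have h1 : f =ᵐ[ν] S.indicator f + (T \ S).indicator f := by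
    filter_upwards [ae_restrict_mem (hS.union hT)] with x hx
    by_cases hxS : x ∈ S
    · simp [hxS]
    · simp [hxS, hx.resolve_left hxS]
  rw [eLpNorm_congr_ae h1]
  refine (eLpNorm_add_le (hf.indicator hS) (hf.indicator (hT.diff hS)) hs).trans ?_
  rw [eLpNorm_indicator_eq_eLpNorm_restrict hS,
    eLpNorm_indicator_eq_eLpNorm_restrict (hT.diff hS), hν, Measure.restrict_restrict hS,
    Measure.restrict_restrict (hT.diff hS)]
  exact add_le_add (eLpNorm_mono_measure _ (Measure.restrict_mono inter_subset_left le_rfl))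
    (eLpNorm_mono_measure _ (Measure.restrict_mono
      (inter_subset_left.trans sdiff_subset) le_rfl))

/-- A limit point of `T` stays outside `Ω`, hence outside `closure A`, and cannot lie in the open
set `S`. So `T` is also closed, and the whole space is connected. -/
theorem eq_empty_or_univ_of_local {Ω A S T : Set 𝔼} (hΩ : IsOpen Ω) (hAΩ : closure A ⊆ Ω)
    (hS : IsOpen S) (hT : IsOpen T) (hST : Disjoint S T) (hun : S ∪ T = (closure A)ᶜ)
    (hTΩ : Disjoint T Ω) : T = ∅ ∨ T = univ := by
  refine isClopen_iff.1 ⟨isClosed_of_closure_subset fun x hx => ?_, hT⟩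
  have hTc : T ⊆ Ωᶜ := fun y hy hyΩ => Set.disjoint_left.1 hTΩ hy hyΩ
  have hxΩ : x ∈ Ωᶜ := closure_minimal hTc hΩ.isClosed_compl hx
  have hxU : x ∈ S ∪ T := by
    rw [hun]
    exact fun hxA => hxΩ (hAΩ hxA)
  refine hxU.resolve_left fun hxS => ?_
  obtain ⟨y, hyS, hyT⟩ := mem_closure_iff.1 hx S hS hxS
  exact Set.disjoint_left.1 hST hyS hyT

/-- Poincaré's inequality outside `closure A` for functions that vanish outside `Ω`. -/
theorem exists_poincare_compl (hn : 1 ≤ n) {Ω A : Set 𝔼} (hΩA : IsTwoPhaseDomain Ω A) {s : ℝ≥0∞}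
    (hs : 1 ≤ s) (hs' : s ≠ ⊤) :
    ∃ C : ℝ≥0∞, C ≠ ⊤ ∧ ∀ (z : 𝔼 → ℝ) (g : 𝔼 → 𝔼), HasWeakGradient (closure A)ᶜ z g →
      (∀ x ∉ Ω, z x = 0) →
      eLpNorm z s (volume.restrict (closure A)ᶜ) ≤
        C * eLpNorm g s (volume.restrict (closure A)ᶜ) := by
  set U : Set 𝔼 := (closure A)ᶜ with hUdef
  have hU : IsOpen U := isClosed_closure.isOpen_compl
  set P : (𝔼 → ℝ) → (𝔼 → 𝔼) → Prop := fun z g => HasWeakGradient U z g ∧ ∀ x ∉ Ω, z x = 0 with hP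
  -- Local validity of the inequality. It holds far away, where `z = 0`, and propagates along balls
  -- in `U`; so the good points of `U` are open and relatively closed.
  set Good : 𝔼 → Prop := fun x => ∃ r > 0, ∃ C : ℝ≥0∞, C ≠ ⊤ ∧ ∀ z g, P z g →
    eLpNorm z s (volume.restrict (Metric.ball x r ∩ U)) ≤ C * eLpNorm g s (volume.restrict U)
    with hGood
  have hUm := hU.measurableSet
  have hbU : ∀ x r, IsOpen (Metric.ball x r ∩ U) := fun x r => Metric.isOpen_ball.inter hU
  have htrans : ∀ (D : Set 𝔼) (x' : 𝔼) (r' : ℝ) (a : 𝔼) (C : ℝ≥0∞), C ≠ ⊤ → IsOpen D →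
      (∀ z g, P z g → eLpNorm z s (volume.restrict (Metric.ball x' r' ∩ U)) ≤
        C * eLpNorm g s (volume.restrict U)) →
      (∀ y ∈ D, ∀ r ∈ Icc (0 : ℝ) 1, y + r • a ∈ U) → (∀ y ∈ D, y + a ∈ Metric.ball x' r') →
      ∃ C' : ℝ≥0∞, C' ≠ ⊤ ∧ ∀ z g, P z g →
        eLpNorm z s (volume.restrict D) ≤ C' * eLpNorm g s (volume.restrict U) := by
    intro D x' r' a C hC hD hz hseg hDE
    refine ⟨C + ‖a‖ₑ, ENNReal.add_ne_top.2 ⟨hC, enorm_ne_top⟩, fun z g hzg => ?_⟩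
    rw [add_mul]
    refine (hzg.1.eLpNorm_le_translate hU hs hs' hD (hbU x' r').measurableSet inter_subset_right
      hseg fun y hy => ⟨hDE y hy, by simpa using hseg y hy 1 (by simp)⟩).trans ?_
    gcongr
    exact hz z g hzg
  have hopen : IsOpen {x | Good x} := by
    refine Metric.isOpen_iff.2 fun x hx => ?_
    obtain ⟨r, hr, C, hC, hCz⟩ := hx
    refine ⟨r / 2, half_pos hr, fun y hy => ⟨r / 2, half_pos hr, C, hC, fun z g hzg => ?_⟩⟩
    refine le_trans (eLpNorm_mono_measure _ (Measure.restrict_mono ?_ le_rfl)) (hCz z g hzg)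
    refine inter_subset_inter_left _ fun w hw => ?_
    rw [Metric.mem_ball] at hw hy ⊢
    linarith [dist_triangle w y x]
  have hclosed : ∀ x ∈ U, x ∈ closure {x | Good x} → Good x := by
    intro x hxU hx
    obtain ⟨R, hR, hRU⟩ := Metric.isOpen_iff.1 hU x hxU
    obtain ⟨x', ⟨r', hr', C, hC, hCz⟩, hxx'⟩ := Metric.mem_closure_iff.1 hx (R / 2) (half_pos hR)
    refine ⟨min r' (R / 2), lt_min hr' (half_pos hR), ?_⟩
    refine htrans (Metric.ball x (min r' (R / 2)) ∩ U) x' r' (x' - x) C hC (hbU _ _) hCz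
      (fun y hy θ hθ => hRU ?_) fun y hy => ?_
    · have h1 := (Metric.mem_ball.1 hy.1).trans_le (min_le_right _ _)
      have h2 : ‖θ • (x' - x)‖ ≤ ‖x' - x‖ := by
        rw [norm_smul, Real.norm_of_nonneg hθ.1]
        exact mul_le_of_le_one_left (norm_nonneg _) hθ.2
      rw [dist_comm, dist_eq_norm] at hxx'
      rw [Metric.mem_ball, dist_eq_norm]
      rw [dist_eq_norm] at h1
      calc ‖y + θ • (x' - x) - x‖ = ‖(y - x) + θ • (x' - x)‖ := by congr 1; abel
        _ ≤ ‖y - x‖ + ‖θ • (x' - x)‖ := norm_add_le _ _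
        _ < R := by linarith
    · have h1 := (Metric.mem_ball.1 hy.1).trans_le (min_le_left _ _)
      rw [Metric.mem_ball, dist_eq_norm]
      rw [dist_eq_norm] at h1
      have h2 : y + (x' - x) - x' = y - x := by abel
      rwa [h2]
  obtain ⟨R, hR⟩ := hΩA.isBounded_Ω.subset_ball (0 : 𝔼)
  -- The unit ball about this point misses `Ω`.
  set x₀ : 𝔼 := (|R| + 1) • EuclideanSpace.single ⟨0, hn⟩ (1 : ℝ) with hx₀
  have hx₀n : ‖x₀‖ = |R| + 1 := by
    rw [hx₀, norm_smul, PiLp.norm_single, norm_one, mul_one, Real.norm_of_nonneg (by positivity)]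
  have hfar : Metric.ball x₀ 1 ⊆ Ωᶜ := fun y hy hyΩ => by
    have h1 := mem_ball_zero_iff.1 (hR hyΩ)
    rw [Metric.mem_ball, dist_comm, dist_eq_norm] at hy
    have h2 : ‖x₀‖ ≤ ‖x₀ - y‖ + ‖y‖ := by simpa using norm_add_le (x₀ - y) y
    linarith [le_abs_self R]
  have hx₀Ω : x₀ ∉ Ω := hfar (Metric.mem_ball_self one_pos)
  have hgood₀ : Good x₀ := by
    refine ⟨1, one_pos, 0, ENNReal.zero_ne_top, fun z g hzg => ?_⟩
    rw [zero_mul, nonpos_iff_eq_zero]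
    refine (eLpNorm_congr_ae (g := 0) ?_).trans eLpNorm_zero
    filter_upwards [ae_restrict_mem (hbU x₀ 1).measurableSet] with x hx using hzg.2 x (hfar hx.1)
  have hUgood : ∀ x ∈ U, Good x := by
    set S := U ∩ {x | Good x} with hS
    set T := U ∩ (closure {x | Good x})ᶜ with hT
    have hSo : IsOpen S := hU.inter hopen
    have hTo : IsOpen T := hU.inter isClosed_closure.isOpen_compl
    have hST : Disjoint S T := Set.disjoint_left.2 fun x hx hx' => hx'.2 (subset_closure hx.2)
    have hun : S ∪ T = U := by
      refine Subset.antisymm (union_subset inter_subset_left inter_subset_left) fun x hx => ?_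
      by_cases hc : x ∈ closure {x | Good x}
      · exact Or.inl ⟨hx, hclosed x hx hc⟩
      · exact Or.inr ⟨hx, hc⟩
    have hx₀U : x₀ ∈ U := fun h => hx₀Ω (hΩA.closure_A_subset h)
    have hx₀S : x₀ ∈ S := ⟨hx₀U, hgood₀⟩
    have hB := hΩA.isConnected_B
    have hBU : Ω \ closure A ⊆ U := fun x hx => hx.2
    have hdis : ∀ V ⊆ U, ∀ W : Set 𝔼, Disjoint W V → Ω \ closure A ⊆ W → Disjoint V Ω :=
      fun V hV W hWV hBW => Set.disjoint_left.2 fun x hxV hxΩ =>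
        Set.disjoint_left.1 hWV (hBW ⟨hxΩ, hV hxV⟩) hxV
    -- The connected set `Ω \ closure A` lies in one of `S` and `T`. The other one misses `Ω`, so it
    -- is empty or everything, and `x₀ ∈ S` decides which.
    have hTe : T = ∅ := by
      rcases hB.isPreconnected.subset_or_subset hSo hTo hST (hun ▸ hBU) with hBS | hBT
      · rcases eq_empty_or_univ_of_local hΩA.isOpen_Ω hΩA.closure_A_subset hSo hTo hST hun
          (hdis T inter_subset_left S hST hBS) with h | h
        · exact h
        · exact absurd (h ▸ mem_univ x₀ : x₀ ∈ T) (Set.disjoint_left.1 hST hx₀S)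
      · rcases eq_empty_or_univ_of_local hΩA.isOpen_Ω hΩA.closure_A_subset hTo hSo hST.symm
          (by rw [union_comm, hun]) (hdis S inter_subset_left T hST.symm hBT) with h | h
        · exact absurd hx₀S (h ▸ notMem_empty x₀)
        · exact eq_empty_of_forall_notMem fun y hy =>
            Set.disjoint_left.1 hST (h ▸ mem_univ y) hy
    intro x hx
    rw [← hun, hTe, union_empty] at hx
    exact hx.2
  have hgood : ∀ x, Good x := by
    intro x
    by_cases hxU : x ∈ U
    · exact hUgood x hxU
    have hxcl : x ∈ closure A := not_not.1 hxU
    by_cases hxA : x ∈ A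
    · obtain ⟨r, hr, hball⟩ := Metric.isOpen_iff.1 hΩA.isOpen_A x hxA
      refine ⟨r, hr, 0, ENNReal.zero_ne_top, fun z g _ => ?_⟩
      have : Metric.ball x r ∩ U = ∅ :=
        eq_empty_of_forall_notMem fun y hy => hy.2 (subset_closure (hball hy.1))
      simp [this]
    · have hfr : x ∈ frontier A := ⟨hxcl, by rwa [hΩA.isOpen_A.interior_eq]⟩
      obtain ⟨e, he, r, hr, κ, hκ, -, hcone⟩ := hΩA.lipschitz_A.exists_cone hfr
      have hmove : ∀ y ∈ Metric.ball x r, y ∉ A → ∀ h ∈ Ioo (0 : ℝ) r, y - h • e ∈ U := by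
        intro y hy hyA h hh hcl
        have hsub := (hcone y hy h hh).2 hyA
        obtain ⟨w, hwA, hw⟩ := Metric.mem_closure_iff.1 hcl (κ * h) (mul_pos hκ hh.1)
        exact hsub (by rw [Metric.mem_closedBall, dist_comm]; exact hw.le) hwA
      have hr2 : r / 2 ∈ Ioo (0 : ℝ) r := ⟨half_pos hr, half_lt_self hr⟩
      obtain ⟨r', hr', C, hC, hCz⟩ := hUgood _ (hmove x (Metric.mem_ball_self hr) hxA _ hr2)
      -- At a boundary point of `A`, nearby points of `U` are moved along `-e` to a ball around a
      -- good interior point of `U`, and by the Lipschitz geometry the path remains outside `closure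
      -- A`.
      refine ⟨min r r', lt_min hr hr', ?_⟩
      refine htrans _ (x - (r / 2) • e) r' (-((r / 2) • e)) C hC (hbU _ _) hCz
        (fun y hy θ hθ => ?_) fun y hy => ?_
      · rcases hθ.1.eq_or_lt with h0 | h0
        · rw [← h0, zero_smul, add_zero]
          exact hy.2
        · rw [smul_neg, smul_smul, ← sub_eq_add_neg]
          refine hmove y (Metric.ball_subset_ball (min_le_left _ _) hy.1)
            (fun hyA => hy.2 (subset_closure hyA)) _ ⟨mul_pos h0 hr2.1, ?_⟩
          exact (mul_le_of_le_one_left hr2.1.le hθ.2).trans_lt hr2.2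
      · rw [← sub_eq_add_neg, Metric.mem_ball, dist_sub_right]
        exact (Metric.mem_ball.1 hy.1).trans_le (min_le_right _ _)
  obtain ⟨C, hC, V, hV, hΩV, hCz⟩ : ∃ C : ℝ≥0∞, C ≠ ⊤ ∧ ∃ V, IsOpen V ∧ closure Ω ⊆ V ∧ ∀ z g, P z g →
      eLpNorm z s (volume.restrict (V ∩ U)) ≤ C * eLpNorm g s (volume.restrict U) := by
    -- Finitely many local inequalities cover `closure Ω`; outside of it `z` vanishes.
    refine IsCompact.induction_on (s := closure Ω) hΩA.isBounded_Ω.isCompact_closure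
      (p := fun K => ∃ C : ℝ≥0∞, C ≠ ⊤ ∧ ∃ V, IsOpen V ∧ K ⊆ V ∧ ∀ z g, P z g →
      eLpNorm z s (volume.restrict (V ∩ U)) ≤ C * eLpNorm g s (volume.restrict U)) ?_ ?_ ?_ ?_
    · exact ⟨0, ENNReal.zero_ne_top, ∅, isOpen_empty, Subset.rfl, fun z g _ => by simp⟩
    · rintro K L hKL ⟨C, hC, V, hV, hLV, h⟩
      exact ⟨C, hC, V, hV, hKL.trans hLV, h⟩
    · rintro K L ⟨C, hC, V, hV, hKV, h⟩ ⟨C', hC', V', hV', hLV', h'⟩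
      refine ⟨C + C', ENNReal.add_ne_top.2 ⟨hC, hC'⟩, V ∪ V', hV.union hV',
        union_subset_union hKV hLV', fun z g hzg => ?_⟩
      rw [union_inter_distrib_right, add_mul]
      refine (eLpNorm_restrict_union_le hs (hV.inter hU).measurableSet
        (hV'.inter hU).measurableSet ?_).trans (add_le_add (h z g hzg) (h' z g hzg))
      exact hzg.1.1.aestronglyMeasurable.mono_measure
        (Measure.restrict_mono (union_subset inter_subset_right inter_subset_right) le_rfl)
    · intro x _
      obtain ⟨r, hr, C, hC, h⟩ := hgood x
      exact ⟨Metric.ball x r, mem_nhdsWithin_of_mem_nhds (Metric.ball_mem_nhds x hr), C, hC,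
        Metric.ball x r, Metric.isOpen_ball, Subset.rfl, h⟩
  refine ⟨C, hC, fun z g h1 h2 => le_trans ?_ (hCz z g ⟨h1, h2⟩)⟩
  have h3 : z =ᵐ[volume.restrict U] (V ∩ U).indicator z := by
    filter_upwards [ae_restrict_mem hUm] with x hx
    by_cases hxV : x ∈ V
    · rw [indicator_of_mem (show x ∈ V ∩ U from ⟨hxV, hx⟩)]
    · rw [indicator_of_notMem fun h => hxV h.1, h2 x fun h => hxV (hΩV (subset_closure h))]
  rw [eLpNorm_congr_ae h3, eLpNorm_indicator_eq_eLpNorm_restrict (hV.inter hU).measurableSet,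
    Measure.restrict_restrict (hV.inter hU).measurableSet, inter_eq_self_of_subset_left
    inter_subset_right]

end PoincareOutside

/-! ### Measurability, growth and small-field limit of the energy. -/

section Energy

variable {n : ℕ}

local notation "𝔼" => EuclideanSpace ℝ (Fin n)

theorem AEMeasurable.apply_nat {α β : Type*} [MeasurableSpace α] [MeasurableSpace β]
    {μ : Measure α} {F : ℕ → α → β} (hF : ∀ j, AEMeasurable (F j) μ) {N : α → ℕ}
    (hN : AEMeasurable N μ) : AEMeasurable (fun x => F (N x) x) μ := by
  have hG : Measurable fun z : ℕ × α => (hF z.1).mk (F z.1) z.2 :=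
    measurable_from_prod_countable_right fun j => (hF j).measurable_mk
  refine ⟨fun x => (hF (hN.mk N x)).mk (F (hN.mk N x)) x,
    hG.comp (hN.measurable_mk.prodMk measurable_id), ?_⟩
  filter_upwards [hN.ae_eq_mk, ae_all_iff.2 fun j => (hF j).ae_eq_mk] with x hx hx'
  rw [← hx]
  exact hx' _

/-- A Carathéodory function can be composed with a nonnegative measurable function. -/
theorem IsEnergyDensity.aemeasurable_comp {D : Set 𝔼} {Q : 𝔼 → ℝ → ℝ} (hQ : IsEnergyDensity D Q)
    {h : 𝔼 → ℝ} (hm : AEMeasurable h (volume.restrict D)) (h0 : ∀ x, 0 ≤ h x) :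
    AEMeasurable (fun x => Q x (h x)) (volume.restrict D) := by
  -- Rounding `h` down to multiples of `1/(k+1)` leaves countably many field values, for which
  -- measurability in `x` suffices; continuity in the field gives the limit.
  have hstep : ∀ k : ℕ, AEMeasurable
      (fun x => Q x ((⌊h x * ((k + 1 : ℕ) : ℝ)⌋₊ : ℝ) / ((k + 1 : ℕ) : ℝ))) (volume.restrict D) := fun k =>
    AEMeasurable.apply_nat (F := fun j x => Q x ((j : ℝ) / ((k + 1 : ℕ) : ℝ)))
      (fun j => hQ.measurable _ (by positivity)) (Nat.measurable_floor.comp_aemeasurable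
        (hm.mul_const _))
  refine aemeasurable_of_tendsto_metrizable_ae' hstep ?_
  filter_upwards [hQ.continuous] with x hx
  have h1 : Tendsto (fun k : ℕ => (⌊h x * ((k + 1 : ℕ) : ℝ)⌋₊ : ℝ) / ((k + 1 : ℕ) : ℝ)) atTop
      (𝓝 (h x)) := ((tendsto_nat_floor_mul_div_atTop (h0 x)).comp tendsto_natCast_atTop_atTop).comp
    (tendsto_add_atTop_nat 1)
  have h2 := hx (h x) (h0 x)
  exact h2.tendsto.comp (tendsto_nhdsWithin_iff.2 ⟨h1, Eventually.of_forall fun k =>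
    mem_Ici.2 (by positivity)⟩)

theorem HasTwoPowerGrowth.le_add {D : Set 𝔼} {Q : 𝔼 → ℝ → ℝ} {s₀ s Qlow Qup E₀ : ℝ}
    (hQup : 0 ≤ Qup) (hE₀ : 0 < E₀) (hg : HasTwoPowerGrowth D Q s₀ s Qlow Qup E₀) :
    ∀ᵐ x ∂(volume.restrict D), ∀ E : ℝ, 0 ≤ E →
      Q x E ≤ Qup * ((E / E₀) ^ s₀ + (E / E₀) ^ s) := by
  filter_upwards [hg] with x hx E hE
  refine (hx E hE).2.trans (mul_le_mul_of_nonneg_left ?_ hQup)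
  have h1 : 0 ≤ (E / E₀) ^ s₀ := by positivity
  have h2 : 0 ≤ (E / E₀) ^ s := by positivity
  exact max_le (by linarith) (by linarith)

theorem HasTwoPowerGrowth.mul_rpow_le {D : Set 𝔼} {Q : 𝔼 → ℝ → ℝ} {s₀ s Qlow Qup E₀ : ℝ}
    (hQlow : 0 < Qlow) (hE₀ : 0 < E₀) (hg : HasTwoPowerGrowth D Q s₀ s Qlow Qup E₀) :
    ∀ᵐ x ∂(volume.restrict D), ∀ E : ℝ, 0 ≤ E → Qlow / E₀ ^ s₀ * E ^ s₀ ≤ Q x E := by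
  filter_upwards [hg] with x hx E hE
  refine le_trans (le_of_eq ?_) ((mul_le_mul_of_nonneg_left (le_max_left _ _) hQlow.le).trans
    (hx E hE).1)
  rw [Real.div_rpow hE hE₀.le]
  ring

theorem lintegral_ofReal_rpow_lt_top {α F : Type*} [MeasurableSpace α] [NormedAddCommGroup F]
    {μ : Measure α} {s : ℝ} (hs : 0 < s) {g : α → F} (hg : MemLp g (ENNReal.ofReal s) μ) :
    ∫⁻ x, ENNReal.ofReal (‖g x‖ ^ s) ∂μ < ⊤ := by
  have h := hg.2
  rw [eLpNorm_lt_top_iff_lintegral_rpow_enorm_lt_top (by simpa using hs) ENNReal.ofReal_ne_top,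
    ENNReal.toReal_ofReal hs.le] at h
  refine lt_of_eq_of_lt (lintegral_congr fun x => ?_) h
  rw [← ENNReal.ofReal_rpow_of_nonneg (norm_nonneg _) hs.le, ofReal_norm]

theorem eLpNorm_rpow_eq_lintegral {α F : Type*} [MeasurableSpace α] [NormedAddCommGroup F]
    {μ : Measure α} {s : ℝ} (hs : 0 < s) (g : α → F) :
    eLpNorm g (ENNReal.ofReal s) μ ^ s = ∫⁻ x, ENNReal.ofReal (‖g x‖ ^ s) ∂μ := by
  rw [eLpNorm_eq_lintegral_rpow_enorm_toReal (by simpa using hs) ENNReal.ofReal_ne_top,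
    ENNReal.toReal_ofReal hs.le, ← ENNReal.rpow_mul, one_div, inv_mul_cancel₀ hs.ne',
    ENNReal.rpow_one]
  refine lintegral_congr fun x => ?_
  rw [← ENNReal.ofReal_rpow_of_nonneg (norm_nonneg _) hs.le, ofReal_norm]

theorem div_rpow_mul_rpow {t e E₀ s s₀ : ℝ} (ht : 0 < t) (he : 0 ≤ e) (hE₀ : 0 < E₀) :
    1 / t ^ s₀ * (t * e / E₀) ^ s = t ^ (s - s₀) * ((1 / E₀ ^ s) * e ^ s) := by
  rw [Real.div_rpow (by positivity) hE₀.le, Real.mul_rpow ht.le he, Real.rpow_sub ht]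
  field_simp

/-- Finiteness and small-field limit of the scaled energy in a region. -/
theorem HasTwoPowerGrowth.lintegral_lt_top {D : Set 𝔼} {Q : 𝔼 → ℝ → ℝ} {s₀ s Qlow Qup E₀ : ℝ}
    (hs₀ : 0 < s₀) (hs : s₀ ≤ s) (hQup : 0 ≤ Qup) (hE₀ : 0 < E₀)
    (hg : HasTwoPowerGrowth D Q s₀ s Qlow Qup E₀) {g : 𝔼 → 𝔼}
    (hg0 : MemLp g (ENNReal.ofReal s₀) (volume.restrict D))
    (hg1 : MemLp g (ENNReal.ofReal s) (volume.restrict D)) {t : ℝ} (ht : 0 < t) :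
    ∫⁻ x in D, ENNReal.ofReal (Q x (t * ‖g x‖)) < ⊤ := by
  have hs' : 0 < s := hs₀.trans_le hs
  have hb : ∀ᵐ x ∂(volume.restrict D), ENNReal.ofReal (Q x (t * ‖g x‖)) ≤
      ENNReal.ofReal (Qup * (t / E₀) ^ s₀) * ENNReal.ofReal (‖g x‖ ^ s₀) +
        ENNReal.ofReal (Qup * (t / E₀) ^ s) * ENNReal.ofReal (‖g x‖ ^ s) := by
    filter_upwards [hg.le_add hQup hE₀] with x hx
    rw [← ENNReal.ofReal_mul (by positivity), ← ENNReal.ofReal_mul (by positivity),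
      ← ENNReal.ofReal_add (by positivity) (by positivity)]
    refine ENNReal.ofReal_le_ofReal ((hx _ (by positivity)).trans (le_of_eq ?_))
    rw [mul_div_right_comm, Real.mul_rpow (by positivity) (norm_nonneg _),
      Real.mul_rpow (by positivity) (norm_nonneg _)]
    ring
  refine (lintegral_mono_ae hb).trans_lt ?_
  have hm0 : AEMeasurable (fun x => ENNReal.ofReal (‖g x‖ ^ s₀)) (volume.restrict D) :=
    (hg0.1.norm.aemeasurable.pow_const s₀).ennreal_ofReal
  rw [lintegral_add_left' (hm0.const_mul _), lintegral_const_mul' _ _ ENNReal.ofReal_ne_top,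
    lintegral_const_mul' _ _ ENNReal.ofReal_ne_top]
  exact ENNReal.add_lt_top.2 ⟨ENNReal.mul_lt_top ENNReal.ofReal_lt_top
    (lintegral_ofReal_rpow_lt_top hs₀ hg0), ENNReal.mul_lt_top ENNReal.ofReal_lt_top
    (lintegral_ofReal_rpow_lt_top hs' hg1)⟩

/-- Dominated convergence. For `t < 1` and `s ≥ s₀` the factor `t^{s-s₀}` is at most one, so the
upper growth bound gives a dominating function; its integrability is the reason why competitors are
taken with gradient in `L^s`. -/
theorem tendsto_scaled_energy {D : Set 𝔼} {Q : 𝔼 → ℝ → ℝ} {s₀ s Qlow Qup E₀ : ℝ}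
    (hs₀ : 0 < s₀) (hs : s₀ ≤ s) (hQup : 0 ≤ Qup) (hE₀ : 0 < E₀) (hQ : IsEnergyDensity D Q)
    (hg : HasTwoPowerGrowth D Q s₀ s Qlow Qup E₀) {β : 𝔼 → ℝ} (hβ : HasSmallFieldLimit D Q s₀ β)
    {g : 𝔼 → 𝔼} (hg0 : MemLp g (ENNReal.ofReal s₀) (volume.restrict D))
    (hg1 : MemLp g (ENNReal.ofReal s) (volume.restrict D)) :
    Tendsto (fun t : ℝ => ENNReal.ofReal (1 / t ^ s₀) *
      ∫⁻ x in D, ENNReal.ofReal (Q x (t * ‖g x‖))) (𝓝[>] 0)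
      (𝓝 (∫⁻ x in D, ENNReal.ofReal (β x * ‖g x‖ ^ s₀))) := by
  have hs' : 0 < s := hs₀.trans_le hs
  have heq : ∀ t : ℝ, ENNReal.ofReal (1 / t ^ s₀) *
      ∫⁻ x in D, ENNReal.ofReal (Q x (t * ‖g x‖)) =
      ∫⁻ x in D, ENNReal.ofReal (1 / t ^ s₀) * ENNReal.ofReal (Q x (t * ‖g x‖)) := fun t =>
    (lintegral_const_mul' _ _ ENNReal.ofReal_ne_top).symm
  simp_rw [heq]
  have hpos : ∀ᶠ t : ℝ in 𝓝[>] 0, 0 < t ∧ t < 1 := Ioo_mem_nhdsGT one_pos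
  have hm0 : AEMeasurable (fun x => ENNReal.ofReal (‖g x‖ ^ s₀)) (volume.restrict D) :=
    (hg0.1.norm.aemeasurable.pow_const s₀).ennreal_ofReal
  refine tendsto_lintegral_filter_of_dominated_convergence'
    (fun x => ENNReal.ofReal (Qup * (1 / E₀ ^ s₀)) * ENNReal.ofReal (‖g x‖ ^ s₀) +
      ENNReal.ofReal (Qup * (1 / E₀ ^ s)) * ENNReal.ofReal (‖g x‖ ^ s)) ?_ ?_ ?_ ?_
  · filter_upwards [hpos] with t ht
    exact ((hQ.aemeasurable_comp (hg0.1.norm.aemeasurable.const_mul t) fun x =>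
      mul_nonneg ht.1.le (norm_nonneg _)).ennreal_ofReal).const_mul _
  · filter_upwards [hpos] with t ht
    filter_upwards [hg.le_add hQup hE₀] with x hx
    have ht0 := ht.1
    rw [← ENNReal.ofReal_mul (by positivity), ← ENNReal.ofReal_mul (by positivity),
      ← ENNReal.ofReal_mul (by positivity), ← ENNReal.ofReal_add (by positivity) (by positivity)]
    refine ENNReal.ofReal_le_ofReal ((mul_le_mul_of_nonneg_left (hx _ (by positivity))
      (by positivity)).trans ?_)
    rw [mul_left_comm, mul_add, div_rpow_mul_rpow ht0 (norm_nonneg _) hE₀,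
      div_rpow_mul_rpow ht0 (norm_nonneg _) hE₀, sub_self, Real.rpow_zero, one_mul, mul_add,
      mul_assoc, mul_assoc]
    refine add_le_add le_rfl (mul_le_mul_of_nonneg_left ?_ hQup)
    exact mul_le_of_le_one_left (by positivity) (Real.rpow_le_one ht0.le ht.2.le (by linarith))
  · rw [lintegral_add_left' (hm0.const_mul _), lintegral_const_mul' _ _ ENNReal.ofReal_ne_top,
      lintegral_const_mul' _ _ ENNReal.ofReal_ne_top]
    exact (ENNReal.add_lt_top.2 ⟨ENNReal.mul_lt_top ENNReal.ofReal_lt_top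
      (lintegral_ofReal_rpow_lt_top hs₀ hg0), ENNReal.mul_lt_top ENNReal.ofReal_lt_top
      (lintegral_ofReal_rpow_lt_top hs' hg1)⟩).ne
  · filter_upwards [hβ.2, hQ.map_zero] with x hx hx0
    have h1 : Tendsto (fun t : ℝ => 1 / t ^ s₀ * Q x (t * ‖g x‖)) (𝓝[>] 0)
        (𝓝 (β x * ‖g x‖ ^ s₀)) := by
      rcases (norm_nonneg (g x)).eq_or_lt with h0 | h0
      · simp [← h0, hx0, Real.zero_rpow hs₀.ne']
      have h2 : Tendsto (fun t : ℝ => t * ‖g x‖) (𝓝[>] 0) (𝓝[>] 0) := by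
        refine tendsto_nhdsWithin_iff.2 ⟨?_, ?_⟩
        · have : Tendsto (fun t : ℝ => t * ‖g x‖) (𝓝 0) (𝓝 (0 * ‖g x‖)) :=
            (continuous_id.mul continuous_const).tendsto 0
          rw [zero_mul] at this
          exact this.mono_left nhdsWithin_le_nhds
        · filter_upwards [self_mem_nhdsWithin] with t ht using mul_pos ht h0
      refine ((hx.comp h2).mul_const (‖g x‖ ^ s₀)).congr' ?_
      filter_upwards [self_mem_nhdsWithin] with t ht
      have ht0 : 0 < t := ht
      simp only [Function.comp]
      rw [Real.mul_rpow ht0.le h0.le]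
      have := (Real.rpow_pos_of_pos h0 s₀).ne'
      have := (Real.rpow_pos_of_pos ht0 s₀).ne'
      field_simp
    refine (ENNReal.tendsto_ofReal h1).congr' ?_
    filter_upwards [self_mem_nhdsWithin] with t ht
    have ht0 : 0 < t := ht
    rw [ENNReal.ofReal_mul (by positivity)]

/-- The normalization power `r` is kept separate from the growth exponent `s₀`: in `B` they
coincide, whereas in `A` the factor `t^{p₀-q₀}` is what forces the gradient to zero. -/
theorem HasTwoPowerGrowth.lintegral_rpow_le {D : Set 𝔼} {Q : 𝔼 → ℝ → ℝ} {s₀ s Qlow Qup E₀ r : ℝ}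
    (hQlow : 0 < Qlow) (hE₀ : 0 < E₀)
    (hg : HasTwoPowerGrowth D Q s₀ s Qlow Qup E₀) (g : 𝔼 → 𝔼) {t : ℝ} (ht : 0 < t) :
    ∫⁻ x in D, ENNReal.ofReal (‖g x‖ ^ s₀) ≤ ENNReal.ofReal (E₀ ^ s₀ / Qlow * t ^ (r - s₀)) *
      (ENNReal.ofReal (1 / t ^ r) * ∫⁻ x in D, ENNReal.ofReal (Q x (t * ‖g x‖))) := by
  rw [← mul_assoc, ← lintegral_const_mul' _ _ (ENNReal.mul_ne_top ENNReal.ofReal_ne_top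
    ENNReal.ofReal_ne_top)]
  refine lintegral_mono_ae ?_
  filter_upwards [hg.mul_rpow_le hQlow hE₀] with x hx
  rw [← ENNReal.ofReal_mul (by positivity), ← ENNReal.ofReal_mul (by positivity)]
  refine ENNReal.ofReal_le_ofReal ?_
  refine le_trans (le_of_eq ?_) (mul_le_mul_of_nonneg_left (hx (t * ‖g x‖) (by positivity))
    (by positivity))
  rw [Real.mul_rpow ht.le (norm_nonneg _), Real.rpow_sub ht]
  have := (Real.rpow_pos_of_pos ht s₀).ne'
  have := (Real.rpow_pos_of_pos ht r).ne'
  field_simp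

end Energy

/-! ### Affine lower bounds for the scaled energy. -/

section LowerSemicontinuity

variable {n : ℕ}

local notation "𝔼" => EuclideanSpace ℝ (Fin n)

/-- The lower envelopes `inf_{0 < E < 1/(k+1)} Q(x,E) / E^s₀`. -/
theorem HasSmallFieldLimit.exists_lower_envelope {D : Set 𝔼} {Q : 𝔼 → ℝ → ℝ} {s₀ c : ℝ}
    (hc : 0 ≤ c) (hQ : IsEnergyDensity D Q)
    (hlow : ∀ᵐ x ∂(volume.restrict D), ∀ E : ℝ, 0 ≤ E → c * E ^ s₀ ≤ Q x E)
    {β : 𝔼 → ℝ} (hβ : HasSmallFieldLimit D Q s₀ β) :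
    ∃ b : ℕ → 𝔼 → ℝ, (∀ k, AEMeasurable (b k) (volume.restrict D)) ∧
      ∀ᵐ x ∂(volume.restrict D), (∀ k, 0 ≤ b k x ∧ b k x ≤ β x) ∧
        Tendsto (fun k => b k x) atTop (𝓝 (β x)) ∧
        ∀ k : ℕ, ∀ E ∈ Ioo (0 : ℝ) (1 / ((k : ℝ) + 1)), b k x * E ^ s₀ ≤ Q x E := by
  -- Restricting the infimum to rational fields makes it countable, hence measurable; continuity in
  -- the field recovers the bound for all real ones.
  set B : ℕ → 𝔼 → ℝ≥0∞ := fun k x =>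
    ⨅ E : {E : ℚ // (E : ℝ) ∈ Ioo (0 : ℝ) (1 / ((k : ℝ) + 1))},
      ENNReal.ofReal (Q x (E.1 : ℝ) / (E.1 : ℝ) ^ s₀) with hB
  have hBm : ∀ k, AEMeasurable (B k) (volume.restrict D) := fun k =>
    AEMeasurable.iInf fun E => ((hQ.measurable _ E.2.1.le).div_const _).ennreal_ofReal
  obtain ⟨c₀, hc₀, hβpos⟩ := hβ.1.2
  refine ⟨fun k x => (B k x).toReal, fun k => (hBm k).ennreal_toReal, ?_⟩
  filter_upwards [hlow, hβ.2, hQ.continuous, hβpos] with x hx hlim hcont hβx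
  have hβ0 : 0 ≤ β x := hc₀.le.trans hβx
  have hlim' := ENNReal.tendsto_ofReal hlim
  have hδ : ∀ k : ℕ, (0 : ℝ) < 1 / ((k : ℝ) + 1) := fun k => by positivity
  have hle : ∀ k : ℕ, ∀ E ∈ Ioo (0 : ℝ) (1 / ((k : ℝ) + 1)),
      B k x ≤ ENNReal.ofReal (Q x E / E ^ s₀) := by
    intro k E hE
    by_contra! hlt
    have hat : ContinuousAt (fun y : ℝ => ENNReal.ofReal (Q x y / y ^ s₀)) E := by
      refine ENNReal.continuous_ofReal.continuousAt.comp ?_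
      exact (hcont.continuousAt (Ici_mem_nhds hE.1)).div
        (Real.continuousAt_rpow_const _ _ (Or.inl hE.1.ne')) (Real.rpow_pos_of_pos hE.1 _).ne'
    obtain ⟨V, hVs, hVo, hEV⟩ := mem_nhds_iff.1
      (inter_mem (hat.eventually_lt continuousAt_const hlt) (isOpen_Ioo.mem_nhds hE))
    obtain ⟨r, hr⟩ := (Rat.denseRange_cast (𝕜 := ℝ)).exists_mem_open hVo ⟨E, hEV⟩
    have h1 := hVs hr
    exact absurd (iInf_le (fun E : {E : ℚ // (E : ℝ) ∈ Ioo (0 : ℝ) (1 / ((k : ℝ) + 1))} =>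
      ENNReal.ofReal (Q x (E.1 : ℝ) / (E.1 : ℝ) ^ s₀)) ⟨r, h1.2⟩) (not_le.2 h1.1)
  have hBβ : ∀ k, B k x ≤ ENNReal.ofReal (β x) := fun k =>
    ge_of_tendsto hlim' (by
      filter_upwards [Ioo_mem_nhdsGT (hδ k)] with E hE using hle k E hE)
  have hBt : ∀ k, B k x ≠ ⊤ := fun k => ((hBβ k).trans_lt ENNReal.ofReal_lt_top).ne
  refine ⟨fun k => ⟨ENNReal.toReal_nonneg, ENNReal.toReal_le_of_le_ofReal hβ0 (hBβ k)⟩, ?_,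
    fun k E hE => ?_⟩
  · rw [← ENNReal.toReal_ofReal hβ0]
    refine (ENNReal.tendsto_toReal ENNReal.ofReal_ne_top).comp (tendsto_order.2 ⟨fun a ha => ?_,
      fun a ha => Eventually.of_forall fun k => (hBβ k).trans_lt ha⟩)
    obtain ⟨a', haa', ha'⟩ := exists_between ha
    obtain ⟨δ, hδ0, hδs⟩ := mem_nhdsGT_iff_exists_Ioo_subset.1 (hlim'.eventually_const_lt ha')
    have h1 : Tendsto (fun k : ℕ => 1 / ((k : ℝ) + 1)) atTop (𝓝 0) :=
      tendsto_one_div_add_atTop_nhds_zero_nat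
    filter_upwards [h1.eventually_lt_const hδ0] with k hk
    exact haa'.trans_le (le_iInf fun E => (hδs ⟨E.2.1, E.2.2.trans hk⟩ : a' < _).le)
  · have h1 := hle k E hE
    have hE0 := Real.rpow_pos_of_pos hE.1 s₀
    have hq : 0 ≤ Q x E / E ^ s₀ :=
      div_nonneg ((mul_nonneg hc hE0.le).trans (hx E hE.1.le)) hE0.le
    exact (le_div_iff₀ hE0).1 (ENNReal.toReal_le_of_le_ofReal hq h1)

/-- The power lies above its tangent at `F`; here obtained from Young's inequality for `E` and
`F^(s-1)`. -/
theorem mul_rpow_sub_one_mul_le {s E F : ℝ} (hs : 1 < s) (hE : 0 ≤ E) (hF : 0 ≤ F) :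
    s * F ^ (s - 1) * E ≤ E ^ s + (s - 1) * F ^ s := by
  have hs0 : 0 < s := by linarith
  have hconj := Real.HolderConjugate.conjExponent hs
  have h := Real.young_inequality_of_nonneg hE (Real.rpow_nonneg hF (s - 1)) hconj
  have hq : (s - 1) * Real.conjExponent s = s := hconj.sub_one_mul_conj
  rw [← Real.rpow_mul hF, hq] at h
  have hs1 : s - 1 ≠ 0 := by linarith
  have h2 : s * (F ^ s / Real.conjExponent s) = (s - 1) * F ^ s := by
    rw [Real.conjExponent]
    field_simp
  have h3 := mul_le_mul_of_nonneg_left h hs0.le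
  rw [mul_add, h2, mul_div_cancel₀ _ hs0.ne'] at h3
  linarith

/-- When `te < δ` the envelope bound holds and the tangent inequality applies. Otherwise `e ≥ δ/t`
is so large, by `hM`, that the crude bound `c e^s` already beats a linear function of bounded slope.
-/
theorem mul_rpow_sub_one_mul_le_scaled {s b b' c δ M t F e : ℝ} {q : ℝ → ℝ} (hs : 1 < s)
    (hb : 0 ≤ b) (hbb' : b ≤ b') (hc : 0 ≤ c) (hδ : 0 < δ) (ht : 0 < t) (hF : 0 ≤ F) (hFM : F ≤ M)
    (he : 0 ≤ e)
    (h1 : ∀ E ∈ Ioo 0 δ, b * E ^ s ≤ q E) (h2 : ∀ E, 0 ≤ E → c * E ^ s ≤ q E)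
    (hM : s * b' * M ^ (s - 1) ≤ c * (δ / t) ^ (s - 1)) :
    s * b * F ^ (s - 1) * e ≤ 1 / t ^ s * q (t * e) + (s - 1) * b * F ^ s := by
  have hs0 : 0 < s := by linarith
  have hs1 : 0 < s - 1 := by linarith
  have hts := Real.rpow_pos_of_pos ht s
  have hFs := Real.rpow_nonneg hF s
  have hscale : ∀ r : ℝ, r * (t * e) ^ s ≤ q (t * e) → r * e ^ s ≤ 1 / t ^ s * q (t * e) := by
    intro r hr
    rw [Real.mul_rpow ht.le he] at hr
    rw [one_div, ← div_eq_inv_mul, le_div_iff₀ hts]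
    linarith
  rcases he.eq_or_lt with h0 | h0
  · have := h2 0 le_rfl
    rw [Real.zero_rpow hs0.ne', mul_zero] at this
    rw [← h0, mul_zero, mul_zero]
    positivity
  by_cases hlt : t * e < δ
  · have h3 := hscale b (h1 _ ⟨mul_pos ht h0, hlt⟩)
    have h4 := mul_le_mul_of_nonneg_left (mul_rpow_sub_one_mul_le hs he hF) hb
    linarith
  · have h3 := hscale c (h2 _ (by positivity))
    have hde : δ / t ≤ e := by
      rw [div_le_iff₀ ht]
      linarith [not_lt.1 hlt]
    have h4 : s * b * F ^ (s - 1) ≤ c * e ^ (s - 1) := by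
      calc s * b * F ^ (s - 1) ≤ s * b' * M ^ (s - 1) := by
            have := Real.rpow_le_rpow hF hFM hs1.le
            have hb' : 0 ≤ b' := hb.trans hbb'
            gcongr
        _ ≤ c * (δ / t) ^ (s - 1) := hM
        _ ≤ c * e ^ (s - 1) := by gcongr
    have h5 : e ^ (s - 1) * e = e ^ s := by
      rw [Real.rpow_sub_one h0.ne', div_mul_cancel₀ _ h0.ne']
    have h6 := mul_le_mul_of_nonneg_right h4 he
    rw [mul_assoc c, h5] at h6
    have h7 : 0 ≤ (s - 1) * b * F ^ s := by positivity
    linarith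

theorem norm_rpow_smul_self {F : Type*} [NormedAddCommGroup F] [NormedSpace ℝ F] {s : ℝ}
    (hs : 1 < s) (x : F) : ‖(‖x‖ ^ (s - 2)) • x‖ = ‖x‖ ^ (s - 1) := by
  rw [norm_smul, Real.norm_of_nonneg (by positivity)]
  rcases (norm_nonneg x).eq_or_lt with h | h
  · rw [← h, mul_zero, Real.zero_rpow (by linarith)]
  · rw [← Real.rpow_add_one h.ne']
    congr 1
    ring

/-- Lower bound of the scaled energy by an affine function of the field. -/
theorem setIntegral_inner_le_scaled_energy {D : Set 𝔼} (hD : volume D ≠ ⊤) {Q : 𝔼 → ℝ → ℝ}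
    {s b' c δ M t : ℝ} (hs : 1 < s) (hc : 0 ≤ c) (hδ : 0 < δ) (ht : 0 < t)
    (hQ : IsEnergyDensity D Q)
    (hlow : ∀ᵐ x ∂(volume.restrict D), ∀ E : ℝ, 0 ≤ E → c * E ^ s ≤ Q x E) {b : 𝔼 → ℝ}
    (hbm : AEMeasurable b (volume.restrict D))
    (hb : ∀ᵐ x ∂(volume.restrict D), 0 ≤ b x ∧ b x ≤ b' ∧ ∀ E ∈ Ioo 0 δ, b x * E ^ s ≤ Q x E)
    {Φ : 𝔼 → 𝔼} (hΦ : AEStronglyMeasurable Φ (volume.restrict D)) (hΦM : ∀ x, ‖Φ x‖ ≤ M)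
    (hM : s * b' * M ^ (s - 1) ≤ c * (δ / t) ^ (s - 1)) {g : 𝔼 → 𝔼}
    (hg : AEStronglyMeasurable g (volume.restrict D))
    (hfin : ∫⁻ x in D, ENNReal.ofReal (Q x (t * ‖g x‖)) ≠ ⊤)
    (hint : Integrable (fun x => inner ℝ ((s * b x * ‖Φ x‖ ^ (s - 2)) • Φ x) (g x))
      (volume.restrict D)) :
    ∫ x in D, inner ℝ ((s * b x * ‖Φ x‖ ^ (s - 2)) • Φ x) (g x) ≤
      (ENNReal.ofReal (1 / t ^ s) * ∫⁻ x in D, ENNReal.ofReal (Q x (t * ‖g x‖))).toReal +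
        ∫ x in D, (s - 1) * b x * ‖Φ x‖ ^ s := by
  have hs0 : 0 < s := by linarith
  have hμ : IsFiniteMeasure (volume.restrict D) := ⟨by simpa using hD.lt_top⟩
  have hM0 : 0 ≤ M := (norm_nonneg _).trans (hΦM 0)
  have hqm : AEMeasurable (fun x => Q x (t * ‖g x‖)) (volume.restrict D) :=
    hQ.aemeasurable_comp (hg.norm.aemeasurable.const_mul t) fun x => by positivity
  have hq0 : 0 ≤ᵐ[volume.restrict D] fun x => Q x (t * ‖g x‖) := by
    filter_upwards [hQ.nonneg] with x hx using hx _ (by positivity)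
  have hqi : Integrable (fun x => Q x (t * ‖g x‖)) (volume.restrict D) :=
    ⟨hqm.aestronglyMeasurable, (hasFiniteIntegral_iff_ofReal hq0).2 hfin.lt_top⟩
  have hri : Integrable (fun x => (s - 1) * b x * ‖Φ x‖ ^ s) (volume.restrict D) := by
    refine Integrable.of_bound ((hbm.const_mul _).mul
      (hΦ.norm.aemeasurable.pow_const s)).aestronglyMeasurable ((s - 1) * b' * M ^ s) ?_
    filter_upwards [hb] with x hx
    have h1 := Real.rpow_le_rpow (norm_nonneg _) (hΦM x) hs0.le
    have h2 : 0 ≤ s - 1 := by linarith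
    have h3 := hx.1
    have h4 := hx.2.1
    have h5 : 0 ≤ b' := h3.trans h4
    rw [Real.norm_of_nonneg (by positivity)]
    gcongr
  have hval : (ENNReal.ofReal (1 / t ^ s) *
      ∫⁻ x in D, ENNReal.ofReal (Q x (t * ‖g x‖))).toReal =
      ∫ x in D, 1 / t ^ s * Q x (t * ‖g x‖) := by
    rw [ENNReal.toReal_mul, ENNReal.toReal_ofReal (by positivity), integral_const_mul,
      integral_eq_lintegral_of_nonneg_ae hq0 hqm.aestronglyMeasurable]
  rw [hval, ← integral_add (hqi.const_mul _) hri]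
  refine integral_mono_ae hint ((hqi.const_mul _).add hri) ?_
  -- The vector field is the gradient of `b‖·‖^s` at `Φ`; Cauchy–Schwarz reduces the pairing to the
  -- scalar tangent inequality.
  filter_upwards [hb, hlow] with x hx hxl
  refine le_trans ?_ (mul_rpow_sub_one_mul_le_scaled hs hx.1 hx.2.1 hc hδ ht (norm_nonneg (Φ x))
    (hΦM x) (norm_nonneg (g x)) hx.2.2 hxl hM)
  refine (real_inner_le_norm _ _).trans (mul_le_mul_of_nonneg_right (le_of_eq ?_) (norm_nonneg _))
  rw [mul_smul, norm_smul, norm_rpow_smul_self hs, Real.norm_of_nonneg (mul_nonneg hs0.le hx.1)]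

end LowerSemicontinuity

/-! ### Closed convex conditions in the Sobolev space. -/

section ConvexSets

variable {n : ℕ}

local notation "𝔼" => EuclideanSpace ℝ (Fin n)

/-- With `Φ = g` the tangent inequality is an equality, and the affine bound becomes a bound for the
energy with weight `b k`. Since `Φ` has to be bounded, `g` is truncated, and Fatou's lemma removes
truncation and envelope together. -/
theorem lintegral_weight_le_of_affine_bounds {D : Set 𝔼} (hD : volume D ≠ ⊤) {s b' m : ℝ}
    (hs : 1 < s) {β : 𝔼 → ℝ} {b : ℕ → 𝔼 → ℝ}
    (hbm : ∀ k, AEMeasurable (b k) (volume.restrict D))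
    (hb : ∀ᵐ x ∂(volume.restrict D), (∀ k, 0 ≤ b k x ∧ b k x ≤ b') ∧
      Tendsto (fun k => b k x) atTop (𝓝 (β x)))
    {g : 𝔼 → 𝔼} (hg : StronglyMeasurable g)
    (h : ∀ (k : ℕ) (M : ℝ) (Φ : 𝔼 → 𝔼), StronglyMeasurable Φ → (∀ x, ‖Φ x‖ ≤ M) →
      ∫ x in D, inner ℝ ((s * b k x * ‖Φ x‖ ^ (s - 2)) • Φ x) (g x) ≤
        m + ∫ x in D, (s - 1) * b k x * ‖Φ x‖ ^ s) :
    ∫⁻ x in D, ENNReal.ofReal (β x * ‖g x‖ ^ s) ≤ ENNReal.ofReal m := by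
  have hs0 : 0 < s := by linarith
  have hμ : IsFiniteMeasure (volume.restrict D) := ⟨by simpa using hD.lt_top⟩
  -- The truncation level and the envelope share the index `k`, so a single limit is enough.
  set Φ : ℕ → 𝔼 → 𝔼 := fun k => {x | ‖g x‖ ≤ k}.indicator g with hΦ
  have hset : ∀ k : ℕ, MeasurableSet {x | ‖g x‖ ≤ k} := fun k =>
    measurableSet_le hg.norm.measurable measurable_const
  have hΦm : ∀ k, StronglyMeasurable (Φ k) := fun k => hg.indicator (hset k)
  have hΦM : ∀ k x, ‖Φ k x‖ ≤ (k : ℝ) := fun k x => by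
    by_cases hx : ‖g x‖ ≤ k
    · simpa [hΦ, indicator_of_mem (show x ∈ {x | ‖g x‖ ≤ k} from hx)] using hx
    · simp [hΦ, indicator_of_notMem (show x ∉ {x | ‖g x‖ ≤ k} from hx)]
  have hkey : ∀ k x, inner ℝ ((s * b k x * ‖Φ k x‖ ^ (s - 2)) • Φ k x) (g x) =
      s * (b k x * ‖Φ k x‖ ^ s) := fun k x => by
    rw [real_inner_smul_left]
    by_cases hx : ‖g x‖ ≤ k
    · rw [show Φ k x = g x from indicator_of_mem (show x ∈ {x | ‖g x‖ ≤ k} from hx) g,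
        real_inner_self_eq_norm_sq]
      rcases (norm_nonneg (g x)).eq_or_lt with h0 | h0
      · rw [← h0, Real.zero_rpow hs0.ne']
        simp
      · rw [Real.rpow_sub h0, Real.rpow_ofNat]
        field_simp
    · rw [show Φ k x = 0 from indicator_of_notMem (show x ∉ {x | ‖g x‖ ≤ k} from hx) g,
        inner_zero_left, norm_zero, Real.zero_rpow hs0.ne']
      simp
  have hfm : ∀ k, AEMeasurable (fun x => b k x * ‖Φ k x‖ ^ s) (volume.restrict D) := fun k =>
    (hbm k).mul ((hΦm k).norm.measurable.pow_const s).aemeasurable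
  have hf0 : ∀ k, 0 ≤ᵐ[volume.restrict D] fun x => b k x * ‖Φ k x‖ ^ s := fun k => by
    filter_upwards [hb] with x hx
    have := (hx.1 k).1
    positivity
  have hfi : ∀ k, Integrable (fun x => b k x * ‖Φ k x‖ ^ s) (volume.restrict D) := fun k => by
    refine Integrable.of_bound (hfm k).aestronglyMeasurable (b' * (k : ℝ) ^ s) ?_
    filter_upwards [hb, hf0 k] with x hx hx0
    have h1 := Real.rpow_le_rpow (norm_nonneg _) (hΦM k x) hs0.le
    have h2 := hx.1 k
    have h3 : 0 ≤ b' := h2.1.trans h2.2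
    rw [Real.norm_of_nonneg hx0]
    exact mul_le_mul h2.2 h1 (by positivity) h3
  have hbound : ∀ k, ∫⁻ x in D, ENNReal.ofReal (b k x * ‖Φ k x‖ ^ s) ≤ ENNReal.ofReal m := by
    intro k
    rw [← ofReal_integral_eq_lintegral_ofReal (hfi k) (hf0 k)]
    refine ENNReal.ofReal_le_ofReal ?_
    have h1 := h k k (Φ k) (hΦm k) (hΦM k)
    simp_rw [hkey, mul_assoc (s - 1)] at h1
    rw [integral_const_mul, integral_const_mul] at h1
    linarith
  calc ∫⁻ x in D, ENNReal.ofReal (β x * ‖g x‖ ^ s)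
      = ∫⁻ x in D, liminf (fun k => ENNReal.ofReal (b k x * ‖Φ k x‖ ^ s)) atTop := by
        refine lintegral_congr_ae ?_
        filter_upwards [hb] with x hx
        refine (Tendsto.liminf_eq (ENNReal.tendsto_ofReal ?_)).symm
        refine (hx.2.mul_const (‖g x‖ ^ s)).congr' ?_
        filter_upwards [eventually_ge_atTop ⌈‖g x‖⌉₊] with k hk
        have : x ∈ {x | ‖g x‖ ≤ k} := show ‖g x‖ ≤ k from Nat.ceil_le.1 hk
        rw [show Φ k x = g x from indicator_of_mem this g]
    _ ≤ liminf (fun k => ∫⁻ x in D, ENNReal.ofReal (b k x * ‖Φ k x‖ ^ s)) atTop :=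
        lintegral_liminf_le' fun k => (hfm k).ennreal_ofReal
    _ ≤ ENNReal.ofReal m := by
        refine liminf_le_of_le (by isBoundedDefault) fun a ha => ?_
        obtain ⟨k, hk⟩ := ha.exists
        exact hk.trans (hbound k)

theorem eLpNorm_smul_le_of_bound {D : Set 𝔼} {s : ℝ≥0∞} {κ : 𝔼 → ℝ} {K : ℝ}
    (hκ : ∀ᵐ x ∂(volume.restrict D), ‖κ x‖ ≤ K) (g : 𝔼 → 𝔼) :
    eLpNorm (fun x => κ x • g x) s (volume.restrict D) ≤
      ENNReal.ofReal K * eLpNorm g s (volume.restrict D) :=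
  eLpNorm_le_mul_eLpNorm_of_ae_le_mul (hκ.mono fun x hx => by
    rw [norm_smul]
    exact mul_le_mul_of_nonneg_right hx (norm_nonneg _)) s

theorem tendsto_eLpNorm_sub_of_tendsto {Ω : Set 𝔼} {s : ℝ≥0∞} [Fact (1 ≤ s)] {ι : Type*}
    {l : Filter ι} {V : ι → sobolevSpace s Ω} {W : sobolevSpace s Ω} (h : Tendsto V l (𝓝 W)) :
    Tendsto (fun k => eLpNorm (⇑(V k).1.1 - ⇑W.1.1) s (volume.restrict Ω)) l (𝓝 0) ∧
      Tendsto (fun k => eLpNorm (⇑(V k).1.2 - ⇑W.1.2) s (volume.restrict Ω)) l (𝓝 0) := by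
  have h' := (continuous_subtype_val.tendsto W).comp h
  exact ⟨(Lp.tendsto_Lp_iff_tendsto_eLpNorm' _ _).1 ((continuous_fst.tendsto W.1).comp h'),
    (Lp.tendsto_Lp_iff_tendsto_eLpNorm' _ _).1 ((continuous_snd.tendsto W.1).comp h')⟩

/-- The weight has two uses: `β^{1/p₀}` on `B` gives sublevel sets of the limit energy, and the
constant one on `A` gives the gradient constraint. Boundedness of the weight makes the seminorm
continuous. -/
theorem isClosed_setOf_eLpNorm_smul_grad_le {Ω D : Set 𝔼} (hDΩ : D ⊆ Ω) {s : ℝ≥0∞}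
    [hs : Fact (1 ≤ s)] {κ : 𝔼 → ℝ} {K : ℝ} (hκm : AEStronglyMeasurable κ (volume.restrict D))
    (hκ : ∀ᵐ x ∂(volume.restrict D), ‖κ x‖ ≤ K) (r : ℝ≥0∞) :
    IsClosed {V : sobolevSpace s Ω |
      eLpNorm (fun x => κ x • V.1.2 x) s (volume.restrict D) ≤ r} := by
  refine IsSeqClosed.isClosed fun V W hV hVW => ?_
  have hle : volume.restrict D ≤ volume.restrict Ω := Measure.restrict_mono hDΩ le_rfl
  have h2 := (tendsto_eLpNorm_sub_of_tendsto hVW).2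
  have h3 : Tendsto (fun k => r + ENNReal.ofReal K *
      eLpNorm (⇑(V k).1.2 - ⇑W.1.2) s (volume.restrict Ω)) atTop (𝓝 r) := by
    simpa using (ENNReal.Tendsto.const_mul h2 (Or.inr ENNReal.ofReal_ne_top)).const_add r
  refine ge_of_tendsto' h3 fun k => ?_
  have hm : ∀ g : Lp 𝔼 s (volume.restrict Ω),
      AEStronglyMeasurable (fun x => κ x • g x) (volume.restrict D) := fun g =>
    hκm.smul ((Lp.aestronglyMeasurable g).mono_measure hle)
  have h4 : (fun x => κ x • W.1.2 x) =
      (fun x => κ x • (V k).1.2 x) - fun x => κ x • ((V k).1.2 x - W.1.2 x) := by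
    ext1 x
    simp [smul_sub]
  rw [h4]
  refine (eLpNorm_sub_le (hm _) ?_ hs.out).trans (add_le_add (hV k)
    ((eLpNorm_smul_le_of_bound hκ _).trans ?_))
  · simp_rw [smul_sub]
    exact (hm _).sub (hm _)
  · gcongr
    exact eLpNorm_mono_measure _ hle

theorem convex_setOf_eLpNorm_smul_grad_le {Ω D : Set 𝔼} (hDΩ : D ⊆ Ω) {s : ℝ≥0∞}
    [hs : Fact (1 ≤ s)] {κ : 𝔼 → ℝ} (hκm : AEStronglyMeasurable κ (volume.restrict D)) (r : ℝ≥0∞) :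
    Convex ℝ {V : sobolevSpace s Ω |
      eLpNorm (fun x => κ x • V.1.2 x) s (volume.restrict D) ≤ r} := by
  intro V hV W hW a c ha hc hac
  have hle : volume.restrict D ≤ volume.restrict Ω := Measure.restrict_mono hDΩ le_rfl
  have hm : ∀ g : Lp 𝔼 s (volume.restrict Ω),
      AEStronglyMeasurable (fun x => κ x • g x) (volume.restrict D) := fun g =>
    hκm.smul ((Lp.aestronglyMeasurable g).mono_measure hle)
  have h1 : (fun x => κ x • (a • V + c • W).1.2 x) =ᵐ[volume.restrict D]
      a • (fun x => κ x • V.1.2 x) + c • fun x => κ x • W.1.2 x := by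
    filter_upwards [ae_mono hle (Lp.coeFn_add (a • V.1.2) (c • W.1.2)),
      ae_mono hle (Lp.coeFn_smul a V.1.2), ae_mono hle (Lp.coeFn_smul c W.1.2)] with x hx hx1 hx2
    have : (a • V + c • W).1.2 = a • V.1.2 + c • W.1.2 := rfl
    rw [this, hx, Pi.add_apply, hx1, hx2]
    simp [smul_comm (κ x)]
  change eLpNorm _ _ _ ≤ r
  rw [eLpNorm_congr_ae h1]
  refine (eLpNorm_add_le ((hm _).const_smul a) ((hm _).const_smul c) hs.out).trans ?_
  rw [eLpNorm_const_smul, eLpNorm_const_smul]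
  calc _ ≤ ‖a‖ₑ * r + ‖c‖ₑ * r := by
        gcongr
        · exact hV
        · exact hW
    _ = r := by
        rw [← add_mul, Real.enorm_of_nonneg ha, Real.enorm_of_nonneg hc,
          ← ENNReal.ofReal_add ha hc, hac, ENNReal.ofReal_one, one_mul]

/-- The boundary condition survives strong limits; with its convexity, this lets weak limits inherit
it. -/
theorem isClosed_setOf_hasZeroExt_sub {Ω : Set 𝔼} (hΩ : IsOpen Ω) {s : ℝ≥0∞} [hs : Fact (1 ≤ s)]
    {f : 𝔼 → ℝ} {g : 𝔼 → 𝔼} (hf : MemLp f s (volume.restrict Ω))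
    (hg : MemLp g s (volume.restrict Ω)) :
    IsClosed {V : sobolevSpace s Ω | HasZeroExt Ω (V.1.1 - f) (V.1.2 - g)} := by
  refine IsSeqClosed.isClosed fun V W hV hVW => ?_
  obtain ⟨h1, h2⟩ := tendsto_eLpNorm_sub_of_tendsto hVW
  refine HasZeroExt.of_tendsto hΩ hs.out (l := atTop) hV (fun k => (Lp.memLp _).sub hf)
    (fun k => (Lp.memLp _).sub hg) ((Lp.memLp _).sub hf) ((Lp.memLp _).sub hg) ?_ ?_
  · simpa using h1
  · simpa using h2

theorem convex_setOf_hasZeroExt_sub {Ω : Set 𝔼} (hΩ : IsOpen Ω) {s : ℝ≥0∞} [hs : Fact (1 ≤ s)]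
    (f : 𝔼 → ℝ) (g : 𝔼 → 𝔼) :
    Convex ℝ {V : sobolevSpace s Ω | HasZeroExt Ω (V.1.1 - f) (V.1.2 - g)} := by
  intro V hV W hW a c ha hc hac
  refine ((hV.const_smul a).add (hW.const_smul c)).congr hΩ ?_ ?_
  · have : (a • V + c • W).1.1 = a • V.1.1 + c • W.1.1 := rfl
    filter_upwards [Lp.coeFn_add (a • V.1.1) (c • W.1.1), Lp.coeFn_smul a V.1.1,
      Lp.coeFn_smul c W.1.1] with x hx hx1 hx2
    have h3 : f x = a • f x + c • f x := by rw [← add_smul, hac, one_smul]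
    calc _ = a • V.1.1 x + c • W.1.1 x - (a • f x + c • f x) := by
          simp only [Pi.add_apply, Pi.smul_apply, Pi.sub_apply, smul_sub]
          abel
      _ = _ := by
          rw [this, Pi.sub_apply, hx, Pi.add_apply, hx1, hx2, ← h3]
          rfl
  · have : (a • V + c • W).1.2 = a • V.1.2 + c • W.1.2 := rfl
    filter_upwards [Lp.coeFn_add (a • V.1.2) (c • W.1.2), Lp.coeFn_smul a V.1.2,
      Lp.coeFn_smul c W.1.2] with x hx hx1 hx2
    have h3 : g x = a • g x + c • g x := by rw [← add_smul, hac, one_smul]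
    calc _ = a • V.1.2 x + c • W.1.2 x - (a • g x + c • g x) := by
          simp only [Pi.add_apply, Pi.smul_apply, Pi.sub_apply, smul_sub]
          abel
      _ = _ := by
          rw [this, Pi.sub_apply, hx, Pi.add_apply, hx1, hx2, ← h3]
          rfl

theorem exists_sobolevSpace {s : ℝ≥0∞} [Fact (1 ≤ s)] {U : Set 𝔼} (hU : IsOpen U) {z : 𝔼 → ℝ}
    {g : 𝔼 → 𝔼} (h : HasWeakGradient U z g) (hz : MemLp z s (volume.restrict U))
    (hg : MemLp g s (volume.restrict U)) :
    ∃ V : sobolevSpace s U, V.1.1 =ᵐ[volume.restrict U] z ∧ V.1.2 =ᵐ[volume.restrict U] g :=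
  ⟨⟨(hz.toLp z, hg.toLp g), h.congr hU hz.coeFn_toLp.symm hg.coeFn_toLp.symm⟩,
    hz.coeFn_toLp, hg.coeFn_toLp⟩

theorem norm_sobolevSpace_le {s : ℝ≥0∞} [Fact (1 ≤ s)] {U : Set 𝔼} (V : sobolevSpace s U)
    {R : ℝ≥0∞} (hR : R ≠ ⊤) (h1 : eLpNorm V.1.1 s (volume.restrict U) ≤ R)
    (h2 : eLpNorm V.1.2 s (volume.restrict U) ≤ R) : ‖V‖ ≤ R.toReal := by
  change max ‖V.1.1‖ ‖V.1.2‖ ≤ _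
  rw [Lp.norm_def, Lp.norm_def]
  exact max_le (ENNReal.toReal_mono hR h1) (ENNReal.toReal_mono hR h2)

theorem uniformlyConvexFun_sobolevSpace {s : ℝ} (hs : 1 < s) [Fact (1 ≤ ENNReal.ofReal s)]
    (U : Set 𝔼) :
    UniformlyConvexFun (fun V : sobolevSpace (ENNReal.ofReal s) U => ‖V.1.1‖ ^ s + ‖V.1.2‖ ^ s) :=
  ((uniformlyConvexFun_Lp_norm_rpow hs).prod (uniformlyConvexFun_Lp_norm_rpow hs)).submodule _

/-- Only the boundary of `A` is missing from the union, and a Lipschitz boundary is a null set. -/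
theorem IsTwoPhaseDomain.restrict_union {Ω A : Set 𝔼} (h : IsTwoPhaseDomain Ω A) :
    volume.restrict Ω = volume.restrict ((Ω \ closure A) ∪ A) := by
  have h0 : volume (frontier A) = 0 := h.lipschitz_A.volume_frontier
  refine Measure.restrict_congr_set (ae_eq_set.2 ⟨measure_mono_null (fun x hx => ?_) h0, ?_⟩)
  · by_contra hx'
    rw [h.isOpen_A.frontier_eq] at hx'
    exact hx.2 (by
      by_cases hA : x ∈ A
      · exact Or.inr hA
      · exact Or.inl ⟨hx.1, fun hc => hx' ⟨hc, hA⟩⟩)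
  · rw [sdiff_eq_bot_iff.2 (union_subset sdiff_subset
      (subset_closure.trans h.closure_A_subset))]
    simp

theorem IsTwoPhaseDomain.ae_iff {Ω A : Set 𝔼} (h : IsTwoPhaseDomain Ω A) {P : 𝔼 → Prop} :
    (∀ᵐ x ∂(volume.restrict Ω), P x) ↔
      (∀ᵐ x ∂(volume.restrict (Ω \ closure A)), P x) ∧ ∀ᵐ x ∂(volume.restrict A), P x := by
  rw [h.restrict_union, ae_restrict_union_iff]

theorem IsTwoPhaseDomain.eLpNorm_le {Ω A : Set 𝔼} (h : IsTwoPhaseDomain Ω A) {F : Type*}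
    [NormedAddCommGroup F] {s : ℝ≥0∞} (hs : 1 ≤ s) {g : 𝔼 → F}
    (hg : AEStronglyMeasurable g (volume.restrict Ω)) :
    eLpNorm g s (volume.restrict Ω) ≤
      eLpNorm g s (volume.restrict (Ω \ closure A)) + eLpNorm g s (volume.restrict A) := by
  rw [h.restrict_union] at hg ⊢
  exact eLpNorm_restrict_union_le hs (h.isOpen_Ω.measurableSet.diff isClosed_closure.measurableSet)
    h.isOpen_A.measurableSet hg

end ConvexSets

/-! ### Admissible functions of the limit problem. -/

section LimitProblem

variable {n : ℕ}

local notation "𝔼" => EuclideanSpace ℝ (Fin n)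

/-- One member of a partition of unity subordinate to `Ω` and the complement of `K`: the other
member has support away from `K`, so this one equals one near `K`. -/
theorem exists_smooth_cutoff {Ω K : Set 𝔼} (hΩ : IsOpen Ω) (hK : IsClosed K) (hKΩ : K ⊆ Ω) :
    ∃ χ : 𝔼 → ℝ, ContDiff ℝ ∞ χ ∧ tsupport χ ⊆ Ω ∧ ∀ x ∈ K, ∀ᶠ y in 𝓝 x, χ y = 1 := by
  obtain ⟨ψ, h1, h2, h3⟩ := exists_smooth_partition (s := (univ : Set 𝔼)) isClosed_univ
    (U := fun b : Bool => if b then Ω else Kᶜ) (by simp [hΩ, hK.isOpen_compl]) (by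
      intro x _
      by_cases hx : x ∈ K
      · exact mem_iUnion.2 ⟨true, by simpa using hKΩ hx⟩
      · exact mem_iUnion.2 ⟨false, by simpa using hx⟩)
  refine ⟨ψ true, h1 true, by simpa using h2 true, fun x hx => ?_⟩
  have hx' : x ∈ (tsupport (ψ false))ᶜ := fun hc => by
    have := h2 false hc
    simp only [Bool.false_eq_true, if_false] at this
    exact this hx
  filter_upwards [(isClosed_tsupport _).isOpen_compl.mem_nhds hx'] with y hy
  have h4 := h3 y (mem_univ y)
  have h5 : ψ false y = 0 := image_eq_zero_of_notMem_tsupport hy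
  rw [Fintype.sum_bool, h5, add_zero] at h4
  exact h4

/-- A test function on the whole space need not be supported in `Ω`. It is multiplied by a second
cutoff equal to one near the support of `χ`, which changes neither integral. -/
theorem HasWeakGradient.hasZeroExt_mul {Ω : Set 𝔼} (hΩ : IsOpen Ω) {u : 𝔼 → ℝ} {g : 𝔼 → 𝔼}
    (h : HasWeakGradient Ω u g) {χ : 𝔼 → ℝ} (hχ : IsTestFunction Ω χ) :
    HasZeroExt Ω (fun x => χ x * u x) (fun x => χ x • g x + u x • gradient χ x) := by
  have hi1 : Integrable (fun x => χ x * u x) volume :=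
    integrable_smul_of_compact h.1 hχ.1.continuous hχ.2.1 hχ.2.2
  have hi2 : Integrable (fun x => χ x • g x + u x • gradient χ x) volume :=
    (h.integrable_right hχ).add (h.integrable_left hχ)
  have hz : ∀ x ∉ tsupport χ, χ x = 0 ∧ gradient χ x = 0 := fun x hx =>
    ⟨image_eq_zero_of_notMem_tsupport hx,
      Function.notMem_support.1 fun hx' => hx (support_gradient_subset χ hx')⟩
  have e1 : Ω.indicator (fun x => χ x * u x) = fun x => χ x * u x :=
    indicator_eq_self.2 fun x hx => by
      by_contra hxΩ
      exact hx (by simp [(hz x fun hc => hxΩ (hχ.2.2 hc)).1])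
  have e2 : Ω.indicator (fun x => χ x • g x + u x • gradient χ x) =
      fun x => χ x • g x + u x • gradient χ x :=
    indicator_eq_self.2 fun x hx => by
      by_contra hxΩ
      exact hx (by simp [hz x fun hc => hxΩ (hχ.2.2 hc)])
  rw [HasZeroExt, e1, e2, hasWeakGradient_iff]
  refine ⟨hi1.locallyIntegrable.locallyIntegrableOn _,
    hi2.locallyIntegrable.locallyIntegrableOn _, fun φ hφ => ?_⟩
  obtain ⟨η, hη, hηs, hη1⟩ := exists_smooth_cutoff hΩ (isClosed_tsupport χ) hχ.2.2
  have htest : IsTestFunction Ω fun x => η x * φ x :=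
    ⟨hη.mul hφ.1, hφ.2.1.mul_left, (tsupport_mul_subset_left).trans hηs⟩
  have h1 := (hasWeakGradient_iff.1 (h.mul_contDiff hΩ hχ.1)).2.2 _ htest
  have hηφ : ∀ x ∈ tsupport χ, gradient (fun y => η y * φ y) x = gradient φ x := fun x hx => by
    have : (fun y => η y * φ y) =ᶠ[𝓝 x] φ := by
      filter_upwards [hη1 x hx] with y hy
      rw [hy, one_mul]
    simp only [gradient, this.fderiv_eq]
  convert h1 using 2
  · ext1 x
    by_cases hx : x ∈ tsupport χ
    · rw [hηφ x hx]
    · simp [(hz x hx).1]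
  · congr 1
    ext1 x
    by_cases hx : x ∈ tsupport χ
    · rw [(hη1 x hx).self_of_nhds, one_mul]
    · simp [hz x hx]

theorem hasWeakGradient_of_sub {Ω : Set 𝔼} (hΩ : IsOpen Ω) {z f : 𝔼 → ℝ} {g k : 𝔼 → 𝔼}
    (h : HasZeroExt Ω (z - f) (g - k)) (hf : HasWeakGradient Ω f k) : HasWeakGradient Ω z g := by
  have := (h.hasWeakGradient hΩ).add hf
  rwa [sub_add_cancel, sub_add_cancel] at this

/-- Boundary data can be changed inside `Ω` so as to be locally constant on `A`. -/
theorem exists_datum_grad_eq_zero {Ω A : Set 𝔼} (hΩA : IsTwoPhaseDomain Ω A) {s : ℝ} {f : 𝔼 → ℝ}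
    (hf : MemSobolev s Ω f) :
    ∃ f' : 𝔼 → ℝ, MemSobolev s Ω f' ∧ HasZeroExt Ω (f' - f) (weakGrad Ω f' - weakGrad Ω f) ∧
      weakGrad Ω f' =ᵐ[volume.restrict A] 0 := by
  have hΩ := hΩA.isOpen_Ω
  have hAΩ : A ⊆ Ω := subset_closure.trans hΩA.closure_A_subset
  obtain ⟨χ, hχ, hχs, hχ1⟩ := exists_smooth_cutoff hΩ isClosed_closure hΩA.closure_A_subset
  have hc : HasCompactSupport χ := Metric.isCompact_of_isClosed_isBounded (isClosed_tsupport χ)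
    (hΩA.isBounded_Ω.subset hχs)
  have hw := hf.hasWeakGradient
  have hz := hw.hasZeroExt_mul hΩ ⟨hχ, hc, hχs⟩
  set g' : 𝔼 → 𝔼 := fun x => χ x • weakGrad Ω f x + f x • gradient χ x with hg'
  have h1 : HasWeakGradient Ω (f - fun x => χ x * f x) (weakGrad Ω f - g') :=
    hw.sub (hz.hasWeakGradient hΩ)
  have hχ1' : ContDiff ℝ 1 χ := hχ.of_le (by norm_cast)
  obtain ⟨C, hC⟩ := hχ.continuous.bounded_above_of_compact_support hc
  obtain ⟨C', hC'⟩ := (continuous_gradient hχ1').bounded_above_of_compact_support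
    (hc.of_isClosed_subset (isClosed_tsupport _) (tsupport_gradient_subset χ))
  have hmz : MemLp (fun x => χ x * f x) (ENNReal.ofReal s) (volume.restrict Ω) :=
    hf.1.of_le_mul (c := C) (hχ.continuous.aestronglyMeasurable.mul hf.1.1)
      (Eventually.of_forall fun x => by
        rw [norm_mul]
        exact mul_le_mul_of_nonneg_right (hC x) (norm_nonneg _))
  have hgf := hf.memLp_weakGrad hΩ
  have hmg : MemLp g' (ENNReal.ofReal s) (volume.restrict Ω) :=
    (hgf.of_le_mul (c := C) (hχ.continuous.aestronglyMeasurable.smul hgf.1)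
      (Eventually.of_forall fun x => by
        rw [Pi.smul_apply', norm_smul]
        exact mul_le_mul_of_nonneg_right (hC x) (norm_nonneg _))).add
    (hf.1.of_le_mul (c := C') (hf.1.1.smul (continuous_gradient hχ1').aestronglyMeasurable)
      (Eventually.of_forall fun x => by
        rw [norm_smul, mul_comm]
        exact mul_le_mul_of_nonneg_right (hC' x) (norm_nonneg _)))
  have hae := h1.weakGrad_ae_eq hΩ
  -- With `χ = 1` near `closure A`, the new datum is zero there and is unchanged near the boundary
  -- of `Ω`.
  refine ⟨f - fun x => χ x * f x, ⟨hf.1.sub hmz, _, h1, hgf.sub hmg⟩,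
    (hz.const_smul (-1)).congr hΩ (Eventually.of_forall fun x => ?_) ?_, ?_⟩
  · simp
  · filter_upwards [hae] with x hx
    simp [hx]
  · filter_upwards [ae_mono (Measure.restrict_mono hAΩ le_rfl) hae,
      ae_restrict_mem hΩA.isOpen_A.measurableSet] with x hx hxA
    have h2 := hχ1 x (subset_closure hxA)
    have h3 : gradient χ x = 0 := gradient_eq_zero_of_eventually_const h2
    simp [hx, hg', h2.self_of_nhds, h3]

theorem MemSobolevZero.hasZeroExt_sub {s : ℝ} (hs : 1 ≤ s) {Ω : Set 𝔼} (hΩ : IsOpen Ω)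
    {z f : 𝔼 → ℝ} (hz : MemSobolev s Ω z) (hf : MemSobolev s Ω f)
    (h : MemSobolevZero s Ω (z - f)) :
    HasZeroExt Ω (z - f) (weakGrad Ω z - weakGrad Ω f) :=
  (h.hasZeroExt hs hΩ).congr hΩ EventuallyEq.rfl
    ((hz.hasWeakGradient.sub hf.hasWeakGradient).weakGrad_ae_eq hΩ)

/-- A function with the boundary values of `f` whose gradient is in `L^s` belongs to `W^{1,s}`. -/
theorem HasZeroExt.memSobolev_of_sub (hn : 1 ≤ n) {Ω : Set 𝔼} (hΩ : IsOpen Ω)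
    (hΩb : Bornology.IsBounded Ω) (hΩL : HasLipschitzBoundary Ω) {s : ℝ} (hs : 1 ≤ s)
    {z f : 𝔼 → ℝ} {g : 𝔼 → 𝔼} (hf : MemSobolev s Ω f)
    (h : HasZeroExt Ω (z - f) (g - weakGrad Ω f))
    (hg : MemLp g (ENNReal.ofReal s) (volume.restrict Ω)) :
    MemSobolev s Ω z ∧ MemSobolevZero s Ω (z - f) ∧ weakGrad Ω z =ᵐ[volume.restrict Ω] g := by
  obtain ⟨C, hC, hP⟩ := exists_poincare hn hΩ hΩb
  have hd := hg.sub (hf.memLp_weakGrad hΩ)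
  have hz : MemLp (z - f) (ENNReal.ofReal s) (volume.restrict Ω) :=
    ⟨(h.hasWeakGradient hΩ).1.aestronglyMeasurable,
      (hP _ (ENNReal.one_le_ofReal.2 hs) ENNReal.ofReal_ne_top _ _ h).trans_lt
        (ENNReal.mul_lt_top hC.lt_top hd.2)⟩
  have hw := hasWeakGradient_of_sub hΩ h hf.hasWeakGradient
  refine ⟨⟨?_, g, hw, hg⟩, h.memSobolevZero hΩ hΩb hΩL hs hz hd, hw.weakGrad_ae_eq hΩ⟩
  have := hz.add hf.1
  rwa [sub_add_cancel] at this

/-- Poincaré's inequality for the difference, with exponent one: its gradient is zero almost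
everywhere, so the gradients themselves need no integrability. -/
theorem HasZeroExt.ae_eq (hn : 1 ≤ n) {Ω : Set 𝔼} (hΩ : IsOpen Ω) (hΩb : Bornology.IsBounded Ω)
    {z w f : 𝔼 → ℝ} {g k l : 𝔼 → 𝔼} (h : HasZeroExt Ω (z - f) (g - l))
    (h' : HasZeroExt Ω (w - f) (k - l)) (hgk : g =ᵐ[volume.restrict Ω] k) :
    z =ᵐ[volume.restrict Ω] w := by
  obtain ⟨C, hC, hP⟩ := exists_poincare hn hΩ hΩb
  have h1 := h.sub h'
  rw [sub_sub_sub_cancel_right, sub_sub_sub_cancel_right] at h1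
  have h2 := hP 1 le_rfl ENNReal.one_ne_top _ _ h1
  have h3 : eLpNorm (g - k) 1 (volume.restrict Ω) = 0 := by
    rw [eLpNorm_congr_ae (g := 0), eLpNorm_zero]
    filter_upwards [hgk] with x hx
    simp [hx]
  rw [h3, mul_zero, nonpos_iff_eq_zero, eLpNorm_eq_zero_iff
    (h1.hasWeakGradient hΩ).1.aestronglyMeasurable one_ne_zero] at h2
  filter_upwards [h2] with x hx
  exact sub_eq_zero.1 hx

/-- Moving the weight into the field turns the energy into a power of a seminorm, for which the
triangle inequality is available. -/
theorem eLpNorm_weight_rpow {D : Set 𝔼} {s : ℝ} (hs : 0 < s) {β : 𝔼 → ℝ}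
    (hβ : ∀ᵐ x ∂(volume.restrict D), 0 ≤ β x) (g : 𝔼 → 𝔼) :
    eLpNorm (fun x => β x ^ (1 / s) • g x) (ENNReal.ofReal s) (volume.restrict D) ^ s =
      ∫⁻ x in D, ENNReal.ofReal (β x * ‖g x‖ ^ s) := by
  rw [eLpNorm_rpow_eq_lintegral hs]
  refine lintegral_congr_ae ?_
  filter_upwards [hβ] with x hx
  rw [norm_smul, Real.norm_of_nonneg (by positivity), Real.mul_rpow (by positivity)
    (norm_nonneg _), ← Real.rpow_mul hx, one_div_mul_cancel hs.ne', Real.rpow_one]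

theorem MemLinftyPos.exists_bound {D : Set 𝔼} {β : 𝔼 → ℝ} (hβ : MemLinftyPos D β) :
    ∃ c K : ℝ, 0 < c ∧ ∀ᵐ x ∂(volume.restrict D), c ≤ β x ∧ β x ≤ K := by
  obtain ⟨c, hc, h⟩ := hβ.2
  refine ⟨c, (eLpNormEssSup β (volume.restrict D)).toReal, hc, ?_⟩
  have h1 := ae_le_eLpNormEssSup (f := β) (μ := volume.restrict D)
  have h2 : eLpNormEssSup β (volume.restrict D) ≠ ⊤ := by
    have := hβ.1.2
    rw [eLpNorm_exponent_top] at this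
    exact this.ne
  filter_upwards [h, h1] with x hx hx1
  refine ⟨hx, (le_abs_self _).trans ?_⟩
  rw [← Real.norm_eq_abs, ← toReal_enorm]
  exact ENNReal.toReal_mono h2 hx1

end LimitProblem

/-! ### Existence and uniqueness for the limit problem. -/

section LimitMinimizer

variable {n : ℕ}

local notation "𝔼" => EuclideanSpace ℝ (Fin n)

theorem exists_norm_le_of_hasZeroExt_sub (hn : 1 ≤ n) {Ω : Set 𝔼} (hΩ : IsOpen Ω)
    (hΩb : Bornology.IsBounded Ω) {s : ℝ≥0∞} [hs : Fact (1 ≤ s)] (hs' : s ≠ ⊤) {f : 𝔼 → ℝ}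
    {k : 𝔼 → 𝔼} (hf : MemLp f s (volume.restrict Ω)) (hk : MemLp k s (volume.restrict Ω))
    {R : ℝ≥0∞} (hR : R ≠ ⊤) :
    ∃ R' : ℝ, ∀ V : sobolevSpace s Ω, HasZeroExt Ω (V.1.1 - f) (V.1.2 - k) →
      eLpNorm V.1.2 s (volume.restrict Ω) ≤ R → ‖V‖ ≤ R' := by
  obtain ⟨C, hC, hP⟩ := exists_poincare hn hΩ hΩb
  set T : ℝ≥0∞ := C * (R + eLpNorm k s (volume.restrict Ω)) + eLpNorm f s (volume.restrict Ω)
    with hT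
  have hTt : T ≠ ⊤ := ENNReal.add_ne_top.2 ⟨ENNReal.mul_ne_top hC
    (ENNReal.add_ne_top.2 ⟨hR, hk.2.ne⟩), hf.2.ne⟩
  refine ⟨(T + R).toReal, fun V hV hVR => norm_sobolevSpace_le V
    (ENNReal.add_ne_top.2 ⟨hTt, hR⟩) ?_ (hVR.trans le_add_self)⟩
  refine le_trans ?_ (le_self_add : T ≤ T + R)
  have h1 : (V.1.1 : 𝔼 → ℝ) = (⇑V.1.1 - f) + f := (sub_add_cancel _ _).symm
  have h2 := eLpNorm_sub_le (Lp.memLp V.1.2).1 hk.1 hs.out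
  calc eLpNorm V.1.1 s (volume.restrict Ω)
      ≤ eLpNorm (⇑V.1.1 - f) s (volume.restrict Ω) + eLpNorm f s (volume.restrict Ω) := by
        conv_lhs => rw [h1]
        exact eLpNorm_add_le ((Lp.memLp V.1.1).1.sub hf.1) hf.1 hs.out
    _ ≤ T := by
        refine add_le_add ((hP s hs.out hs' _ _ hV).trans (mul_le_mul_right ?_ C)) le_rfl
        exact h2.trans (add_le_add hVR le_rfl)

theorem eLpNorm_le_weight {D : Set 𝔼} {s c : ℝ} (hc : 0 < c) {β : 𝔼 → ℝ} (hs : 0 < s)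
    (hβ : ∀ᵐ x ∂(volume.restrict D), c ≤ β x) (g : 𝔼 → 𝔼) :
    eLpNorm g (ENNReal.ofReal s) (volume.restrict D) ≤ ENNReal.ofReal ((c ^ (1 / s))⁻¹) *
      eLpNorm (fun x => β x ^ (1 / s) • g x) (ENNReal.ofReal s) (volume.restrict D) := by
  refine eLpNorm_le_mul_eLpNorm_of_ae_le_mul ?_ _
  filter_upwards [hβ] with x hx
  have h1 : 0 < c ^ (1 / s) := Real.rpow_pos_of_pos hc _
  have h2 : c ^ (1 / s) ≤ β x ^ (1 / s) := Real.rpow_le_rpow hc.le hx (by positivity)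
  rw [norm_smul, Real.norm_of_nonneg (h1.le.trans h2), ← div_eq_inv_mul, le_div_iff₀ h1,
    mul_comm]
  exact mul_le_mul_of_nonneg_right h2 (norm_nonneg _)

theorem weightedEnergy_eq_of_ae {Ω A : Set 𝔼} {β : 𝔼 → ℝ} {s : ℝ}
    {z : 𝔼 → ℝ} {g : 𝔼 → 𝔼} (h : weakGrad Ω z =ᵐ[volume.restrict Ω] g) :
    weightedEnergy Ω A β s z = ∫⁻ x in Ω \ closure A, ENNReal.ofReal (β x * ‖g x‖ ^ s) := by
  refine lintegral_congr_ae ?_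
  filter_upwards [ae_mono (Measure.restrict_mono (sdiff_subset : Ω \ closure A ⊆ Ω) le_rfl) h]
    with x hx
  rw [hx]

theorem weightedEnergy_lt_top {Ω A : Set 𝔼} (hΩ : IsOpen Ω) {β : 𝔼 → ℝ} {s : ℝ} (hs : 0 < s)
    (hβ : MemLinftyPos (Ω \ closure A) β) {z : 𝔼 → ℝ} (hz : MemSobolev s Ω z) :
    weightedEnergy Ω A β s z < ⊤ := by
  obtain ⟨c, K, hc, hcK⟩ := hβ.exists_bound
  have hle : volume.restrict (Ω \ closure A) ≤ volume.restrict Ω :=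
    Measure.restrict_mono sdiff_subset le_rfl
  have h1 := lintegral_ofReal_rpow_lt_top hs ((hz.memLp_weakGrad hΩ).mono_measure hle)
  refine lt_of_le_of_lt ?_ (ENNReal.mul_lt_top (ENNReal.ofReal_lt_top (r := K)) h1)
  rw [← lintegral_const_mul' _ _ ENNReal.ofReal_ne_top]
  refine lintegral_mono_ae ?_
  filter_upwards [hcK] with x hx
  rw [← ENNReal.ofReal_mul (by linarith)]
  exact ENNReal.ofReal_le_ofReal (mul_le_mul_of_nonneg_right hx.2 (by positivity))

-- Direct method by intersection: the admissible functions with energy seminorm at most the infimum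
-- plus `1/(m+1)` form a decreasing sequence of nonempty bounded closed convex sets, and any common
-- point is a minimizer.
set_option maxHeartbeats 1000000 in
theorem exists_isLimitMinimizer (hn : 1 ≤ n) {Ω A : Set 𝔼} (hΩA : IsTwoPhaseDomain Ω A) {p₀ : ℝ}
    (hp₀ : 1 < p₀) {β : 𝔼 → ℝ} (hβ : MemLinftyPos (Ω \ closure A) β) {f : 𝔼 → ℝ}
    (hf : MemSobolev p₀ Ω f) : ∃ w, IsLimitMinimizer Ω A β p₀ f w := by
  have hΩ := hΩA.isOpen_Ω
  have hΩb := hΩA.isBounded_Ω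
  have hp0 : 0 < p₀ := by linarith
  have hfact : Fact (1 ≤ ENNReal.ofReal p₀) := ⟨ENNReal.one_le_ofReal.2 hp₀.le⟩
  set s := ENNReal.ofReal p₀ with hs
  set B := Ω \ closure A with hB
  have hBΩ : B ⊆ Ω := sdiff_subset
  have hAΩ : A ⊆ Ω := subset_closure.trans hΩA.closure_A_subset
  have hleA : volume.restrict A ≤ volume.restrict Ω := Measure.restrict_mono hAΩ le_rfl
  have hleB : volume.restrict B ≤ volume.restrict Ω := Measure.restrict_mono hBΩ le_rfl
  obtain ⟨c, K, hc, hcK⟩ := hβ.exists_bound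
  have hβ0 : ∀ᵐ x ∂(volume.restrict B), 0 ≤ β x := hcK.mono fun x hx => hc.le.trans hx.1
  set κ : 𝔼 → ℝ := fun x => β x ^ (1 / p₀) with hκ
  have hκm : AEStronglyMeasurable κ (volume.restrict B) :=
    (hβ.1.1.aemeasurable.pow_const _).aestronglyMeasurable
  have hκK : ∀ᵐ x ∂(volume.restrict B), ‖κ x‖ ≤ K ^ (1 / p₀) := by
    filter_upwards [hcK] with x hx
    have h0 : 0 ≤ β x := hc.le.trans hx.1
    rw [Real.norm_of_nonneg (by positivity)]
    exact Real.rpow_le_rpow h0 hx.2 (by positivity)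
  set N : sobolevSpace s Ω → ℝ≥0∞ := fun V =>
    eLpNorm (fun x => κ x • V.1.2 x) s (volume.restrict B) with hN
  have hNt : ∀ V, N V < ⊤ := fun V => by
    have h1 := eLpNorm_smul_le_of_bound (s := s) hκK V.1.2
    exact h1.trans_lt (ENNReal.mul_lt_top ENNReal.ofReal_lt_top
      ((Lp.memLp V.1.2).mono_measure hleB).2)
  set S : Set (sobolevSpace s Ω) := {V | HasZeroExt Ω (V.1.1 - f) (V.1.2 - weakGrad Ω f)} ∩
    {V | eLpNorm (fun x => (1 : ℝ) • V.1.2 x) s (volume.restrict A) ≤ 0} with hS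
  have hfg := hf.memLp_weakGrad hΩ
  have hlift : ∀ (z : 𝔼 → ℝ), MemSobolev p₀ Ω z →
      HasZeroExt Ω (z - f) (weakGrad Ω z - weakGrad Ω f) → weakGrad Ω z =ᵐ[volume.restrict A] 0 →
      ∃ V ∈ S, V.1.2 =ᵐ[volume.restrict Ω] weakGrad Ω z := by
    intro z hz hzf hzA
    obtain ⟨V, hV1, hV2⟩ := exists_sobolevSpace hΩ hz.hasWeakGradient hz.1 (hz.memLp_weakGrad hΩ)
    refine ⟨V, ⟨hzf.congr hΩ ?_ ?_, ?_⟩, hV2⟩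
    · filter_upwards [hV1] with x hx
      simp [hx]
    · filter_upwards [hV2] with x hx
      simp [hx]
    · refine le_of_eq ((eLpNorm_congr_ae (g := 0) ?_).trans eLpNorm_zero)
      filter_upwards [hzA, ae_mono hleA hV2] with x hx hx'
      rw [hx', hx]
      simp
  -- The admissible class is nonempty, so the infimum is finite.
  obtain ⟨f', hf', hf'f, hf'A⟩ := exists_datum_grad_eq_zero hΩA hf
  obtain ⟨V₀, hV₀, -⟩ := hlift f' hf' hf'f hf'A
  set i : ℝ≥0∞ := ⨅ V ∈ S, N V with hi
  have hit : i ≠ ⊤ := ((iInf₂_le V₀ hV₀).trans_lt (hNt V₀)).ne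
  set C : ℕ → Set (sobolevSpace s Ω) := fun m => S ∩ {V | N V ≤ i + ((m : ℝ≥0∞) + 1)⁻¹} with hC
  have hCa : Antitone C := fun m m' hmm' V hV => ⟨hV.1, hV.2.trans (add_le_add le_rfl
    (ENNReal.inv_le_inv.2 (add_le_add (by exact_mod_cast hmm') le_rfl)))⟩
  have hpos : ∀ m : ℕ, ((m : ℝ≥0∞) + 1)⁻¹ ≠ 0 := fun m =>
    ENNReal.inv_ne_zero.2 (ENNReal.add_ne_top.2 ⟨ENNReal.natCast_ne_top m, ENNReal.one_ne_top⟩)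
  have hCne : ∀ m, (C m).Nonempty := fun m => by
    have h1 : i < i + ((m : ℝ≥0∞) + 1)⁻¹ := ENNReal.lt_add_right hit (hpos m)
    obtain ⟨V, hV⟩ := iInf_lt_iff.1 h1
    obtain ⟨hVS, hVN⟩ := iInf_lt_iff.1 hV
    exact ⟨V, hVS, hVN.le⟩
  have hA1 : ∀ᵐ x ∂(volume.restrict A), ‖(fun _ : 𝔼 => (1 : ℝ)) x‖ ≤ 1 := by simp
  have hScl : IsClosed S := (isClosed_setOf_hasZeroExt_sub hΩ hf.1 hfg).inter
    (isClosed_setOf_eLpNorm_smul_grad_le hAΩ aestronglyMeasurable_const hA1 0)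
  have hSconv : Convex ℝ S := (convex_setOf_hasZeroExt_sub hΩ f (weakGrad Ω f)).inter
    (convex_setOf_eLpNorm_smul_grad_le hAΩ aestronglyMeasurable_const 0)
  have hSA : ∀ V ∈ S, V.1.2 =ᵐ[volume.restrict A] 0 := fun V hV => by
    have h1 : eLpNorm V.1.2 s (volume.restrict A) ≤ 0 := by
      have h2 : eLpNorm (fun x => (1 : ℝ) • V.1.2 x) s (volume.restrict A) ≤ 0 := hV.2
      simpa only [one_smul] using h2
    rwa [nonpos_iff_eq_zero, eLpNorm_eq_zero_iff ((Lp.memLp V.1.2).mono_measure hleA).1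
      (zero_lt_one.trans_le hfact.out).ne'] at h1
  set R : ℝ≥0∞ := ENNReal.ofReal ((c ^ (1 / p₀))⁻¹) * (i + 1) with hR
  have hRt : R ≠ ⊤ := ENNReal.mul_ne_top ENNReal.ofReal_ne_top
    (ENNReal.add_ne_top.2 ⟨hit, ENNReal.one_ne_top⟩)
  obtain ⟨R', hR'⟩ := exists_norm_le_of_hasZeroExt_sub hn hΩ hΩb (s := s) ENNReal.ofReal_ne_top
    hf.1 hfg hRt
  have hbd : ∀ V ∈ C 0, ‖V‖ ≤ R' := fun V hV => by
    refine hR' V hV.1.1 ((hΩA.eLpNorm_le hfact.out (Lp.memLp V.1.2).1).trans ?_)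
    rw [eLpNorm_congr_ae (hSA V hV.1), eLpNorm_zero, add_zero]
    refine (eLpNorm_le_weight hc hp0 (hcK.mono fun x hx => hx.1) V.1.2).trans
      (mul_le_mul_right (hV.2.trans ?_) _)
    simp
  obtain ⟨W, hW⟩ := (uniformlyConvexFun_sobolevSpace hp₀ Ω).nonempty_iInter hCa hCne
    (fun m => hScl.inter (isClosed_setOf_eLpNorm_smul_grad_le hBΩ hκm hκK _))
    (fun m => hSconv.inter (convex_setOf_eLpNorm_smul_grad_le hBΩ hκm _)) hbd
  have hWS : W ∈ S := (mem_iInter.1 hW 0).1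
  have hWN : N W ≤ i := by
    have h1 : Tendsto (fun m : ℕ => i + ((m : ℝ≥0∞) + 1)⁻¹) atTop (𝓝 (i + 0)) := by
      refine Tendsto.const_add i ?_
      have := (tendsto_add_atTop_iff_nat 1).2 ENNReal.tendsto_inv_nat_nhds_zero
      simpa using this
    rw [add_zero] at h1
    exact ge_of_tendsto' h1 fun m => (mem_iInter.1 hW m).2
  obtain ⟨h1, h2, h3⟩ := hWS.1.memSobolev_of_sub hn hΩ hΩb hΩA.lipschitz_Ω hp₀.le hf (Lp.memLp W.1.2)
  refine ⟨W.1.1, ⟨h1, h2, ?_⟩, fun z hz => ?_⟩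
  · filter_upwards [ae_mono hleA h3, hSA W hWS] with x hx hx'
    rw [hx, hx']
    simp
  · obtain ⟨V, hV, hV2⟩ := hlift z hz.1 (hz.2.1.hasZeroExt_sub hp₀.le hΩ hz.1 hf)
      (hz.2.2.mono fun x hx => norm_eq_zero.1 hx)
    change weightedEnergy Ω A β p₀ _ ≤ weightedEnergy Ω A β p₀ z
    rw [weightedEnergy_eq_of_ae h3, weightedEnergy_eq_of_ae hV2.symm,
      ← eLpNorm_weight_rpow hp0 hβ0, ← eLpNorm_weight_rpow hp0 hβ0]
    exact ENNReal.rpow_le_rpow (hWN.trans (iInf₂_le V hV)) hp0.le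

/-- The midpoint of two minimizers is admissible and cannot do better, so convexity is an equality
almost everywhere in `B`. Strictness makes the gradients agree there; in `A` both vanish, and the
common boundary values then identify the functions. -/
theorem IsLimitMinimizer.ae_eq (hn : 1 ≤ n) {Ω A : Set 𝔼} (hΩA : IsTwoPhaseDomain Ω A) {p₀ : ℝ}
    (hp₀ : 1 < p₀) {β : 𝔼 → ℝ} (hβ : MemLinftyPos (Ω \ closure A) β) {f : 𝔼 → ℝ}
    (hf : MemSobolev p₀ Ω f) {z w : 𝔼 → ℝ} (hz : IsLimitMinimizer Ω A β p₀ f z)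
    (hw : IsLimitMinimizer Ω A β p₀ f w) : z =ᵐ[volume.restrict Ω] w := by
  have hΩ := hΩA.isOpen_Ω
  have hΩb := hΩA.isBounded_Ω
  have hp0 : 0 < p₀ := by linarith
  obtain ⟨c, K, hc, hcK⟩ := hβ.exists_bound
  have hBΩ : Ω \ closure A ⊆ Ω := sdiff_subset
  have hAΩ : A ⊆ Ω := subset_closure.trans hΩA.closure_A_subset
  have hleA : volume.restrict A ≤ volume.restrict Ω := Measure.restrict_mono hAΩ le_rfl
  have hleB : volume.restrict (Ω \ closure A) ≤ volume.restrict Ω :=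
    Measure.restrict_mono hBΩ le_rfl
  obtain ⟨⟨hz1, hz2, hz3⟩, hzm⟩ := hz
  obtain ⟨⟨hw1, hw2, hw3⟩, hwm⟩ := hw
  have hzf := hz2.hasZeroExt_sub hp₀.le hΩ hz1 hf
  have hwf := hw2.hasZeroExt_sub hp₀.le hΩ hw1 hf
  have hzg := hz1.memLp_weakGrad hΩ
  have hwg := hw1.memLp_weakGrad hΩ
  have hlt := weightedEnergy_lt_top hΩ hp0 hβ hz1
  have heq : weightedEnergy Ω A β p₀ z = weightedEnergy Ω A β p₀ w :=
    le_antisymm (hzm ⟨hw1, hw2, hw3⟩) (hwm ⟨hz1, hz2, hz3⟩)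
  set g := weakGrad Ω z with hg
  set k := weakGrad Ω w with hk
  set y : 𝔼 → ℝ := (1 / 2 : ℝ) • (z + w) with hy
  have hyf : HasZeroExt Ω (y - f) ((1 / 2 : ℝ) • (g + k) - weakGrad Ω f) := by
    refine ((hzf.add hwf).const_smul (1 / 2)).congr hΩ (Eventually.of_forall fun x => ?_)
      (Eventually.of_forall fun x => ?_)
    · simp only [hy, Pi.smul_apply, Pi.add_apply, Pi.sub_apply, smul_eq_mul]
      ring
    · simp only [Pi.smul_apply, Pi.add_apply, Pi.sub_apply]
      module
  obtain ⟨hy1, hy2, hy3⟩ := hyf.memSobolev_of_sub hn hΩ hΩb hΩA.lipschitz_Ω hp₀.le hf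
    ((hzg.add hwg).const_smul (1 / 2 : ℝ))
  have hyA : ∀ᵐ x ∂(volume.restrict A), ‖weakGrad Ω y x‖ = 0 := by
    filter_upwards [ae_mono hleA hy3, hz3, hw3] with x hx hx1 hx2
    rw [norm_eq_zero] at hx1 hx2 ⊢
    rw [hx, Pi.smul_apply, Pi.add_apply, hx1, hx2]
    simp
  have hym : weightedEnergy Ω A β p₀ z ≤ weightedEnergy Ω A β p₀ y := hzm ⟨hy1, hy2, hyA⟩
  rw [weightedEnergy_eq_of_ae hy3] at hym
  have hmeas : ∀ {l : 𝔼 → 𝔼}, AEStronglyMeasurable l (volume.restrict Ω) →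
      AEMeasurable (fun x => ENNReal.ofReal (β x * ‖l x‖ ^ p₀)) (volume.restrict (Ω \ closure A)) :=
    fun hl => (hβ.1.1.aemeasurable.mul
      ((hl.mono_measure hleB).norm.aemeasurable.pow_const _)).ennreal_ofReal
  have havg : ∫⁻ x in Ω \ closure A, (ENNReal.ofReal (β x * ‖g x‖ ^ p₀) +
      ENNReal.ofReal (β x * ‖k x‖ ^ p₀)) / 2 = weightedEnergy Ω A β p₀ z := by
    simp_rw [ENNReal.div_eq_inv_mul]
    rw [lintegral_const_mul' _ _ (by simp), lintegral_add_left' (hmeas hzg.1)]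
    change 2⁻¹ * (weightedEnergy Ω A β p₀ z + weightedEnergy Ω A β p₀ w) = _
    rw [← heq, ← two_mul, ← mul_assoc, ENNReal.inv_mul_cancel two_ne_zero ENNReal.ofNat_ne_top,
      one_mul]
  have hval : ∀ᵐ x ∂(volume.restrict (Ω \ closure A)), (ENNReal.ofReal (β x * ‖g x‖ ^ p₀) +
      ENNReal.ofReal (β x * ‖k x‖ ^ p₀)) / 2 =
      ENNReal.ofReal (β x * ((‖g x‖ ^ p₀ + ‖k x‖ ^ p₀) / 2)) := by
    filter_upwards [hcK] with x hx
    have h0 : 0 ≤ β x := hc.le.trans hx.1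
    have h2 := ENNReal.ofReal_div_of_pos (x := β x * ‖g x‖ ^ p₀ + β x * ‖k x‖ ^ p₀) two_pos
    rw [ENNReal.ofReal_ofNat] at h2
    rw [← ENNReal.ofReal_add (by positivity) (by positivity), ← h2]
    congr 1
    ring
  have hle : (fun x => ENNReal.ofReal (β x * ‖((1 / 2 : ℝ) • (g + k)) x‖ ^ p₀))
      ≤ᵐ[volume.restrict (Ω \ closure A)] fun x => (ENNReal.ofReal (β x * ‖g x‖ ^ p₀) +
        ENNReal.ofReal (β x * ‖k x‖ ^ p₀)) / 2 := by
    filter_upwards [hval, hcK] with x hx hxc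
    rw [hx]
    exact ENNReal.ofReal_le_ofReal (mul_le_mul_of_nonneg_left
      (norm_half_add_rpow_le hp₀.le (g x) (k x)) (hc.le.trans hxc.1))
  have hae := ae_eq_of_ae_le_of_lintegral_le hle
    ((lintegral_mono_ae hle).trans_lt (havg ▸ hlt)).ne
    (((hmeas hzg.1).add (hmeas hwg.1)).div_const 2) (havg ▸ hym)
  refine hzf.ae_eq hn hΩ hΩb hwf (hΩA.ae_iff.2 ⟨?_, ?_⟩)
  · filter_upwards [hae, hval, hcK] with x hx hxv hxc
    by_contra hne
    have h0 : 0 < β x := hc.trans_le hxc.1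
    have h1 := norm_half_add_rpow_lt hp₀ hne
    rw [hxv] at hx
    have h2 := mul_lt_mul_of_pos_left h1 h0
    refine absurd hx (ne_of_lt ((ENNReal.ofReal_lt_ofReal_iff ?_).2 h2))
    exact lt_of_le_of_lt (by positivity) h2
  · filter_upwards [hz3, hw3] with x hx1 hx2
    rw [norm_eq_zero] at hx1 hx2
    rw [hx1, hx2]

end LimitMinimizer

/-! ### Energy upper bound and a priori estimates. -/

section SmallFieldProblem

variable {n : ℕ}

local notation "𝔼" => EuclideanSpace ℝ (Fin n)

/-- The standing assumptions on the domain, the exponents, the energy densities and the boundary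
datum. -/
structure IsSmallFieldProblem (Ω A : Set (EuclideanSpace ℝ (Fin n))) (p q p₀ q₀ : ℝ)
    (QB QA : EuclideanSpace ℝ (Fin n) → ℝ → ℝ) (Qlow Qup E₀ : ℝ)
    (β f : EuclideanSpace ℝ (Fin n) → ℝ) : Prop where
  dim : 1 ≤ n
  domain : IsTwoPhaseDomain Ω A
  one_lt_q₀ : 1 < q₀
  q₀_lt_p₀ : q₀ < p₀
  p₀_le_p : p₀ ≤ p
  q₀_le_q : q₀ ≤ q
  densityB : IsEnergyDensity (Ω \ closure A) QB
  densityA : IsEnergyDensity A QA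
  Qlow_pos : 0 < Qlow
  Qlow_le_Qup : Qlow ≤ Qup
  E₀_pos : 0 < E₀
  growthB : HasTwoPowerGrowth (Ω \ closure A) QB p₀ p Qlow Qup E₀
  growthA : HasTwoPowerGrowth A QA q₀ q Qlow Qup E₀
  limitB : HasSmallFieldLimit (Ω \ closure A) QB p₀ β
  datum : MemSobolev p Ω f

/-- The family `v` has the boundary values `f` and its scaled energies do not exceed those of the
`W^{1,p}` functions with the same boundary values and vanishing gradient in `A`. -/
def IsAlmostMinimizing (Ω A : Set (EuclideanSpace ℝ (Fin n))) (p p₀ q₀ : ℝ)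
    (QB QA : EuclideanSpace ℝ (Fin n) → ℝ → ℝ) (f : EuclideanSpace ℝ (Fin n) → ℝ)
    (v : ℝ → EuclideanSpace ℝ (Fin n) → ℝ) : Prop :=
  ∀ t > 0, MemSobolev q₀ Ω (v t) ∧ MemSobolevZero q₀ Ω (v t - f) ∧
    ∀ w, MemSobolev p Ω w → MemSobolevZero p Ω (w - f) → weakGrad Ω w =ᵐ[volume.restrict A] 0 →
      normalizedEnergy Ω A QB QA p₀ t (v t) ≤ normalizedEnergy Ω A QB QA p₀ t w

variable {Ω A : Set (EuclideanSpace ℝ (Fin n))} {p q p₀ q₀ : ℝ}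
  {QB QA : EuclideanSpace ℝ (Fin n) → ℝ → ℝ} {Qlow Qup E₀ : ℝ}
  {β f : EuclideanSpace ℝ (Fin n) → ℝ} {v : ℝ → EuclideanSpace ℝ (Fin n) → ℝ}

namespace IsSmallFieldProblem

theorem subset_A (h : IsSmallFieldProblem Ω A p q p₀ q₀ QB QA Qlow Qup E₀ β f) : A ⊆ Ω :=
  subset_closure.trans h.domain.closure_A_subset

theorem restrict_A_le (h : IsSmallFieldProblem Ω A p q p₀ q₀ QB QA Qlow Qup E₀ β f) :
    volume.restrict A ≤ volume.restrict Ω := Measure.restrict_mono h.subset_A le_rfl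

theorem restrict_B_le (Ω A : Set 𝔼) : volume.restrict (Ω \ closure A) ≤ volume.restrict Ω :=
  Measure.restrict_mono sdiff_subset le_rfl

theorem one_lt_p₀ (h : IsSmallFieldProblem Ω A p q p₀ q₀ QB QA Qlow Qup E₀ β f) : 1 < p₀ :=
  h.one_lt_q₀.trans h.q₀_lt_p₀

theorem p₀_pos (h : IsSmallFieldProblem Ω A p q p₀ q₀ QB QA Qlow Qup E₀ β f) : 0 < p₀ :=
  zero_lt_one.trans h.one_lt_p₀

theorem Qup_nonneg (h : IsSmallFieldProblem Ω A p q p₀ q₀ QB QA Qlow Qup E₀ β f) : 0 ≤ Qup :=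
  h.Qlow_pos.le.trans h.Qlow_le_Qup

theorem datum_p₀ (h : IsSmallFieldProblem Ω A p q p₀ q₀ QB QA Qlow Qup E₀ β f) :
    MemSobolev p₀ Ω f := h.datum.mono_exponent h.domain.isBounded_Ω h.p₀_le_p

theorem datum_q₀ (h : IsSmallFieldProblem Ω A p q p₀ q₀ QB QA Qlow Qup E₀ β f) :
    MemSobolev q₀ Ω f := h.datum_p₀.mono_exponent h.domain.isBounded_Ω h.q₀_lt_p₀.le

theorem volume_B_ne_top (h : IsSmallFieldProblem Ω A p q p₀ q₀ QB QA Qlow Qup E₀ β f) :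
    volume (Ω \ closure A) ≠ ⊤ :=
  ((measure_mono sdiff_subset).trans_lt h.domain.isBounded_Ω.measure_lt_top).ne

theorem normalizedEnergy_eq (h : IsSmallFieldProblem Ω A p q p₀ q₀ QB QA Qlow Qup E₀ β f)
    {w : 𝔼 → ℝ} (hwA : weakGrad Ω w =ᵐ[volume.restrict A] 0) (t : ℝ) :
    normalizedEnergy Ω A QB QA p₀ t w = ENNReal.ofReal (1 / t ^ p₀) *
      ∫⁻ x in Ω \ closure A, ENNReal.ofReal (QB x (t * ‖weakGrad Ω w x‖)) := by
  have h1 : ∫⁻ x in A, ENNReal.ofReal (QA x (t * ‖weakGrad Ω w x‖)) = 0 := by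
    rw [← lintegral_zero (μ := volume.restrict A)]
    refine lintegral_congr_ae ?_
    filter_upwards [hwA, h.densityA.map_zero] with x hx hx0
    rw [hx]
    simp [hx0]
  rw [normalizedEnergy, h1, add_zero]

theorem memLp_grad_B {s s' : ℝ} (hΩ : IsOpen Ω) (hΩb : Bornology.IsBounded Ω) {w : 𝔼 → ℝ}
    (hw : MemSobolev s Ω w) (hs : s' ≤ s) :
    MemLp (weakGrad Ω w) (ENNReal.ofReal s') (volume.restrict (Ω \ closure A)) :=
  ((hw.mono_exponent hΩb hs).memLp_weakGrad hΩ).mono_measure (restrict_B_le Ω A)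

theorem normalizedEnergy_lt_top (h : IsSmallFieldProblem Ω A p q p₀ q₀ QB QA Qlow Qup E₀ β f)
    {w : 𝔼 → ℝ} (hw : MemSobolev p Ω w) (hwA : weakGrad Ω w =ᵐ[volume.restrict A] 0) {t : ℝ}
    (ht : 0 < t) : normalizedEnergy Ω A QB QA p₀ t w < ⊤ := by
  rw [h.normalizedEnergy_eq hwA]
  have hΩ := h.domain.isOpen_Ω
  have hb := h.domain.isBounded_Ω
  exact ENNReal.mul_lt_top ENNReal.ofReal_lt_top (h.growthB.lintegral_lt_top h.p₀_pos h.p₀_le_p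
    h.Qup_nonneg h.E₀_pos (memLp_grad_B hΩ hb hw h.p₀_le_p) (memLp_grad_B hΩ hb hw le_rfl) ht)

theorem tendsto_normalizedEnergy (h : IsSmallFieldProblem Ω A p q p₀ q₀ QB QA Qlow Qup E₀ β f)
    {w : 𝔼 → ℝ} (hw : MemSobolev p Ω w) (hwA : weakGrad Ω w =ᵐ[volume.restrict A] 0) :
    Tendsto (fun t => normalizedEnergy Ω A QB QA p₀ t w) (𝓝[>] 0)
      (𝓝 (weightedEnergy Ω A β p₀ w)) := by
  simp_rw [h.normalizedEnergy_eq hwA]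
  have hΩ := h.domain.isOpen_Ω
  have hb := h.domain.isBounded_Ω
  exact tendsto_scaled_energy h.p₀_pos h.p₀_le_p h.Qup_nonneg h.E₀_pos h.densityB h.growthB
    h.limitB (memLp_grad_B hΩ hb hw h.p₀_le_p) (memLp_grad_B hΩ hb hw le_rfl)

/-- The minimizer need not be in `W^{1,p}`. Let `f'` be the modified datum with zero gradient in
`A`; then `w - f'` has zero boundary values and zero gradient in `A`, so it is approximated in
`W^{1,p₀}` by smooth `φ_k` with the same two properties. The functions `f' + φ_k` are in `W^{1,p}`
and their energies approach that of `w`. -/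
theorem exists_competitor (h : IsSmallFieldProblem Ω A p q p₀ q₀ QB QA Qlow Qup E₀ β f)
    {w : 𝔼 → ℝ} (hw : IsLimitMinimizer Ω A β p₀ f w) {r : ℝ≥0∞}
    (hr : weightedEnergy Ω A β p₀ w < r) :
    ∃ w', MemSobolev p Ω w' ∧ MemSobolevZero p Ω (w' - f) ∧
      weakGrad Ω w' =ᵐ[volume.restrict A] 0 ∧ weightedEnergy Ω A β p₀ w' < r := by
  have hΩ := h.domain.isOpen_Ω
  have hb := h.domain.isBounded_Ω
  have hL := h.domain.lipschitz_Ω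
  have hp1 : 1 ≤ p := h.one_lt_p₀.le.trans h.p₀_le_p
  obtain ⟨⟨hw1, hw2, hw3⟩, -⟩ := hw
  have hwf := hw2.hasZeroExt_sub h.one_lt_p₀.le hΩ hw1 h.datum_p₀
  obtain ⟨f', hf', hf'f, hf'A⟩ := exists_datum_grad_eq_zero h.domain h.datum
  have hf'p := hf'.mono_exponent hb h.p₀_le_p
  have hz := hwf.sub hf'f
  rw [sub_sub_sub_cancel_right, sub_sub_sub_cancel_right] at hz
  have hgw := hw1.memLp_weakGrad hΩ
  have hzA : weakGrad Ω w - weakGrad Ω f' =ᵐ[volume.restrict A] 0 := by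
    filter_upwards [hw3, hf'A] with x hx hx'
    rw [Pi.sub_apply, hx', norm_eq_zero.1 hx]
    simp
  obtain ⟨φ, hφ, -, hφg⟩ := exists_contDiff_approx_of_hasZeroExt hΩ hb hL h.domain.isOpen_A
    h.domain.lipschitz_A h.domain.closure_A_subset h.one_lt_p₀.le hz (hw1.1.sub hf'p.1)
    (hgw.sub (hf'p.memLp_weakGrad hΩ)) hzA
  obtain ⟨c, K, hc, hcK⟩ := h.limitB.1.exists_bound
  have hβ0 : ∀ᵐ x ∂(volume.restrict (Ω \ closure A)), 0 ≤ β x :=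
    hcK.mono fun x hx => hc.le.trans hx.1
  set κ : 𝔼 → ℝ := fun x => β x ^ (1 / p₀) with hκ
  have hκm : AEStronglyMeasurable κ (volume.restrict (Ω \ closure A)) :=
    (h.limitB.1.1.1.aemeasurable.pow_const _).aestronglyMeasurable
  have hκK : ∀ᵐ x ∂(volume.restrict (Ω \ closure A)), ‖κ x‖ ≤ K ^ (1 / p₀) := by
    filter_upwards [hcK] with x hx
    have h0 : 0 ≤ β x := hc.le.trans hx.1
    have hp := h.p₀_pos
    rw [Real.norm_of_nonneg (by positivity)]
    exact Real.rpow_le_rpow h0 hx.2 (by positivity)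
  set s := ENNReal.ofReal p₀ with hs
  have hs1 : 1 ≤ s := ENNReal.one_le_ofReal.2 h.one_lt_p₀.le
  set g : ℕ → 𝔼 → 𝔼 := fun k => weakGrad Ω f' + gradient (φ k) with hg
  have hφ1 : ∀ k, ContDiff ℝ 1 (φ k) := fun k => (hφ k).1.of_le (by norm_cast)
  have hφc : ∀ k, HasCompactSupport (gradient (φ k)) := fun k =>
    (hφ k).2.1.of_isClosed_subset (isClosed_tsupport _) (tsupport_gradient_subset _)
  have hgm : ∀ k, AEStronglyMeasurable (g k) (volume.restrict Ω) := fun k =>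
    (hf'p.memLp_weakGrad hΩ).1.add (continuous_gradient (hφ1 k)).aestronglyMeasurable
  set N : (𝔼 → 𝔼) → ℝ≥0∞ := fun l =>
    eLpNorm (fun x => κ x • l x) s (volume.restrict (Ω \ closure A)) with hN
  set δ : ℕ → ℝ≥0∞ := fun k => ENNReal.ofReal (K ^ (1 / p₀)) *
    eLpNorm (weakGrad Ω w - weakGrad Ω f' - gradient (φ k)) s (volume.restrict Ω) with hδ
  have hδ0 : Tendsto δ atTop (𝓝 0) := by
    have := ENNReal.Tendsto.const_mul hφg (Or.inr ENNReal.ofReal_ne_top)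
      (a := ENNReal.ofReal (K ^ (1 / p₀)))
    rwa [mul_zero] at this
  have hNle : ∀ k, N (g k) ≤ N (weakGrad Ω w) + δ k := fun k => by
    have e : (fun x => κ x • g k x) = (fun x => κ x • weakGrad Ω w x) -
        fun x => κ x • (weakGrad Ω w - weakGrad Ω f' - gradient (φ k)) x := by
      ext1 x
      simp only [hg, Pi.sub_apply, Pi.add_apply, ← smul_sub]
      congr 1
      abel
    have hm1 : AEStronglyMeasurable (fun x => κ x • weakGrad Ω w x)
        (volume.restrict (Ω \ closure A)) := hκm.smul (hgw.1.mono_measure (restrict_B_le Ω A))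
    have hm2 : AEStronglyMeasurable (weakGrad Ω w - weakGrad Ω f' - gradient (φ k))
        (volume.restrict Ω) := (hgw.1.sub (hf'p.memLp_weakGrad hΩ).1).sub
      (continuous_gradient (hφ1 k)).aestronglyMeasurable
    simp only [hN]
    rw [e]
    refine (eLpNorm_sub_le hm1 (hκm.smul (hm2.mono_measure (restrict_B_le Ω A))) hs1).trans
      (add_le_add le_rfl ((eLpNorm_smul_le_of_bound hκK _).trans ?_))
    exact mul_le_mul_right (eLpNorm_mono_measure _ (restrict_B_le Ω A)) _
  have hlim : Tendsto (fun k => (N (weakGrad Ω w) + δ k) ^ p₀) atTop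
      (𝓝 (N (weakGrad Ω w) ^ p₀)) := by
    have := (hδ0.const_add (N (weakGrad Ω w))).ennrpow_const p₀
    rwa [add_zero] at this
  rw [weightedEnergy, ← eLpNorm_weight_rpow h.p₀_pos hβ0] at hr
  obtain ⟨k, hk⟩ := (hlim.eventually_lt_const hr).exists
  have hfφ : HasZeroExt Ω (f' + φ k - f) (g k - weakGrad Ω f) := by
    have := hf'f.add (HasZeroExt.of_contDiff (hφ1 k) (hφ k).2.2.1)
    have e1 : f' + φ k - f = f' - f + φ k := by abel
    have e2 : g k - weakGrad Ω f = weakGrad Ω f' - weakGrad Ω f + gradient (φ k) := by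
      simp only [hg]
      abel
    rwa [e1, e2]
  obtain ⟨h1, h2, h3⟩ := hfφ.memSobolev_of_sub h.dim hΩ hb hL hp1 h.datum
    ((hf'.memLp_weakGrad hΩ).add
      (((continuous_gradient (hφ1 k)).memLp_of_hasCompactSupport (hφc k)).restrict Ω))
  refine ⟨f' + φ k, h1, h2, ?_, ?_⟩
  · filter_upwards [ae_mono h.restrict_A_le h3, hf'A,
      ae_restrict_mem h.domain.isOpen_A.measurableSet] with x hx hx' hxA
    rw [hx, show g k x = weakGrad Ω f' x + gradient (φ k) x from rfl, hx', (hφ k).2.2.2 x hxA]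
    simp
  · rw [weightedEnergy_eq_of_ae h3, ← eLpNorm_weight_rpow h.p₀_pos hβ0]
    exact (ENNReal.rpow_le_rpow (hNle k) h.p₀_pos.le).trans_lt hk

/-- The bound `limsup G_t(v^t) ≤ m`: the energies are compared with those of one fixed competitor
whose weighted energy is below `r`. -/
theorem eventually_normalizedEnergy_lt
    (h : IsSmallFieldProblem Ω A p q p₀ q₀ QB QA Qlow Qup E₀ β f)
    (hv : IsAlmostMinimizing Ω A p p₀ q₀ QB QA f v)
    {w : 𝔼 → ℝ} (hw : IsLimitMinimizer Ω A β p₀ f w) {r : ℝ≥0∞}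
    (hr : weightedEnergy Ω A β p₀ w < r) :
    ∀ᶠ t in 𝓝[>] 0, normalizedEnergy Ω A QB QA p₀ t (v t) < r := by
  obtain ⟨w', h1, h2, h3, h4⟩ := h.exists_competitor hw hr
  filter_upwards [(h.tendsto_normalizedEnergy h1 h3).eventually_lt_const h4, self_mem_nhdsWithin]
    with t ht ht0 using ((hv t ht0).2.2 w' h1 h2 h3).trans_lt ht

/-- Finiteness is needed for each `t > 0`, not only for small `t`, because membership in
`W^{1,p₀}(B)` is claimed for the whole family. -/
theorem normalizedEnergy_family_lt_top
    (h : IsSmallFieldProblem Ω A p q p₀ q₀ QB QA Qlow Qup E₀ β f)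
    (hv : IsAlmostMinimizing Ω A p p₀ q₀ QB QA f v) {t : ℝ} (ht : 0 < t) :
    normalizedEnergy Ω A QB QA p₀ t (v t) < ⊤ := by
  have hΩ := h.domain.isOpen_Ω
  have hb := h.domain.isBounded_Ω
  obtain ⟨f', hf', hf'f, hf'A⟩ := exists_datum_grad_eq_zero h.domain h.datum
  obtain ⟨h1, h2, h3⟩ := hf'f.memSobolev_of_sub h.dim hΩ hb h.domain.lipschitz_Ω
    (h.one_lt_p₀.le.trans h.p₀_le_p) h.datum (hf'.memLp_weakGrad hΩ)
  exact ((hv t ht).2.2 f' hf' h2 hf'A).trans_lt (h.normalizedEnergy_lt_top hf' hf'A ht)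

theorem eLpNorm_grad_B_rpow_le (h : IsSmallFieldProblem Ω A p q p₀ q₀ QB QA Qlow Qup E₀ β f)
    (u : 𝔼 → ℝ) {t : ℝ} (ht : 0 < t) :
    eLpNorm (weakGrad Ω u) (ENNReal.ofReal p₀) (volume.restrict (Ω \ closure A)) ^ p₀ ≤
      ENNReal.ofReal (E₀ ^ p₀ / Qlow) * normalizedEnergy Ω A QB QA p₀ t u := by
  rw [eLpNorm_rpow_eq_lintegral h.p₀_pos]
  refine (h.growthB.lintegral_rpow_le (r := p₀) h.Qlow_pos h.E₀_pos (weakGrad Ω u) ht).trans ?_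
  rw [sub_self, Real.rpow_zero, mul_one]
  exact mul_le_mul_right (mul_le_mul_right le_self_add _) _

theorem eLpNorm_grad_A_rpow_le (h : IsSmallFieldProblem Ω A p q p₀ q₀ QB QA Qlow Qup E₀ β f)
    (u : 𝔼 → ℝ) {t : ℝ} (ht : 0 < t) :
    eLpNorm (weakGrad Ω u) (ENNReal.ofReal q₀) (volume.restrict A) ^ q₀ ≤
      ENNReal.ofReal (E₀ ^ q₀ / Qlow * t ^ (p₀ - q₀)) * normalizedEnergy Ω A QB QA p₀ t u := by
  rw [eLpNorm_rpow_eq_lintegral (zero_lt_one.trans h.one_lt_q₀)]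
  refine (h.growthA.lintegral_rpow_le (r := p₀) h.Qlow_pos h.E₀_pos (weakGrad Ω u) ht).trans ?_
  exact mul_le_mul_right (mul_le_mul_right le_add_self _) _

theorem memLp_grad_B_family (h : IsSmallFieldProblem Ω A p q p₀ q₀ QB QA Qlow Qup E₀ β f)
    (hv : IsAlmostMinimizing Ω A p p₀ q₀ QB QA f v) {t : ℝ} (ht : 0 < t) :
    MemLp (weakGrad Ω (v t)) (ENNReal.ofReal p₀) (volume.restrict (Ω \ closure A)) := by
  refine ⟨((hv t ht).1.memLp_weakGrad h.domain.isOpen_Ω).1.mono_measure (restrict_B_le Ω A), ?_⟩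
  have h1 := (h.eLpNorm_grad_B_rpow_le (v t) ht).trans_lt (ENNReal.mul_lt_top
    ENNReal.ofReal_lt_top (h.normalizedEnergy_family_lt_top hv ht))
  exact (ENNReal.rpow_lt_top_iff_of_pos h.p₀_pos).1 h1

theorem exists_eventually_grad_B_le (h : IsSmallFieldProblem Ω A p q p₀ q₀ QB QA Qlow Qup E₀ β f)
    (hv : IsAlmostMinimizing Ω A p p₀ q₀ QB QA f v)
    {w : 𝔼 → ℝ} (hw : IsLimitMinimizer Ω A β p₀ f w) :
    ∃ R : ℝ≥0∞, R ≠ ⊤ ∧ ∀ᶠ t in 𝓝[>] 0, eLpNorm (weakGrad Ω (v t)) (ENNReal.ofReal p₀)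
      (volume.restrict (Ω \ closure A)) ≤ R := by
  have hlt := weightedEnergy_lt_top h.domain.isOpen_Ω h.p₀_pos h.limitB.1 hw.1.1
  set m := weightedEnergy Ω A β p₀ w with hm
  refine ⟨(ENNReal.ofReal (E₀ ^ p₀ / Qlow) * (m + 1)) ^ p₀⁻¹, ?_, ?_⟩
  · exact ENNReal.rpow_ne_top_of_nonneg (inv_nonneg.2 h.p₀_pos.le) (ENNReal.mul_ne_top
      ENNReal.ofReal_ne_top (ENNReal.add_ne_top.2 ⟨hlt.ne, ENNReal.one_ne_top⟩))
  · filter_upwards [h.eventually_normalizedEnergy_lt hv hw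
      (ENNReal.lt_add_right hlt.ne one_ne_zero), self_mem_nhdsWithin] with t ht ht0
    rw [ENNReal.le_rpow_inv_iff h.p₀_pos]
    exact (h.eLpNorm_grad_B_rpow_le (v t) ht0).trans (mul_le_mul_right ht.le _)

/-- The energies are bounded and carry the factor `t^{p₀-q₀}`, whose exponent is positive. -/
theorem tendsto_grad_A (h : IsSmallFieldProblem Ω A p q p₀ q₀ QB QA Qlow Qup E₀ β f)
    (hv : IsAlmostMinimizing Ω A p p₀ q₀ QB QA f v)
    {w : 𝔼 → ℝ} (hw : IsLimitMinimizer Ω A β p₀ f w) :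
    Tendsto (fun t => eLpNorm (weakGrad Ω (v t)) (ENNReal.ofReal q₀) (volume.restrict A))
      (𝓝[>] 0) (𝓝 0) := by
  have hlt := weightedEnergy_lt_top h.domain.isOpen_Ω h.p₀_pos h.limitB.1 hw.1.1
  have hq := zero_lt_one.trans h.one_lt_q₀
  set m := weightedEnergy Ω A β p₀ w with hm
  have hm1 : m + 1 ≠ ⊤ := ENNReal.add_ne_top.2 ⟨hlt.ne, ENNReal.one_ne_top⟩
  have h1 : Tendsto (fun t : ℝ => E₀ ^ q₀ / Qlow * t ^ (p₀ - q₀)) (𝓝[>] 0) (𝓝 0) := by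
    have h2 : Tendsto (fun t : ℝ => t ^ (p₀ - q₀)) (𝓝 0) (𝓝 0) := by
      have := (Real.continuousAt_rpow_const 0 (p₀ - q₀)
        (Or.inr (sub_pos.2 h.q₀_lt_p₀).le)).tendsto
      rwa [Real.zero_rpow (sub_pos.2 h.q₀_lt_p₀).ne'] at this
    have := (h2.const_mul (E₀ ^ q₀ / Qlow)).mono_left (nhdsWithin_le_nhds (s := Ioi 0))
    rwa [mul_zero] at this
  have h3 : Tendsto (fun t : ℝ => (ENNReal.ofReal (E₀ ^ q₀ / Qlow * t ^ (p₀ - q₀)) *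
      (m + 1)) ^ q₀⁻¹) (𝓝[>] 0) (𝓝 0) := by
    have h4 := (ENNReal.Tendsto.mul_const (ENNReal.tendsto_ofReal h1)
      (Or.inr hm1)).ennrpow_const q₀⁻¹
    rwa [ENNReal.ofReal_zero, zero_mul, ENNReal.zero_rpow_of_pos (inv_pos.2 hq)] at h4
  refine tendsto_of_tendsto_of_tendsto_of_le_of_le' tendsto_const_nhds h3
    (Eventually.of_forall fun _ => zero_le) ?_
  filter_upwards [h.eventually_normalizedEnergy_lt hv hw
    (ENNReal.lt_add_right hlt.ne one_ne_zero), self_mem_nhdsWithin] with t ht ht0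
  rw [ENNReal.le_rpow_inv_iff hq]
  exact (h.eLpNorm_grad_A_rpow_le (v t) ht0).trans (mul_le_mul_right ht.le _)

end IsSmallFieldProblem

end SmallFieldProblem

/-! ### Weak convergence in `Ω`. -/

section WeakConvergence

variable {n : ℕ}

local notation "𝔼" => EuclideanSpace ℝ (Fin n)

theorem exists_clm_inner {α E : Type*} [MeasurableSpace α] {μ : Measure α} [NormedAddCommGroup E]
    [InnerProductSpace ℝ E] {s : ℝ≥0∞} [hs : Fact (1 ≤ s)] {H : α → E}
    (hH : MemLp H s.conjExponent μ) :
    ∃ L : Lp E s μ →L[ℝ] ℝ, ∀ g, L g = ∫ x, inner ℝ (H x) (g x) ∂μ := by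
  have hconj : ENNReal.HolderConjugate s.conjExponent s :=
    (ENNReal.HolderConjugate.conjExponent hs.out).symm
  have hs' : Fact (1 ≤ s.conjExponent) := ⟨hconj.one_le⟩
  refine ⟨(innerSL ℝ).lpPairing μ s.conjExponent s (hH.toLp H), fun g => ?_⟩
  rw [ContinuousLinearMap.lpPairing_eq_integral]
  refine integral_congr_ae ?_
  filter_upwards [hH.coeFn_toLp] with x hx
  rw [hx, innerSL_apply_apply]

theorem exists_clm_grad {Ω D : Set 𝔼} (hΩ : volume Ω ≠ ⊤) (hDΩ : D ⊆ Ω) (hD : MeasurableSet D)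
    {s : ℝ≥0∞} [hs : Fact (1 ≤ s)] {H : 𝔼 → 𝔼} (hH : AEStronglyMeasurable H (volume.restrict D))
    {K : ℝ} (hK : ∀ᵐ x ∂(volume.restrict D), ‖H x‖ ≤ K) :
    ∃ L : sobolevSpace s Ω →L[ℝ] ℝ, ∀ V, L V = ∫ x in D, inner ℝ (H x) (V.1.2 x) := by
  have hμ : IsFiniteMeasure (volume.restrict D) :=
    ⟨by simpa using (measure_mono hDΩ).trans_lt hΩ.lt_top⟩
  have h1 : MemLp (D.indicator H) s.conjExponent (volume.restrict Ω) := by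
    rw [memLp_indicator_iff_restrict hD, Measure.restrict_restrict hD,
      inter_eq_self_of_subset_left hDΩ]
    exact MemLp.of_bound hH K hK
  obtain ⟨L, hL⟩ := exists_clm_inner h1
  refine ⟨L ∘L (ContinuousLinearMap.snd ℝ _ _) ∘L (sobolevSpace s Ω).subtypeL, fun V => ?_⟩
  refine (hL V.1.2).trans ?_
  have h2 : (fun x => inner ℝ (D.indicator H x) (V.1.2 x)) =
      D.indicator fun x => inner ℝ (H x) (V.1.2 x) := by
    ext1 x
    by_cases hx : x ∈ D <;> simp [hx]
  rw [h2, integral_indicator hD, Measure.restrict_restrict hD, inter_eq_self_of_subset_left hDΩ]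

theorem exists_clm_val {Ω : Set 𝔼} (hΩ : volume Ω ≠ ⊤) {s : ℝ≥0∞} [hs : Fact (1 ≤ s)]
    {φ : 𝔼 → ℝ} (hφ : AEStronglyMeasurable φ (volume.restrict Ω)) {K : ℝ} (hK : ∀ x, ‖φ x‖ ≤ K) :
    ∃ L : sobolevSpace s Ω →L[ℝ] ℝ, ∀ V, L V = ∫ x in Ω, φ x * V.1.1 x := by
  have hμ : IsFiniteMeasure (volume.restrict Ω) := ⟨by simpa using hΩ.lt_top⟩
  have h1 : MemLp φ s.conjExponent (volume.restrict Ω) :=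
    MemLp.of_bound hφ K (Eventually.of_forall hK)
  obtain ⟨L, hL⟩ := exists_clm_inner h1
  refine ⟨L ∘L (ContinuousLinearMap.fst ℝ _ _) ∘L (sobolevSpace s Ω).subtypeL, fun V => ?_⟩
  refine (hL V.1.1).trans (integral_congr_ae (Eventually.of_forall fun x => ?_))
  simp [mul_comm]

/-- Half-spaces are closed and convex, so inequalities between functionals pass to such a point as
they would to a weak limit. -/
theorem le_of_forall_convex {X ι : Type*} [NormedAddCommGroup X] [NormedSpace ℝ X] {l : Filter ι}
    {V : ι → X} {x : X} (hx : ∀ C : Set X, IsClosed C → Convex ℝ C → (∀ᶠ t in l, V t ∈ C) → x ∈ C)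
    (L : X →L[ℝ] ℝ) {r : ℝ} (hr : ∀ ε > 0, ∀ᶠ t in l, L (V t) ≤ r + ε) : L x ≤ r :=
  le_of_forall_pos_le_add fun ε hε => hx {y | L y ≤ r + ε} (isClosed_le L.continuous
    continuous_const) (convex_halfSpace_le L.toLinearMap.isLinear _) (hr ε hε)

theorem eq_of_forall_convex {X ι : Type*} [NormedAddCommGroup X] [NormedSpace ℝ X] {l : Filter ι}
    {V : ι → X} {x : X} (hx : ∀ C : Set X, IsClosed C → Convex ℝ C → (∀ᶠ t in l, V t ∈ C) → x ∈ C)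
    (L : X →L[ℝ] ℝ) {m : ℝ} (hm : Tendsto (fun t => L (V t)) l (𝓝 m)) : L x = m := by
  refine le_antisymm (le_of_forall_convex hx L fun ε hε =>
    (hm.eventually_lt_const (lt_add_of_pos_right m hε)).mono fun t ht => ht.le) ?_
  have h := le_of_forall_convex hx (-L) (r := -m) fun ε hε =>
    (hm.eventually_const_lt (sub_lt_self m hε)).mono fun t ht => by
      rw [neg_apply]
      linarith
  rw [neg_apply] at h
  linarith

/-- Supplies, for small `t`, the threshold condition under which the affine lower bound holds for
large fields. -/
theorem eventually_le_mul_div_rpow {c δ r a : ℝ} (hc : 0 < c) (hδ : 0 < δ) (hr : 0 < r) :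
    ∀ᶠ t : ℝ in 𝓝[>] 0, a ≤ c * (δ / t) ^ r := by
  have h1 : Tendsto (fun t : ℝ => δ / t) (𝓝[>] 0) atTop := by
    simp_rw [div_eq_mul_inv]
    exact tendsto_inv_nhdsGT_zero.const_mul_atTop hδ
  exact (((tendsto_rpow_atTop hr).comp h1).const_mul_atTop hc).eventually_ge_atTop a

variable {Ω A : Set (EuclideanSpace ℝ (Fin n))} {p q p₀ q₀ : ℝ}
  {QB QA : EuclideanSpace ℝ (Fin n) → ℝ → ℝ} {Qlow Qup E₀ : ℝ}
  {β f : EuclideanSpace ℝ (Fin n) → ℝ} {v : ℝ → EuclideanSpace ℝ (Fin n) → ℝ}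

namespace IsSmallFieldProblem

theorem exists_lift (h : IsSmallFieldProblem Ω A p q p₀ q₀ QB QA Qlow Qup E₀ β f)
    [Fact (1 ≤ ENNReal.ofReal q₀)] (hv : IsAlmostMinimizing Ω A p p₀ q₀ QB QA f v) :
    ∃ V : ℝ → sobolevSpace (ENNReal.ofReal q₀) Ω, ∀ t > 0, (V t).1.1 =ᵐ[volume.restrict Ω] v t ∧
      (V t).1.2 =ᵐ[volume.restrict Ω] weakGrad Ω (v t) ∧
      HasZeroExt Ω ((V t).1.1 - f) ((V t).1.2 - weakGrad Ω f) := by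
  have hΩ := h.domain.isOpen_Ω
  have h1 : ∀ t : ℝ, ∃ V : sobolevSpace (ENNReal.ofReal q₀) Ω, 0 < t →
      (V.1.1 =ᵐ[volume.restrict Ω] v t ∧ V.1.2 =ᵐ[volume.restrict Ω] weakGrad Ω (v t)) := by
    intro t
    by_cases ht : 0 < t
    · obtain ⟨V, hV⟩ := exists_sobolevSpace hΩ (hv t ht).1.hasWeakGradient (hv t ht).1.1
        ((hv t ht).1.memLp_weakGrad hΩ)
      exact ⟨V, fun _ => hV⟩
    · exact ⟨0, fun ht' => absurd ht' ht⟩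
  choose V hV using h1
  refine ⟨V, fun t ht => ⟨(hV t ht).1, (hV t ht).2, ?_⟩⟩
  refine ((hv t ht).2.1.hasZeroExt_sub h.one_lt_q₀.le hΩ (hv t ht).1 h.datum_q₀).congr hΩ ?_ ?_
  · filter_upwards [(hV t ht).1] with x hx
    simp [hx]
  · filter_upwards [(hV t ht).2] with x hx
    simp [hx]

set_option maxHeartbeats 1000000 in
/-- Lower semicontinuity of the scaled energies, in terms of closed half-spaces. -/
theorem weightedEnergy_le_of_forall_convex
    (h : IsSmallFieldProblem Ω A p q p₀ q₀ QB QA Qlow Qup E₀ β f)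
    [Fact (1 ≤ ENNReal.ofReal q₀)]
    (hv : IsAlmostMinimizing Ω A p p₀ q₀ QB QA f v) {w : 𝔼 → ℝ}
    (hw : IsLimitMinimizer Ω A β p₀ f w) {V : ℝ → sobolevSpace (ENNReal.ofReal q₀) Ω}
    (hV : ∀ t > 0, (V t).1.2 =ᵐ[volume.restrict Ω] weakGrad Ω (v t))
    {x : sobolevSpace (ENNReal.ofReal q₀) Ω}
    (hx : ∀ C : Set (sobolevSpace (ENNReal.ofReal q₀) Ω), IsClosed C → Convex ℝ C →
      (∀ᶠ t in 𝓝[>] 0, V t ∈ C) → x ∈ C) :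
    ∫⁻ y in Ω \ closure A, ENNReal.ofReal (β y * ‖x.1.2 y‖ ^ p₀) ≤ weightedEnergy Ω A β p₀ w := by
  have hΩ := h.domain.isOpen_Ω
  have hBm : MeasurableSet (Ω \ closure A) :=
    hΩ.measurableSet.diff isClosed_closure.measurableSet
  have hleB := restrict_B_le Ω A
  have hμ : IsFiniteMeasure (volume.restrict (Ω \ closure A)) :=
    ⟨by simpa using h.volume_B_ne_top.lt_top⟩
  have hlt := weightedEnergy_lt_top hΩ h.p₀_pos h.limitB.1 hw.1.1
  have hlow := h.growthB.mul_rpow_le h.Qlow_pos h.E₀_pos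
  set c := Qlow / E₀ ^ p₀ with hc
  have hc0 : 0 < c := div_pos h.Qlow_pos (Real.rpow_pos_of_pos h.E₀_pos _)
  obtain ⟨b, hbm, hb⟩ := h.limitB.exists_lower_envelope hc0.le h.densityB hlow
  obtain ⟨c', K, -, hcK⟩ := h.limitB.1.exists_bound
  rw [← ENNReal.ofReal_toReal hlt.ne]
  set m := (weightedEnergy Ω A β p₀ w).toReal with hm
  have hbK : ∀ᵐ y ∂(volume.restrict (Ω \ closure A)), ∀ k, 0 ≤ b k y ∧ b k y ≤ K := by
    filter_upwards [hb, hcK] with y hy hyK k using ⟨(hy.1 k).1, (hy.1 k).2.trans hyK.2⟩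
  refine lintegral_weight_le_of_affine_bounds h.volume_B_ne_top h.one_lt_p₀ hbm (b' := K) ?_
    (Lp.stronglyMeasurable _) fun k M Φ hΦ hΦM => ?_
  · filter_upwards [hb, hbK] with y hy hyK using ⟨hyK, hy.2.1⟩
  set H : 𝔼 → 𝔼 := fun y => (p₀ * b k y * ‖Φ y‖ ^ (p₀ - 2)) • Φ y with hH
  have hHm : AEStronglyMeasurable H (volume.restrict (Ω \ closure A)) :=
    ((((hbm k).const_mul p₀).mul (hΦ.norm.measurable.pow_const _).aemeasurable).aestronglyMeasurable).smul
      hΦ.aestronglyMeasurable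
  have hHK : ∀ᵐ y ∂(volume.restrict (Ω \ closure A)), ‖H y‖ ≤ p₀ * K * M ^ (p₀ - 1) := by
    filter_upwards [hbK] with y hy
    have h1 := h.p₀_pos
    have h2 := hy k
    have h3 : 0 ≤ K := h2.1.trans h2.2
    have h4 : 0 ≤ p₀ - 1 := by linarith [h.one_lt_p₀]
    simp only [hH]
    rw [mul_smul, norm_smul, norm_rpow_smul_self h.one_lt_p₀,
      Real.norm_of_nonneg (mul_nonneg h1.le h2.1)]
    exact mul_le_mul (mul_le_mul_of_nonneg_left h2.2 h1.le)
      (Real.rpow_le_rpow (norm_nonneg _) (hΦM y) h4) (by positivity) (by positivity)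
  -- Since `H` is bounded, pairing with it is continuous already on `W^{1,q₀}(Ω)`, the space where
  -- `x` lives; no `L^{p₀}` information on its gradient is used.
  obtain ⟨L, hL⟩ := exists_clm_grad (s := ENNReal.ofReal q₀)
    h.domain.isBounded_Ω.measure_lt_top.ne sdiff_subset hBm hHm hHK
  set r := ∫ y in Ω \ closure A, (p₀ - 1) * b k y * ‖Φ y‖ ^ p₀ with hr
  rw [← hL x]
  refine le_of_forall_convex hx L fun ε hε => ?_
  have hmε : weightedEnergy Ω A β p₀ w < ENNReal.ofReal (m + ε) := by
    rw [← ENNReal.ofReal_toReal hlt.ne]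
    exact (ENNReal.ofReal_lt_ofReal_iff (by positivity)).2 (by linarith)
  have hk0 : (0 : ℝ) < 1 / ((k : ℝ) + 1) := by positivity
  filter_upwards [h.eventually_normalizedEnergy_lt hv hw hmε,
    eventually_le_mul_div_rpow (a := p₀ * K * M ^ (p₀ - 1)) hc0 hk0
      (sub_pos.2 h.one_lt_p₀), self_mem_nhdsWithin] with t ht hMt ht0
  have ht0 : 0 < t := ht0
  have hGt := h.normalizedEnergy_family_lt_top hv ht0
  have hpart : ENNReal.ofReal (1 / t ^ p₀) * ∫⁻ y in Ω \ closure A,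
      ENNReal.ofReal (QB y (t * ‖weakGrad Ω (v t) y‖)) ≤
      normalizedEnergy Ω A QB QA p₀ t (v t) := mul_le_mul_right le_self_add _
  have hfin : ∫⁻ y in Ω \ closure A,
      ENNReal.ofReal (QB y (t * ‖weakGrad Ω (v t) y‖)) ≠ ⊤ := by
    intro htop
    rw [htop, ENNReal.mul_top (by simpa using Real.rpow_pos_of_pos ht0 p₀)] at hpart
    exact absurd hpart (not_le.2 hGt)
  have hgm := h.memLp_grad_B_family hv ht0
  have hint : Integrable (fun y => inner ℝ (H y) (weakGrad Ω (v t) y))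
      (volume.restrict (Ω \ closure A)) := by
    refine ((hgm.integrable (ENNReal.one_le_ofReal.2 h.one_lt_p₀.le)).norm.const_mul
      (p₀ * K * M ^ (p₀ - 1))).mono' (hHm.inner hgm.1) ?_
    filter_upwards [hHK] with y hy
    exact (norm_inner_le_norm _ _).trans (mul_le_mul_of_nonneg_right hy (norm_nonneg _))
  have h1 := setIntegral_inner_le_scaled_energy h.volume_B_ne_top h.one_lt_p₀ hc0.le hk0 ht0
    h.densityB hlow (hbm k) (b' := K) (by
      filter_upwards [hb, hbK] with y hy hyK using ⟨(hyK k).1, (hyK k).2, hy.2.2 k⟩)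
    hΦ.aestronglyMeasurable hΦM hMt hgm.1 hfin hint
  have h2 : L (V t) = ∫ y in Ω \ closure A, inner ℝ (H y) (weakGrad Ω (v t) y) := by
    rw [hL]
    refine integral_congr_ae ?_
    filter_upwards [ae_mono hleB (hV t ht0)] with y hy
    rw [hy]
  have h3 : (ENNReal.ofReal (1 / t ^ p₀) * ∫⁻ y in Ω \ closure A,
      ENNReal.ofReal (QB y (t * ‖weakGrad Ω (v t) y‖))).toReal ≤ m + ε :=
    ENNReal.toReal_le_of_le_ofReal (by positivity) (hpart.trans ht.le)
  rw [h2]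
  linarith

/-- In `B` the `L^{p₀}` bound is lowered to `L^{q₀}` by Hölder on a set of finite measure; in `A`
the gradients tend to zero. -/
theorem exists_eventually_grad_le (h : IsSmallFieldProblem Ω A p q p₀ q₀ QB QA Qlow Qup E₀ β f)
    (hv : IsAlmostMinimizing Ω A p p₀ q₀ QB QA f v) {w : 𝔼 → ℝ}
    (hw : IsLimitMinimizer Ω A β p₀ f w) :
    ∃ R : ℝ≥0∞, R ≠ ⊤ ∧ ∀ᶠ t in 𝓝[>] 0,
      eLpNorm (weakGrad Ω (v t)) (ENNReal.ofReal q₀) (volume.restrict Ω) ≤ R := by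
  have hq := zero_lt_one.trans h.one_lt_q₀
  obtain ⟨R, hR, hRB⟩ := h.exists_eventually_grad_B_le hv hw
  set T : ℝ≥0∞ := volume (Ω \ closure A) ^ (1 / q₀ - 1 / p₀) with hT
  have hTt : T ≠ ⊤ := ENNReal.rpow_ne_top_of_nonneg
    (sub_nonneg.2 (one_div_le_one_div_of_le hq h.q₀_lt_p₀.le)) h.volume_B_ne_top
  refine ⟨R * T + 1, ENNReal.add_ne_top.2 ⟨ENNReal.mul_ne_top hR hTt, ENNReal.one_ne_top⟩, ?_⟩
  filter_upwards [(h.tendsto_grad_A hv hw).eventually_lt_const one_pos, hRB,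
    self_mem_nhdsWithin] with t ht htB ht0
  have hg := (hv t ht0).1.memLp_weakGrad h.domain.isOpen_Ω
  refine (h.domain.eLpNorm_le (ENNReal.one_le_ofReal.2 h.one_lt_q₀.le) hg.1).trans
    (add_le_add ?_ ht.le)
  refine (eLpNorm_le_eLpNorm_mul_rpow_measure_univ
    (ENNReal.ofReal_le_ofReal h.q₀_lt_p₀.le) (hg.1.mono_measure (restrict_B_le Ω A))).trans ?_
  rw [Measure.restrict_apply_univ, ENNReal.toReal_ofReal hq.le, ENNReal.toReal_ofReal h.p₀_pos.le]
  exact mul_le_mul_left htB _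

-- A point lying in all closed convex sets that eventually contain the family has the right boundary
-- values, zero gradient in `A` and weighted energy at most the minimum. It is therefore a minimizer
-- of the limit problem, and uniqueness identifies it.
set_option maxHeartbeats 1000000 in
theorem sobolevWeakTendsto_Ω (h : IsSmallFieldProblem Ω A p q p₀ q₀ QB QA Qlow Qup E₀ β f)
    (hv : IsAlmostMinimizing Ω A p p₀ q₀ QB QA f v) {w : 𝔼 → ℝ}
    (hw : IsLimitMinimizer Ω A β p₀ f w) (hq : 1 ≤ q₀) : SobolevWeakTendsto q₀ hq Ω v w := by
  have hfact : Fact (1 ≤ ENNReal.ofReal q₀) := ⟨ENNReal.one_le_ofReal.mpr hq⟩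
  have hΩ := h.domain.isOpen_Ω
  have hΩb := h.domain.isBounded_Ω
  have hleA := h.restrict_A_le
  obtain ⟨V, hV⟩ := h.exists_lift hv
  have hwq := hw.1.1.mono_exponent hΩb h.q₀_lt_p₀.le
  obtain ⟨W, hW1, hW2⟩ := exists_sobolevSpace hΩ hwq.hasWeakGradient hwq.1 (hwq.memLp_weakGrad hΩ)
  refine ⟨V, W, fun t ht => (hV t ht).1, hW1, ?_⟩
  have hfg := h.datum_q₀.memLp_weakGrad hΩ
  obtain ⟨R, hR, hRt⟩ := h.exists_eventually_grad_le hv hw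
  obtain ⟨R', hR'⟩ := exists_norm_le_of_hasZeroExt_sub h.dim hΩ hΩb (s := ENNReal.ofReal q₀)
    ENNReal.ofReal_ne_top h.datum_q₀.1 hfg hR
  refine (uniformlyConvexFun_sobolevSpace h.one_lt_q₀ Ω).tendsto_of_forall_convex (R := R') ?_ ?_
  · filter_upwards [hRt, self_mem_nhdsWithin] with t ht ht0
    refine hR' _ (hV t ht0).2.2 ?_
    rwa [eLpNorm_congr_ae (hV t ht0).2.1]
  · intro x hx
    have hxf : HasZeroExt Ω (x.1.1 - f) (x.1.2 - weakGrad Ω f) :=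
      hx {V | HasZeroExt Ω (V.1.1 - f) (V.1.2 - weakGrad Ω f)}
        (isClosed_setOf_hasZeroExt_sub hΩ h.datum_q₀.1 hfg) (convex_setOf_hasZeroExt_sub hΩ _ _)
        (by filter_upwards [self_mem_nhdsWithin] with t ht using (hV t ht).2.2)
    have hxA : x.1.2 =ᵐ[volume.restrict A] 0 := by
      have hA1 : ∀ᵐ y ∂(volume.restrict A), ‖(fun _ : 𝔼 => (1 : ℝ)) y‖ ≤ 1 := by simp
      have h1 : ∀ ε : ℝ≥0∞, 0 < ε →
          eLpNorm x.1.2 (ENNReal.ofReal q₀) (volume.restrict A) ≤ ε := by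
        intro ε hε
        have h2 := hx {V | eLpNorm (fun y => (1 : ℝ) • V.1.2 y) (ENNReal.ofReal q₀)
          (volume.restrict A) ≤ ε} (isClosed_setOf_eLpNorm_smul_grad_le h.subset_A
            aestronglyMeasurable_const hA1 ε) (convex_setOf_eLpNorm_smul_grad_le h.subset_A
            aestronglyMeasurable_const ε) (by
            filter_upwards [(h.tendsto_grad_A hv hw).eventually_lt_const hε,
              self_mem_nhdsWithin] with t ht ht0
            refine le_trans (le_of_eq (eLpNorm_congr_ae ?_)) ht.le
            filter_upwards [ae_mono hleA (hV t ht0).2.1] with y hy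
            rw [hy, one_smul])
        have h3 : eLpNorm (fun y => (1 : ℝ) • x.1.2 y) (ENNReal.ofReal q₀)
          (volume.restrict A) ≤ ε := h2
        simpa only [one_smul] using h3
      have h2 : eLpNorm x.1.2 (ENNReal.ofReal q₀) (volume.restrict A) = 0 :=
        nonpos_iff_eq_zero.1 (le_of_forall_pos_le_add fun ε hε => by simpa using h1 ε hε)
      rwa [eLpNorm_eq_zero_iff ((Lp.memLp x.1.2).1.mono_measure hleA)
        (zero_lt_one.trans_le hfact.out).ne'] at h2
    have hE := h.weightedEnergy_le_of_forall_convex hv hw (fun t ht => (hV t ht).2.1) hx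
    obtain ⟨c, K, hc, hcK⟩ := h.limitB.1.exists_bound
    have hgB : eLpNorm x.1.2 (ENNReal.ofReal p₀) (volume.restrict (Ω \ closure A)) < ⊤ := by
      refine (eLpNorm_le_weight hc h.p₀_pos (hcK.mono fun y hy => hy.1) _).trans_lt
        (ENNReal.mul_lt_top ENNReal.ofReal_lt_top
          ((ENNReal.rpow_lt_top_iff_of_pos h.p₀_pos).1 ?_))
      rw [eLpNorm_weight_rpow h.p₀_pos (hcK.mono fun y hy => hc.le.trans hy.1)]
      exact hE.trans_lt (weightedEnergy_lt_top hΩ h.p₀_pos h.limitB.1 hw.1.1)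
    -- The energy bound improves the integrability of the gradient from `q₀` to `p₀`, as required
    -- for admissibility in the limit problem.
    have hgp : MemLp x.1.2 (ENNReal.ofReal p₀) (volume.restrict Ω) := by
      refine ⟨(Lp.memLp x.1.2).1, (h.domain.eLpNorm_le
        (ENNReal.one_le_ofReal.2 h.one_lt_p₀.le) (Lp.memLp x.1.2).1).trans_lt ?_⟩
      rw [eLpNorm_congr_ae hxA, eLpNorm_zero, add_zero]
      exact hgB
    obtain ⟨h1, h2, h3⟩ := hxf.memSobolev_of_sub h.dim hΩ hΩb h.domain.lipschitz_Ω
      h.one_lt_p₀.le h.datum_p₀ hgp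
    have hmin : IsLimitMinimizer Ω A β p₀ f x.1.1 := by
      refine ⟨⟨h1, h2, ?_⟩, fun z hz => ?_⟩
      · filter_upwards [ae_mono hleA h3, hxA] with y hy hy'
        rw [hy, hy']
        simp
      · change weightedEnergy Ω A β p₀ _ ≤ _
        rw [weightedEnergy_eq_of_ae h3]
        exact hE.trans (hw.2 hz)
    have hae := hmin.ae_eq h.dim h.domain h.one_lt_p₀ h.limitB.1 h.datum_p₀ hw
    have hgae : x.1.2 =ᵐ[volume.restrict Ω] weakGrad Ω w :=
      HasWeakGradient.ae_eq hΩ (x.2.congr hΩ hae EventuallyEq.rfl) hwq.hasWeakGradient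
    exact Subtype.ext (Prod.ext (Lp.ext (hae.trans hW1.symm)) (Lp.ext (hgae.trans hW2.symm)))

end IsSmallFieldProblem

end WeakConvergence

/-! ### Compactness, strong convergence in `A`, weak convergence in `B`. -/

section StrongConvergence

variable {n : ℕ}

local notation "𝔼" => EuclideanSpace ℝ (Fin n)

theorem HasZeroExt.eLpNorm_mollify_sub_le {Ω : Set 𝔼} {z : 𝔼 → ℝ} {g : 𝔼 → 𝔼}
    (hΩ : IsOpen Ω) (h : HasZeroExt Ω z g) {s : ℝ≥0∞} (hs : 1 ≤ s) (hs' : s ≠ ⊤)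
    (ρ : ContDiffBump (0 : 𝔼)) :
    eLpNorm (fun x => mollify ρ (Ω.indicator z) x - Ω.indicator z x) s volume ≤
      ENNReal.ofReal ρ.rOut * eLpNorm g s (volume.restrict Ω) := by
  refine _root_.eLpNorm_mollify_sub_le hs hs' ρ (locallyIntegrableOn_univ.1 h.1) fun a ha => ?_
  have h1 := HasWeakGradient.eLpNorm_translate_sub_le isOpen_univ h hs hs' (a := a) isOpen_univ
    fun _ _ _ _ => mem_univ _
  rw [Measure.restrict_univ, eLpNorm_indicator_eq_eLpNorm_restrict hΩ.measurableSet] at h1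
  refine h1.trans (mul_le_mul_left ?_ _)
  rw [← ofReal_norm]
  exact ENNReal.ofReal_le_ofReal ha.le

/-- Compactness of the embedding of `W^{1,s}_0` in `L^s`. -/
theorem HasZeroExt.tendsto_eLpNorm_of_weak (hn : 1 ≤ n) {Ω : Set 𝔼} (hΩ : IsOpen Ω)
    (hΩb : Bornology.IsBounded Ω) {s : ℝ} (hs : 1 ≤ s) {ι : Type*} {l : Filter ι}
    [l.IsCountablyGenerated] {z : ι → 𝔼 → ℝ} {g : ι → 𝔼 → 𝔼}
    (h : ∀ᶠ t in l, HasZeroExt Ω (z t) (g t)) {R : ℝ≥0∞} (hR : R ≠ ⊤)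
    (hg : ∀ᶠ t in l, eLpNorm (g t) (ENNReal.ofReal s) (volume.restrict Ω) ≤ R)
    (hweak : ∀ φ : 𝔼 → ℝ, Continuous φ → HasCompactSupport φ →
      Tendsto (fun t => ∫ x in Ω, φ x * z t x) l (𝓝 0)) :
    Tendsto (fun t => eLpNorm (z t) (ENNReal.ofReal s) (volume.restrict Ω)) l (𝓝 0) := by
  have hs0 : 0 < s := zero_lt_one.trans_le hs
  have hs1 : 1 ≤ ENNReal.ofReal s := ENNReal.one_le_ofReal.2 hs
  have hm := hΩ.measurableSet
  have hμ : IsFiniteMeasure (volume.restrict Ω) := ⟨by simpa using hΩb.measure_lt_top⟩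
  obtain ⟨C, hC, hP⟩ := exists_poincare hn hΩ hΩb
  set T : ℝ≥0∞ := volume Ω ^ (1 / (1 : ℝ) - 1 / s) with hT
  have hTt : T ≠ ⊤ := ENNReal.rpow_ne_top_of_nonneg
    (sub_nonneg.2 (one_div_le_one_div_of_le one_pos hs)) hΩb.measure_lt_top.ne
  set R₁ : ℝ≥0∞ := C * R * T with hR₁
  have hR₁t : R₁ ≠ ⊤ := ENNReal.mul_ne_top (ENNReal.mul_ne_top hC hR) hTt
  have hz1 : ∀ᶠ t in l, eLpNorm (z t) 1 (volume.restrict Ω) ≤ R₁ := by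
    filter_upwards [h, hg] with t ht htg
    have h1 := eLpNorm_le_eLpNorm_mul_rpow_measure_univ hs1
      (ht.hasWeakGradient hΩ).1.aestronglyMeasurable
    rw [Measure.restrict_apply_univ, ENNReal.toReal_one, ENNReal.toReal_ofReal hs0.le] at h1
    refine h1.trans (mul_le_mul_left ?_ _)
    exact (hP _ hs1 ENNReal.ofReal_ne_top _ _ ht).trans (mul_le_mul_right htg _)
  -- For a fixed kernel, weak convergence gives pointwise convergence of the mollifications, and the
  -- `L^1` bound gives a uniform bound; dominated convergence makes them tend to zero strongly.
  have hmoll : ∀ ρ : ContDiffBump (0 : 𝔼), Tendsto (fun t => eLpNorm (mollify ρ (Ω.indicator (z t)))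
      (ENNReal.ofReal s) (volume.restrict Ω)) l (𝓝 0) := by
    intro ρ
    have hρc : HasCompactSupport (ρ.normed volume) := ρ.hasCompactSupport_normed
    obtain ⟨S, hS⟩ := ρ.continuous_normed.bounded_above_of_compact_support hρc
    have hval : ∀ t x, mollify ρ (Ω.indicator (z t)) x =
        ∫ y in Ω, ρ.normed volume (x - y) * z t y := by
      intro t x
      rw [mollify_eq_integral_swap, ← integral_indicator hm]
      refine integral_congr_ae (Eventually.of_forall fun y => ?_)
      by_cases hy : y ∈ Ω <;> simp [hy]
    have hpt : ∀ x, Tendsto (fun t => mollify ρ (Ω.indicator (z t)) x) l (𝓝 0) := by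
      intro x
      simp_rw [hval]
      exact hweak _ (ρ.continuous_normed.comp (continuous_const.sub continuous_id))
        (hρc.comp_homeomorph (Homeomorph.subLeft x))
    have hbd : ∀ᶠ t in l, ∀ x, ‖mollify ρ (Ω.indicator (z t)) x‖ ≤ S * R₁.toReal := by
      filter_upwards [h, hz1] with t ht ht1
      intro x
      have hS0 : 0 ≤ S := (norm_nonneg _).trans (hS 0)
      have hzi : Integrable (z t) (volume.restrict Ω) := memLp_one_iff_integrable.1
        ⟨(ht.hasWeakGradient hΩ).1.aestronglyMeasurable, ht1.trans_lt hR₁t.lt_top⟩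
      rw [hval]
      calc ‖∫ y in Ω, ρ.normed volume (x - y) * z t y‖ ≤ ∫ y in Ω, S * ‖z t y‖ := by
            refine norm_integral_le_of_norm_le (hzi.norm.const_mul S)
              (Eventually.of_forall fun y => ?_)
            rw [norm_mul]
            exact mul_le_mul_of_nonneg_right (hS _) (norm_nonneg _)
        _ ≤ S * R₁.toReal := by
            rw [integral_const_mul, integral_norm_eq_lintegral_enorm hzi.1,
              ← eLpNorm_one_eq_lintegral_enorm]
            exact mul_le_mul_of_nonneg_left (ENNReal.toReal_mono hR₁t ht1) hS0
    have h1 : Tendsto (fun t => ∫⁻ x in Ω,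
        ENNReal.ofReal (‖mollify ρ (Ω.indicator (z t)) x‖ ^ s)) l (𝓝 0) := by
      rw [← lintegral_zero (μ := volume.restrict Ω)]
      refine tendsto_lintegral_filter_of_dominated_convergence'
        (fun _ => ENNReal.ofReal ((S * R₁.toReal) ^ s)) ?_ ?_ ?_ ?_
      · filter_upwards [h] with t ht
        have hcont := (contDiff_mollify ρ (locallyIntegrableOn_univ.1 ht.1)).continuous
        exact ((hcont.norm.measurable.pow_const s).ennreal_ofReal).aemeasurable
      · filter_upwards [hbd] with t ht
        exact Eventually.of_forall fun x => ENNReal.ofReal_le_ofReal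
          (Real.rpow_le_rpow (norm_nonneg _) (ht x) hs0.le)
      · rw [lintegral_const, Measure.restrict_apply_univ]
        exact ENNReal.mul_ne_top ENNReal.ofReal_ne_top hΩb.measure_lt_top.ne
      · refine Eventually.of_forall fun x => ?_
        have h2 := ((hpt x).norm.rpow_const (Or.inr hs0.le) (p := s))
        rw [norm_zero, Real.zero_rpow hs0.ne'] at h2
        simpa using ENNReal.tendsto_ofReal h2
    have h2 := h1.ennrpow_const s⁻¹
    rw [ENNReal.zero_rpow_of_pos (inv_pos.2 hs0)] at h2
    refine h2.congr fun t => ?_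
    rw [← eLpNorm_rpow_eq_lintegral hs0, ← ENNReal.rpow_mul, mul_inv_cancel₀ hs0.ne',
      ENNReal.rpow_one]
  rw [ENNReal.tendsto_nhds_zero]
  intro ε hε
  have hε2 : 0 < ε / 2 := ENNReal.half_pos hε.ne'
  -- The mollification error is at most the radius times the gradient bound, uniformly along the
  -- family.
  obtain ⟨r, hr, hrR⟩ : ∃ r : ℝ, 0 < r ∧ ENNReal.ofReal r * R ≤ ε / 2 := by
    have h1 : Tendsto (fun r : ℝ => ENNReal.ofReal r * R) (𝓝[>] 0) (𝓝 0) := by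
      have := ENNReal.Tendsto.mul_const (b := R)
        (ENNReal.tendsto_ofReal (tendsto_id (α := ℝ) (x := 𝓝 0))) (Or.inr hR)
      rw [ENNReal.ofReal_zero, zero_mul] at this
      exact this.mono_left nhdsWithin_le_nhds
    obtain ⟨r, hr1, hr2⟩ := ((h1.eventually_le_const hε2).and self_mem_nhdsWithin).exists
    exact ⟨r, hr2, hr1⟩
  set ρ := bumpOfRadius n r hr with hρ
  filter_upwards [h, hg, (hmoll ρ).eventually_le_const hε2] with t ht htg htm
  have hcont := (contDiff_mollify ρ (locallyIntegrableOn_univ.1 ht.1)).continuous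
  have hzm := (ht.hasWeakGradient hΩ).1.aestronglyMeasurable
  have h1 : eLpNorm (fun x => mollify ρ (Ω.indicator (z t)) x - Ω.indicator (z t) x)
      (ENNReal.ofReal s) (volume.restrict Ω) ≤ ε / 2 :=
    (eLpNorm_mono_measure _ Measure.restrict_le_self).trans
      ((ht.eLpNorm_mollify_sub_le hΩ hs1 ENNReal.ofReal_ne_top ρ).trans
        ((mul_le_mul_right htg _).trans hrR))
  have h2 : z t =ᵐ[volume.restrict Ω] mollify ρ (Ω.indicator (z t)) -
      fun x => mollify ρ (Ω.indicator (z t)) x - Ω.indicator (z t) x := by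
    filter_upwards [ae_restrict_mem hm] with x hx
    simp [hx]
  rw [eLpNorm_congr_ae h2, ← ENNReal.add_halves ε]
  refine (eLpNorm_sub_le hcont.aestronglyMeasurable (hcont.aestronglyMeasurable.sub
    (hzm.congr (indicator_ae_eq_restrict hm).symm)) hs1).trans (add_le_add htm h1)

variable {Ω A : Set (EuclideanSpace ℝ (Fin n))} {p q p₀ q₀ : ℝ}
  {QB QA : EuclideanSpace ℝ (Fin n) → ℝ → ℝ} {Qlow Qup E₀ : ℝ}
  {β f : EuclideanSpace ℝ (Fin n) → ℝ} {v : ℝ → EuclideanSpace ℝ (Fin n) → ℝ}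

theorem SobolevWeakTendsto.tendsto_integral_mul {Ω : Set 𝔼} (hΩ : volume Ω ≠ ⊤) {s : ℝ} {hs : 1 ≤ s}
    {v : ℝ → 𝔼 → ℝ} {w : 𝔼 → ℝ} (h : SobolevWeakTendsto s hs Ω v w) {φ : 𝔼 → ℝ}
    (hφ : Continuous φ) (hc : HasCompactSupport φ) :
    Tendsto (fun t => ∫ x in Ω, φ x * v t x) (𝓝[>] 0) (𝓝 (∫ x in Ω, φ x * w x)) := by
  have hfact : Fact (1 ≤ ENNReal.ofReal s) := ⟨ENNReal.one_le_ofReal.mpr hs⟩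
  obtain ⟨V, W, hV, hW, hlim⟩ := h
  obtain ⟨K, hK⟩ := hφ.bounded_above_of_compact_support hc
  obtain ⟨L, hL⟩ := exists_clm_val hΩ (s := ENNReal.ofReal s) hφ.aestronglyMeasurable hK
  have h1 := tendsto_toWeakSpace_apply hlim L
  have h2 : L W = ∫ x in Ω, φ x * w x := by
    rw [hL]
    refine integral_congr_ae ?_
    filter_upwards [hW] with x hx
    rw [hx]
  rw [h2] at h1
  refine h1.congr' ?_
  filter_upwards [self_mem_nhdsWithin] with t ht
  rw [hL]
  refine integral_congr_ae ?_
  filter_upwards [hV t ht] with x hx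
  rw [hx]

namespace IsSmallFieldProblem

/-- Compactness is applied in `Ω` to `v^t - w`, which has zero boundary values, so no compact
embedding on `A` is needed. The gradients in `A` tend to zero, which is the gradient of `w` there.
-/
theorem sobolevStrongTendsto_A (h : IsSmallFieldProblem Ω A p q p₀ q₀ QB QA Qlow Qup E₀ β f)
    (hv : IsAlmostMinimizing Ω A p p₀ q₀ QB QA f v) {w : 𝔼 → ℝ}
    (hw : IsLimitMinimizer Ω A β p₀ f w) : SobolevStrongTendsto q₀ A v w := by
  have hΩ := h.domain.isOpen_Ω
  have hΩb := h.domain.isBounded_Ω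
  have hA := h.domain.isOpen_A
  have hleA := h.restrict_A_le
  have hq1 := h.one_lt_q₀.le
  have hwq := hw.1.1.mono_exponent hΩb h.q₀_lt_p₀.le
  have hwgq := hwq.memLp_weakGrad hΩ
  have hfq := h.datum_q₀
  have hwf : HasZeroExt Ω (w - f) (weakGrad Ω w - weakGrad Ω f) :=
    hw.1.2.1.hasZeroExt_sub h.one_lt_p₀.le hΩ hw.1.1 h.datum_p₀
  refine ⟨fun t ht => (hv t ht).1.mono_set h.subset_A, hwq.mono_set h.subset_A, ?_⟩
  have hz : ∀ᶠ t in 𝓝[>] 0, HasZeroExt Ω (v t - w) (weakGrad Ω (v t) - weakGrad Ω w) := by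
    filter_upwards [self_mem_nhdsWithin] with t ht
    have h1 := ((hv t ht).2.1.hasZeroExt_sub hq1 hΩ (hv t ht).1 hfq).sub hwf
    rwa [sub_sub_sub_cancel_right, sub_sub_sub_cancel_right] at h1
  obtain ⟨R, hR, hRt⟩ := h.exists_eventually_grad_le hv hw
  have hgz : ∀ᶠ t in 𝓝[>] 0, eLpNorm (weakGrad Ω (v t) - weakGrad Ω w) (ENNReal.ofReal q₀)
      (volume.restrict Ω) ≤
      R + eLpNorm (weakGrad Ω w) (ENNReal.ofReal q₀) (volume.restrict Ω) := by
    filter_upwards [hRt, self_mem_nhdsWithin] with t ht ht0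
    exact (eLpNorm_sub_le ((hv t ht0).1.memLp_weakGrad hΩ).1 hwgq.1
      (ENNReal.one_le_ofReal.2 hq1)).trans (add_le_add ht le_rfl)
  have hweak := h.sobolevWeakTendsto_Ω hv hw hq1
  have hval := HasZeroExt.tendsto_eLpNorm_of_weak h.dim hΩ hΩb hq1 hz
    (ENNReal.add_ne_top.2 ⟨hR, hwgq.2.ne⟩) hgz fun φ hφ hc => by
      have h1 := hweak.tendsto_integral_mul hΩb.measure_lt_top.ne hφ hc
      have h2 := h1.sub_const (∫ x in Ω, φ x * w x)
      rw [sub_self] at h2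
      refine h2.congr' ?_
      obtain ⟨K, hK⟩ := hφ.bounded_above_of_compact_support hc
      have hμ : IsFiniteMeasure (volume.restrict Ω) := ⟨by simpa using hΩb.measure_lt_top⟩
      have hint : ∀ u : 𝔼 → ℝ, MemSobolev q₀ Ω u →
          Integrable (fun x => φ x * u x) (volume.restrict Ω) := fun u hu =>
        (hu.1.integrable (ENNReal.one_le_ofReal.2 hq1)).bdd_mul hφ.aestronglyMeasurable
          (Eventually.of_forall hK)
      filter_upwards [self_mem_nhdsWithin] with t ht
      rw [← integral_sub (hint _ (hv t ht).1) (hint _ hwq)]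
      simp [mul_sub]
  have hgrad := h.tendsto_grad_A hv hw
  have hsum := hval.add hgrad
  rw [add_zero] at hsum
  refine tendsto_of_tendsto_of_tendsto_of_le_of_le' tendsto_const_nhds hsum
    (Eventually.of_forall fun _ => zero_le) ?_
  filter_upwards [self_mem_nhdsWithin] with t ht
  refine add_le_add (eLpNorm_mono_measure _ hleA) (le_of_eq (eLpNorm_congr_ae ?_))
  have h1 : HasWeakGradient A (v t - w) (weakGrad Ω (v t) - weakGrad Ω w) :=
    ((hv t ht).1.hasWeakGradient.sub hwq.hasWeakGradient).mono h.subset_A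
  filter_upwards [h1.weakGrad_ae_eq hA, hw.1.2.2] with x hx hx'
  rw [hx, Pi.sub_apply, norm_eq_zero.1 hx', sub_zero]

-- The Poincaré inequality outside `closure A` bounds the family in `W^{1,p₀}(B)`. The limit is then
-- identified without a second minimization argument: testing with smooth functions supported in
-- `B`, the weak convergence in `Ω` leaves only `w`.
set_option maxHeartbeats 1600000 in
theorem sobolevWeakTendsto_B (h : IsSmallFieldProblem Ω A p q p₀ q₀ QB QA Qlow Qup E₀ β f)
    (hv : IsAlmostMinimizing Ω A p p₀ q₀ QB QA f v) {w : 𝔼 → ℝ}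
    (hw : IsLimitMinimizer Ω A β p₀ f w) (hp : 1 ≤ p₀) :
    SobolevWeakTendsto p₀ hp (Ω \ closure A) v w := by
  have hfact : Fact (1 ≤ ENNReal.ofReal p₀) := ⟨ENNReal.one_le_ofReal.mpr hp⟩
  have hΩ := h.domain.isOpen_Ω
  have hΩb := h.domain.isBounded_Ω
  have hB : IsOpen (Ω \ closure A) := hΩ.sdiff isClosed_closure
  have hBΩ : Ω \ closure A ⊆ Ω := sdiff_subset
  have hle := restrict_B_le Ω A
  have hfp := h.datum_p₀.mono_set hBΩ
  have hfg := (h.datum_p₀.memLp_weakGrad hΩ).mono_measure hle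
  obtain ⟨C, hC, hP⟩ := exists_poincare_compl h.dim h.domain hfact.out
    (ENNReal.ofReal_ne_top (r := p₀))
  have hPB : ∀ (z : 𝔼 → ℝ) (g : 𝔼 → 𝔼), HasZeroExt Ω z g →
      eLpNorm z (ENNReal.ofReal p₀) (volume.restrict (Ω \ closure A)) ≤
        C * eLpNorm g (ENNReal.ofReal p₀) (volume.restrict (Ω \ closure A)) := by
    intro z g hz
    have h1 := hP _ _ (HasWeakGradient.mono hz (subset_univ _)) fun x hx =>
      indicator_of_notMem hx z
    have hset : Ω ∩ (closure A)ᶜ = Ω \ closure A := rfl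
    rwa [eLpNorm_indicator_eq_eLpNorm_restrict hΩ.measurableSet,
      eLpNorm_indicator_eq_eLpNorm_restrict hΩ.measurableSet,
      Measure.restrict_restrict hΩ.measurableSet, hset] at h1
  have hz : ∀ t > 0, eLpNorm (v t - f) (ENNReal.ofReal p₀) (volume.restrict (Ω \ closure A)) ≤
      C * (eLpNorm (weakGrad Ω (v t)) (ENNReal.ofReal p₀) (volume.restrict (Ω \ closure A)) +
        eLpNorm (weakGrad Ω f) (ENNReal.ofReal p₀) (volume.restrict (Ω \ closure A))) := by
    intro t ht
    refine (hPB _ _ ((hv t ht).2.1.hasZeroExt_sub h.one_lt_q₀.le hΩ (hv t ht).1 h.datum_q₀)).trans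
      (mul_le_mul_right ?_ _)
    exact eLpNorm_sub_le (h.memLp_grad_B_family hv ht).1 hfg.1 hfact.out
  have hvm : ∀ t > 0, MemLp (v t) (ENNReal.ofReal p₀) (volume.restrict (Ω \ closure A)) := by
    intro t ht
    have h1 : MemLp (v t - f) (ENNReal.ofReal p₀) (volume.restrict (Ω \ closure A)) :=
      ⟨((hv t ht).1.1.1.mono_measure hle).sub hfp.1.1, (hz t ht).trans_lt
        (ENNReal.mul_lt_top hC.lt_top
          (ENNReal.add_lt_top.2 ⟨(h.memLp_grad_B_family hv ht).2, hfg.2⟩))⟩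
    have h2 := h1.add hfp.1
    rwa [sub_add_cancel] at h2
  have hlift : ∀ t : ℝ, ∃ V : sobolevSpace (ENNReal.ofReal p₀) (Ω \ closure A), 0 < t →
      (V.1.1 =ᵐ[volume.restrict (Ω \ closure A)] v t ∧
        V.1.2 =ᵐ[volume.restrict (Ω \ closure A)] weakGrad Ω (v t)) := by
    intro t
    by_cases ht : 0 < t
    · obtain ⟨V, hV⟩ := exists_sobolevSpace hB ((hv t ht).1.hasWeakGradient.mono hBΩ) (hvm t ht)
        (h.memLp_grad_B_family hv ht)
      exact ⟨V, fun _ => hV⟩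
    · exact ⟨0, fun ht' => absurd ht' ht⟩
  choose V hV using hlift
  obtain ⟨W, hW1, hW2⟩ := exists_sobolevSpace hB (hw.1.1.hasWeakGradient.mono hBΩ)
    (hw.1.1.1.mono_measure hle) ((hw.1.1.memLp_weakGrad hΩ).mono_measure hle)
  refine ⟨V, W, fun t ht => (hV t ht).1, hW1, ?_⟩
  obtain ⟨R, hR, hRt⟩ := h.exists_eventually_grad_B_le hv hw
  set R₁ : ℝ≥0∞ := C * (R + eLpNorm (weakGrad Ω f) (ENNReal.ofReal p₀)
    (volume.restrict (Ω \ closure A))) +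
    eLpNorm f (ENNReal.ofReal p₀) (volume.restrict (Ω \ closure A)) with hR₁
  have hR₁t : R₁ ≠ ⊤ := ENNReal.add_ne_top.2 ⟨ENNReal.mul_ne_top hC
    (ENNReal.add_ne_top.2 ⟨hR, hfg.2.ne⟩), hfp.1.2.ne⟩
  have hweak := h.sobolevWeakTendsto_Ω hv hw h.one_lt_q₀.le
  refine (uniformlyConvexFun_sobolevSpace h.one_lt_p₀ (Ω \ closure A)).tendsto_of_forall_convex
    (R := (R₁ + R).toReal) ?_ ?_
  · filter_upwards [hRt, self_mem_nhdsWithin] with t ht ht0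
    refine norm_sobolevSpace_le _ (ENNReal.add_ne_top.2 ⟨hR₁t, hR⟩) ?_ ?_
    · rw [eLpNorm_congr_ae (hV t ht0).1]
      refine le_trans ?_ (le_self_add : R₁ ≤ R₁ + R)
      have h1 : v t = (v t - f) + f := (sub_add_cancel _ _).symm
      rw [h1]
      refine (eLpNorm_add_le ((hvm t ht0).1.sub hfp.1.1) hfp.1.1 hfact.out).trans
        (add_le_add ((hz t ht0).trans (mul_le_mul_right (add_le_add ht le_rfl) _)) le_rfl)
    · rw [eLpNorm_congr_ae (hV t ht0).2]
      exact ht.trans le_add_self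
  · intro x hx
    have hBt : volume (Ω \ closure A) ≠ ⊤ := h.volume_B_ne_top
    have hxi := ((Lp.memLp x.1.1).locallyIntegrableOn_of_restrict hfact.out)
    have hwi := ((hw.1.1.1.mono_measure hle).locallyIntegrableOn_of_restrict hfact.out)
    have htest : ∀ φ : 𝔼 → ℝ, IsTestFunction (Ω \ closure A) φ →
        ∫ y, φ y • (⇑x.1.1 - w) y = 0 := by
      intro φ hφ
      obtain ⟨K, hK⟩ := hφ.1.continuous.bounded_above_of_compact_support hφ.2.1
      obtain ⟨L, hL⟩ := exists_clm_val hBt (s := ENNReal.ofReal p₀)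
        hφ.1.continuous.aestronglyMeasurable hK
      set m := ∫ y, φ y • w y with hm
      have hlim : Tendsto (fun t => L (V t)) (𝓝[>] 0) (𝓝 m) := by
        have h1 := hweak.tendsto_integral_mul hΩb.measure_lt_top.ne hφ.1.continuous hφ.2.1
        have h2 : ∫ y in Ω, φ y * w y = m := setIntegral_test_smul (hφ.mono hBΩ) w
        rw [h2] at h1
        refine h1.congr' ?_
        filter_upwards [self_mem_nhdsWithin] with t ht
        have h3 : ∫ y in Ω, φ y * v t y = ∫ y, φ y • v t y :=
          setIntegral_test_smul (hφ.mono hBΩ) (v t)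
        rw [h3, ← setIntegral_test_smul hφ, hL]
        refine integral_congr_ae ?_
        filter_upwards [(hV t ht).1] with y hy
        rw [hy, smul_eq_mul]
      have hLx := eq_of_forall_convex hx L hlim
      have h4 : ∫ y, φ y • x.1.1 y = m := by
        rw [← hLx, hL, ← setIntegral_test_smul hφ]
        rfl
      simp only [Pi.sub_apply, smul_sub]
      rw [integral_sub (integrable_smul_of_compact hxi hφ.1.continuous hφ.2.1 hφ.2.2)
        (integrable_smul_of_compact hwi hφ.1.continuous hφ.2.1 hφ.2.2), h4, sub_self]
    have hae : x.1.1 =ᵐ[volume.restrict (Ω \ closure A)] w := by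
      filter_upwards [ae_eq_zero_of_forall_test hB (hxi.sub hwi) htest] with y hy
      exact sub_eq_zero.1 hy
    have hgae : x.1.2 =ᵐ[volume.restrict (Ω \ closure A)] weakGrad Ω w :=
      HasWeakGradient.ae_eq hB (x.2.congr hB hae EventuallyEq.rfl)
        (hw.1.1.hasWeakGradient.mono hBΩ)
    exact Subtype.ext (Prod.ext (Lp.ext (hae.trans hW1.symm)) (Lp.ext (hgae.trans hW2.symm)))

end IsSmallFieldProblem

end StrongConvergence

/-! ### Reduction of both families to almost minimizers. -/

section Main

variable {n : ℕ}

local notation "𝔼" => EuclideanSpace ℝ (Fin n)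

theorem MemSobolevZero.mono_exponent {Ω : Set 𝔼} (hΩ : IsOpen Ω) (hΩb : Bornology.IsBounded Ω)
    (hΩL : HasLipschitzBoundary Ω) {s s' : ℝ} (hs' : 1 ≤ s') (hss : s' ≤ s) {z : 𝔼 → ℝ}
    (hz : MemSobolevZero s Ω z) : MemSobolevZero s' Ω z :=
  have h := hz.1.mono_exponent hΩb hss
  (hz.hasZeroExt (hs'.trans hss) hΩ).memSobolevZero hΩ hΩb hΩL hs' h.1 (h.memLp_weakGrad hΩ)

theorem MemSobolevZero.const_smul {Ω : Set 𝔼} (hΩ : IsOpen Ω) (hΩb : Bornology.IsBounded Ω)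
    (hΩL : HasLipschitzBoundary Ω) {s : ℝ} (hs : 1 ≤ s) {z : 𝔼 → ℝ}
    (hz : MemSobolevZero s Ω z) (c : ℝ) : MemSobolevZero s Ω (c • z) :=
  ((hz.hasZeroExt hs hΩ).const_smul c).memSobolevZero hΩ hΩb hΩL hs (hz.1.1.const_smul c)
    ((hz.1.memLp_weakGrad hΩ).const_smul c)

/-- Homogeneity of the weak gradient: scaling the field by `t` is the same as scaling the potential,
which links minimizers with datum `t f` to the normalized problem. -/
theorem normalizedEnergy_eq_dirichletEnergy {Ω A : Set 𝔼} (hΩ : IsOpen Ω) (hA : A ⊆ Ω)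
    (QB QA : 𝔼 → ℝ → ℝ) (p₀ : ℝ) {t : ℝ} (ht : 0 < t) {s : ℝ} {z : 𝔼 → ℝ} (hz : MemSobolev s Ω z) :
    normalizedEnergy Ω A QB QA p₀ t z =
      ENNReal.ofReal (1 / t ^ p₀) * dirichletEnergy Ω A QB QA (t • z) := by
  have h1 : ∀ᵐ x ∂(volume.restrict Ω), t * ‖weakGrad Ω z x‖ = ‖weakGrad Ω (t • z) x‖ := by
    filter_upwards [(hz.hasWeakGradient.const_smul t).weakGrad_ae_eq hΩ] with x hx
    rw [hx, Pi.smul_apply, norm_smul, Real.norm_of_nonneg ht.le]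
  rw [normalizedEnergy, dirichletEnergy]
  congr 2
  · refine lintegral_congr_ae ?_
    filter_upwards [ae_mono (Measure.restrict_mono (sdiff_subset : Ω \ closure A ⊆ Ω) le_rfl) h1]
      with x hx
    rw [hx]
  · refine lintegral_congr_ae ?_
    filter_upwards [ae_mono (Measure.restrict_mono hA le_rfl) h1] with x hx
    rw [hx]

variable {Ω A : Set (EuclideanSpace ℝ (Fin n))} {p q p₀ q₀ : ℝ}
  {QB QA : EuclideanSpace ℝ (Fin n) → ℝ → ℝ} {Qlow Qup E₀ : ℝ}
  {β f : EuclideanSpace ℝ (Fin n) → ℝ}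

namespace IsSmallFieldProblem

theorem isAlmostMinimizing_of_isNormalizedMinimizer
    (h : IsSmallFieldProblem Ω A p q p₀ q₀ QB QA Qlow Qup E₀ β f) {v : ℝ → 𝔼 → ℝ}
    (hv : ∀ t > 0, IsNormalizedMinimizer Ω A QB QA p₀ q₀ f t (v t)) :
    IsAlmostMinimizing Ω A p p₀ q₀ QB QA f v := fun t ht =>
  have hqp := h.q₀_lt_p₀.le.trans h.p₀_le_p
  ⟨(hv t ht).1.1, (hv t ht).1.2, fun _ hw hwf _ => (hv t ht).2
    ⟨hw.mono_exponent h.domain.isBounded_Ω hqp, hwf.mono_exponent h.domain.isOpen_Ω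
      h.domain.isBounded_Ω h.domain.lipschitz_Ω h.one_lt_q₀.le hqp⟩⟩

/-- Either space of the union embeds in `W^{1,q₀}`, with the corresponding zero boundary values, so
the scaled solution has the regularity required. For `w` in `W^{1,p}` with datum `f`, the function
`t w` belongs to the admissible union. -/
theorem isAlmostMinimizing_of_isPotential
    (h : IsSmallFieldProblem Ω A p q p₀ q₀ QB QA Qlow Qup E₀ β f) {u : ℝ → 𝔼 → ℝ}
    (hu : ∀ t > 0, IsPotential Ω A QB QA p q (t • f) (u t)) :
    IsAlmostMinimizing Ω A p p₀ q₀ QB QA f (fun t => t⁻¹ • u t) := by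
  intro t ht
  have hΩ := h.domain.isOpen_Ω
  have hb := h.domain.isBounded_Ω
  have hL := h.domain.lipschitz_Ω
  have hq1 := h.one_lt_q₀.le
  have hqp := h.q₀_lt_p₀.le.trans h.p₀_le_p
  obtain ⟨⟨hu1, hu2⟩, hmin⟩ := hu t ht
  have h1 : MemSobolev q₀ Ω (u t) :=
    hu1.elim (fun h' => h'.mono_exponent hb hqp) fun h' => h'.mono_exponent hb h.q₀_le_q
  have h2 : MemSobolevZero q₀ Ω (u t - t • f) :=
    hu2.elim (fun h' => h'.mono_exponent hΩ hb hL hq1 hqp)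
      fun h' => h'.mono_exponent hΩ hb hL hq1 h.q₀_le_q
  refine ⟨h1.const_smul _, ?_, fun w hw hwf _ => ?_⟩
  · have h3 := h2.const_smul hΩ hb hL hq1 t⁻¹
    rwa [smul_sub, inv_smul_smul₀ ht.ne'] at h3
  · rw [normalizedEnergy_eq_dirichletEnergy hΩ h.subset_A QB QA p₀ ht (h1.const_smul t⁻¹),
      normalizedEnergy_eq_dirichletEnergy hΩ h.subset_A QB QA p₀ ht hw, smul_inv_smul₀ ht.ne']
    refine mul_le_mul_right (hmin ⟨Or.inl (hw.const_smul t), Or.inl ?_⟩) _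
    have h3 := hwf.const_smul hΩ hb hL (hq1.trans hqp) t
    rwa [smul_sub] at h3

end IsSmallFieldProblem

end Main

theorem mainTheorem1 {n : ℕ} (hn : 2 ≤ n)
    (Ω A : Set (EuclideanSpace ℝ (Fin n))) (hΩA : IsTwoPhaseDomain Ω A)
    (p q p₀ q₀ : ℝ) (hq₀ : 1 < q₀) (hqp₀ : q₀ < p₀) (hp : p₀ ≤ p) (hq : q₀ ≤ q)
    (QB QA : EuclideanSpace ℝ (Fin n) → ℝ → ℝ)
    (hQB : IsEnergyDensity (Ω \ closure A) QB) (hQA : IsEnergyDensity A QA)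
    (Qlow Qup E₀ : ℝ) (hQlow : 0 < Qlow) (hQup : Qlow ≤ Qup) (hE₀ : 0 < E₀)
    (hgB : HasTwoPowerGrowth (Ω \ closure A) QB p₀ p Qlow Qup E₀)
    (hgA : HasTwoPowerGrowth A QA q₀ q Qlow Qup E₀)
    (β₀ : EuclideanSpace ℝ (Fin n) → ℝ) (hβ₀ : HasSmallFieldLimit (Ω \ closure A) QB p₀ β₀)
    (f : EuclideanSpace ℝ (Fin n) → ℝ) (hf : MemSobolev p Ω f) :
    ∃ w : EuclideanSpace ℝ (Fin n) → ℝ,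
      IsLimitMinimizer Ω A β₀ p₀ f w ∧
      (∀ w' : EuclideanSpace ℝ (Fin n) → ℝ, IsLimitMinimizer Ω A β₀ p₀ f w' →
        w' =ᵐ[volume.restrict Ω] w) ∧
      (∀ v : ℝ → EuclideanSpace ℝ (Fin n) → ℝ,
        (∀ t > 0, IsNormalizedMinimizer Ω A QB QA p₀ q₀ f t (v t)) →
          SobolevWeakTendsto p₀ (hq₀.trans hqp₀).le (Ω \ closure A) v w ∧
          SobolevStrongTendsto q₀ A v w ∧
          SobolevWeakTendsto q₀ hq₀.le Ω v w) ∧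
      (∀ u : ℝ → EuclideanSpace ℝ (Fin n) → ℝ,
        (∀ t > 0, IsPotential Ω A QB QA p q (t • f) (u t)) →
          SobolevWeakTendsto p₀ (hq₀.trans hqp₀).le (Ω \ closure A) (fun t => t⁻¹ • u t) w ∧
          SobolevStrongTendsto q₀ A (fun t => t⁻¹ • u t) w ∧
          SobolevWeakTendsto q₀ hq₀.le Ω (fun t => t⁻¹ • u t) w) := by
  have h : IsSmallFieldProblem Ω A p q p₀ q₀ QB QA Qlow Qup E₀ β₀ f :=
    ⟨by omega, hΩA, hq₀, hqp₀, hp, hq, hQB, hQA, hQlow, hQup, hE₀, hgB, hgA, hβ₀, hf⟩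
  obtain ⟨w, hw⟩ := exists_isLimitMinimizer h.dim hΩA h.one_lt_p₀ hβ₀.1 h.datum_p₀
  have key : ∀ v, IsAlmostMinimizing Ω A p p₀ q₀ QB QA f v →
      SobolevWeakTendsto p₀ (hq₀.trans hqp₀).le (Ω \ closure A) v w ∧
        SobolevStrongTendsto q₀ A v w ∧ SobolevWeakTendsto q₀ hq₀.le Ω v w := fun v hv =>
    ⟨h.sobolevWeakTendsto_B hv hw _, h.sobolevStrongTendsto_A hv hw,
      h.sobolevWeakTendsto_Ω hv hw _⟩
  exact ⟨w, hw, fun w' hw' => hw'.ae_eq h.dim hΩA h.one_lt_p₀ hβ₀.1 h.datum_p₀ hw,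
    fun v hv => key v (h.isAlmostMinimizing_of_isNormalizedMinimizer hv),
    fun u hu => key _ (h.isAlmostMinimizing_of_isPotential hu)⟩
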